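/- Let $s>s_1>\frac12$ and let $u:\mathbb R\to\mathbb R$ belong to $L^2_s(\mathbb R)$, where $L^p_r(\mathbb R)=\{f : (1+|x|)^r f\in L^p(\mathbb R)\}$. For $k\in\mathbb C\setminus[0,\infty)$ and $\lambda>0$ put $$G_k(x)=\frac1{2\pi}\int_0^\infty\frac{e^{ix\xi}}{\xi-k}\,d\xi,\qquad G_{\lambda\pm0i}(x)=\pm i e^{i\lambda x}\chi_{\mathbb R^\pm}(x)-\frac1{2\pi}\int_{-\infty}^0\frac{e^{ix\xi}}{\xi-\lambda}\,d\xi$$ (improper integrals, convergent for $x\ne0$; $\mathbb R^+=(0,\infty)$, $\mathbb R^-=(-\infty,0)$). For $k\in(\mathbb C\setminus[0,\infty))\cup(\mathbb R^+\pm0i)$, the plane cut along $[0,\infty)$ with both edges $\lambda\pm 0i$, $\lambda>0$, attached (with $|\lambda\pm0i|=\lambda$), the Jost solution $m_1(\cdot,k)$ is the unique solution in $L^\infty_{-(s-s_1)}(\mathbb R)$ of $$m_1(x,k)=1+G_k*(u\,m_1(\cdot,k))(x),$$ and for $\lambda>0$ the Jost solution $m_e(\cdot,\lambda+0i)$ is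 the unique solution in $L^\infty_{-(s-s_1)}(\mathbb R)$ of $$m_e(x,\lambda+0i)=e^{i\lambda x}+G_{\lambda+0i}*(u\,m_e(\cdot,\lambda+0i))(x).$$ These exist and are unique (up to equality almost everywhere): $m_1(\cdot,k)$ for all $k$ in the cut plane with edges with $|k|$ sufficiently large, and $m_1(\cdot,\lambda+0i)$ and $m_e(\cdot,\lambda+0i)$ for every $\lambda>0$. For $\lambda>0$ set $$\Gamma(\lambda)=1+i\int_{\mathbb R}u(x)\,m_e(x,\lambda+0i)\,e^{-i\lambda x}\,dx,\qquad \beta(\lambda)=i\int_{\mathbb R}u(x)\,m_1(x,\lambda+0i)\,e^{-i\lambda x}\,dx.$$ Then 1. $\displaystyle\lim_{k\to\infty}\|m_1(\cdot,k)-1\|_{L^\infty(\mathbb R)}=0$, where $k\to\infty$ means $|k|\to\infty$ with $k\in(\mathbb C\setminus[0,\infty))\cup(\mathbb R^+\pm0i)$; 2. $\displaystyle\lim_{\lambda\to\infty}\Big\|m_e(x,\lambda+0i)-e^{i\lambda x}e^{i\int_{-\infty}^x u(t)\,dt}\Big\|_{L^\infty_x(\mathbb R)}=0$; 3. $\displaystyle\Gamma(\lambda)-e^{i\int_{\mathbb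 R}u(t)\,dt}=O\Big(\frac1\lambda\Big)$ as $\lambda\to\infty$; 4. $\beta\in L^2(a,\infty)$ for every $a>0$, and $\displaystyle\lim_{\lambda\to\infty}\beta(\lambda)=0$. -/

import Mathlib

open MeasureTheory Filter Asymptotics
open scoped ENNReal Topology

namespace BenjaminOno

/-- Membership in the weighted space `L^p_s(ℝ) = {f | w^s f ∈ L^p(ℝ)}`, with weight `w(x) = 1 + |x|`. -/
def MemWeightedLp {E : Type*} [NormedAddCommGroup E] [NormedSpace ℝ E]
    (p : ℝ≥0∞) (s : ℝ) (f : ℝ → E) : Prop :=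
  MemLp (fun x : ℝ => ((1 + |x|) ^ s : ℝ) • f x) p volume

/-- The plane wave `e^{iλx}`. -/
noncomputable def planeWave (l x : ℝ) : ℂ :=
  Complex.exp (Complex.I * l * x)

/-- `G_k(x) = (1/2π) ∫_0^∞ e^{ixξ} / (ξ - k) dξ`, for `k ∈ ℂ \ [0,∞)`. The integral is a
conditionally convergent improper integral (it converges for every `x ≠ 0`). -/
noncomputable def kernelG (k : ℂ) (x : ℝ) : ℂ :=
  limUnder atTop (fun R : ℝ =>
    (1 / (2 * Real.pi) : ℂ) * ∫ ξ in (0 : ℝ)..R, planeWave ξ x / ((ξ : ℂ) - k))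

/-- `G̃_k(x) = (1/2π) ∫_{-∞}^0 e^{ixξ} / (ξ - k) dξ`, for `k ∈ ℂ \ (-∞,0]`, again as an
improper integral. -/
noncomputable def kernelGTilde (k : ℂ) (x : ℝ) : ℂ :=
  limUnder atTop (fun R : ℝ =>
    (1 / (2 * Real.pi) : ℂ) * ∫ ξ in (-R)..(0 : ℝ), planeWave ξ x / ((ξ : ℂ) - k))

/-- The boundary kernel `G_{λ+0i}(x) = i e^{iλx} χ_{(0,∞)}(x) - G̃_λ(x)`, for `λ > 0`. -/
noncomputable def kernelGPlus (l x : ℝ) : ℂ :=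
  Set.indicator (Set.Ioi 0) (fun t => Complex.I * planeWave l t) x - kernelGTilde (l : ℂ) x

/-- The boundary kernel `G_{λ-0i}(x) = -i e^{iλx} χ_{(-∞,0)}(x) - G̃_λ(x)`, for `λ > 0`. -/
noncomputable def kernelGMinus (l x : ℝ) : ℂ :=
  Set.indicator (Set.Iio 0) (fun t => -Complex.I * planeWave l t) x - kernelGTilde (l : ℂ) x

/-- The set `(ℂ \ [0,∞)) ∪ (ℝ⁺ ± 0i)`: the plane cut along `[0,∞)`, with two copies of the
positive half line glued to it. -/
inductive CutPlane : Type
  /-- a point `k ∈ ℂ \ [0,∞)` -/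
  | inner (k : ℂ) (hk : ∀ r : ℝ, 0 ≤ r → k ≠ (r : ℂ)) : CutPlane
  /-- the point `λ + 0i`, with `λ > 0` -/
  | upper (l : ℝ) (hl : 0 < l) : CutPlane
  /-- the point `λ - 0i`, with `λ > 0` -/
  | lower (l : ℝ) (hl : 0 < l) : CutPlane

/-- The modulus `|k|`; it is `λ` at `λ ± 0i`. -/
noncomputable def CutPlane.modulus : CutPlane → ℝ
  | .inner k _ => ‖k‖
  | .upper l _ => l
  | .lower l _ => l

/-- The filter of `k → ∞` in the cut plane. -/
noncomputable def CutPlane.atInfinity : Filter CutPlane :=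
  Filter.comap CutPlane.modulus atTop

/-- The kernel `G_k`, for `k` in the cut plane or on its boundary. -/
noncomputable def CutPlane.kernel : CutPlane → ℝ → ℂ
  | .inner k _ => kernelG k
  | .upper l _ => kernelGPlus l
  | .lower l _ => kernelGMinus l

/-- `m ∈ L^∞_{-a}(ℝ)` solves the integral equation `m = g + G * (u m)` (almost everywhere). -/
def IsSolution (u : ℝ → ℝ) (a : ℝ) (G g m : ℝ → ℂ) : Prop :=
  MemWeightedLp ∞ (-a) m ∧
    ∀ᵐ x ∂(volume : Measure ℝ), m x = g x + ∫ y, G (x - y) * ((u y : ℂ) * m y)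

/-- The equation `m = g + G * (u m)` has exactly one solution in `L^∞_{-a}(ℝ)`, functions that agree
almost everywhere being identified. -/
def UniquelySolvable (u : ℝ → ℝ) (a : ℝ) (G g : ℝ → ℂ) : Prop :=
  ∃ m, IsSolution u a G g m ∧ ∀ m', IsSolution u a G g m' → m' =ᵐ[volume] m

open Classical in
/-- (A representative of) the solution in `L^∞_{-a}(ℝ)` of `m = g + G * (u m)`; it is `0` if there
is no solution. -/
noncomputable def solution (u : ℝ → ℝ) (a : ℝ) (G g : ℝ → ℂ) : ℝ → ℂ :=
  if h : ∃ m, IsSolution u a G g m then h.choose else 0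

/-- The Jost solution `m_1(·,k)`: `m_1 = 1 + G_k * (u m_1)`. -/
noncomputable def jostOne (u : ℝ → ℝ) (a : ℝ) (k : CutPlane) : ℝ → ℂ :=
  solution u a k.kernel (fun _ => 1)

/-- The Jost solution `m_1(·,λ+0i)`, `λ > 0`, that is, `m_1(·,k)` at the boundary point
`k = λ+0i`. -/
noncomputable def jostOnePlus (u : ℝ → ℝ) (a l : ℝ) : ℝ → ℂ :=
  solution u a (kernelGPlus l) (fun _ => 1)

/-- The Jost solution `m_e(·,λ+0i)`, `λ > 0`: `m_e = e^{iλx} + G_{λ+0i} * (u m_e)`. -/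
noncomputable def jostExpPlus (u : ℝ → ℝ) (a l : ℝ) : ℝ → ℂ :=
  solution u a (kernelGPlus l) (planeWave l)

/-- `Γ(λ) = 1 + i ∫ u(x) m_e(x,λ+0i) e^{-iλx} dx`. -/
noncomputable def scatteringGamma (u : ℝ → ℝ) (a l : ℝ) : ℂ :=
  1 + Complex.I * ∫ x, (u x : ℂ) * jostExpPlus u a l x * planeWave (-l) x

/-- `β(λ) = i ∫ u(x) m_1(x,λ+0i) e^{-iλx} dx`. -/
noncomputable def scatteringBeta (u : ℝ → ℝ) (a l : ℝ) : ℂ :=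
  Complex.I * ∫ x, (u x : ℂ) * jostOnePlus u a l x * planeWave (-l) x

end BenjaminOno

open BenjaminOno

/-! Everything takes place on bounded continuous functions. The kernels are Fourier multipliers:
`G_k` has symbol `1/(2πη - k)` on `η > 0`, and `G̃_k` has the same expression on `η < 0`
(`conv_kernelG`, `conv_kernelGTilde`). A multiplier with symbol `q ∈ L²` maps `L¹ ∩ L²` into bounded
continuous functions, with sup norm at most `‖q‖₂` times the `L²` norm (`norm_mulOp_le`). For `Im k
> 0` the two half-line symbols add up to the transform of `i e^{ikx}` on `x > 0`
(`mulOp_symbol_add_eq_volterra`), so the equation becomes `(1 - V + P) m = g` with `V` a Volterra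
operator and `P` coming from `G̃_k`. On the upper edge this is the definition of the kernel.

When `Re k ≥ 0` the norm of `P` is `O(|k|^{-1/2})`. The operator `V` is not small, but an
integrating factor inverts `1 - V` exactly: the inverse is `R = 1 + E V E⁻¹`, where `E` multiplies
by `e^{i∫_{-∞}^x u}` (`one_sub_vOp_mul_rOp`, `rOp_mul_one_sub_vOp`). For `m_1` the function `R 1 -
1` is an oscillatory integral that vanishes uniformly as `|k| → ∞` (`exists_norm_volterra_le`). For
`Re k ≤ 0` the convolution with `G_k` is itself small. The remaining quadrant and the lower edge
follow by complex conjugation together with `x ↦ -x` (`NearOne.reflect`).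

For arbitrary `λ > 0` the gauge `m = e^{iλx} n` replaces `V` by its `k = 0` version and turns the
symbol of `P` into the real function `1/(2πη)` cut off to `η < -λ/2π`. Since `P` is compact
(`isCompactOperator_pOp`), the Fredholm alternative leaves only uniqueness to prove
(`eq_zero_of_homogeneous`). Let `n` solve the homogeneous equation and put `g = u n`. Pairing the
equation with the conjugate of `g` and taking imaginary parts gives `∫ g = 0`. This cancellation
starts a bootstrap to `n = O(1/|x|)` (`exists_decay`). Then `n` is the inverse transform of `ψ`
restricted to `η ≥ -λ/2π`, where `2πηψ = 𝓕 g`, and a virial identity forces `ψ = 0` there.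

As `λ → ∞` everything is read off from `n = R (b - P n)`. For `m_e` the gauged inhomogeneity is `b =
1`, and `R 1 = e^{i∫u}` is the claimed limit. The functional `i ∫ u R(·)` has a closed form
(`integral_mul_rGauge`), and pairing `P n` with an `L²` function costs only the supremum of the
symbol, at most `1/λ` (`norm_remainder_le`); this yields the rate for `Γ`. For `β` the main term is
the Fourier transform of a function in `L¹ ∩ L²` evaluated at `λ/2π`, and the error is `O(1/λ)` and
continuous in `λ`. -/

namespace BenjaminOno

open scoped FourierTransform BoundedContinuousFunction ComplexConjugate

/-! ### The `L²` norm and Plancherel's theorem -/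

/-- The `L²` norm as a real number. -/
noncomputable def l2 (f : ℝ → ℂ) : ℝ := (eLpNorm f 2 volume).toReal

theorem l2_nonneg (f : ℝ → ℂ) : 0 ≤ l2 f := ENNReal.toReal_nonneg

theorem l2_sq {f : ℝ → ℂ} (hf : MemLp f 2) : l2 f ^ 2 = ∫ x, ‖f x‖ ^ 2 := by
  have h := hf.eLpNorm_eq_integral_rpow_norm (by norm_num) (by norm_num)
  have hn : 0 ≤ ∫ x, ‖f x‖ ^ 2 := integral_nonneg fun x => by positivity
  simp only [ENNReal.toReal_ofNat, Real.rpow_ofNat] at h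
  rw [l2, h, ENNReal.toReal_ofReal (by positivity), ← one_div, ← Real.sqrt_eq_rpow]
  exact Real.sq_sqrt hn

theorem integrable_mul_of_memLp_two {f g : ℝ → ℂ} (hf : MemLp f 2) (hg : MemLp g 2) :
    Integrable (fun x => f x * g x) :=
  MemLp.integrable_mul hf hg

theorem integral_norm_mul_le_l2 {f g : ℝ → ℂ} (hf : MemLp f 2) (hg : MemLp g 2) :
    ∫ x, ‖f x * g x‖ ≤ l2 f * l2 g := by
  have h := integral_mul_norm_le_Lp_mul_Lq (μ := volume) (f := f) (g := g) (p := 2) (q := 2)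
    (by constructor <;> norm_num) (by simpa using hf) (by simpa using hg)
  have e : ∀ {f : ℝ → ℂ}, MemLp f 2 → (∫ x, ‖f x‖ ^ (2 : ℝ)) ^ (1 / 2 : ℝ) = l2 f := by
    intro f hf
    rw [← Real.sqrt_eq_rpow]
    simp only [Real.rpow_ofNat]
    rw [← l2_sq hf, Real.sqrt_sq (l2_nonneg f)]
  rw [e hf, e hg] at h
  simpa only [norm_mul] using h

theorem l2_mul_le {f g : ℝ → ℂ} (hf : MemLp f 2) {C : ℝ} (hC : 0 ≤ C) (hg : ∀ x, ‖g x‖ ≤ C * ‖f x‖) :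
    l2 g ≤ C * l2 f := by
  have h := eLpNorm_le_mul_eLpNorm_of_ae_le_mul (μ := volume) (Eventually.of_forall hg) 2
  rw [l2, l2]
  refine (ENNReal.toReal_mono ?_ h).trans_eq ?_
  · exact ENNReal.mul_ne_top ENNReal.ofReal_ne_top hf.2.ne
  · rw [ENNReal.toReal_mul, ENNReal.toReal_ofReal hC]

/-- Tested against a smooth compactly supported function, both the integral transform and the `L²`
extension move the transform onto the test function, so the two agree almost everywhere. This makes
Plancherel available for the integral on `L¹ ∩ L²`. -/
theorem fourier_ae_eq_fourier_toLp {f : ℝ → ℂ} (hf : Integrable f) (hf2 : MemLp f 2) :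
    𝓕 f =ᵐ[volume] (𝓕 (hf2.toLp f) : Lp ℂ 2 (volume : Measure ℝ)) := by
  have hc : Continuous (𝓕 f) := VectorFourier.fourierIntegral_continuous
    Real.continuous_fourierChar (by exact continuous_inner) hf
  refine ae_eq_of_integral_contDiff_smul_eq hc.locallyIntegrable
    ((Lp.memLp _).locallyIntegrable (by norm_num)) ?_
  intro g hg hgs
  have hg' : ContDiff ℝ ((⊤ : ℕ∞) : WithTop ℕ∞) (fun x => (g x : ℂ)) := Complex.ofRealCLM.contDiff.comp hg
  have hgs' : HasCompactSupport (fun x => (g x : ℂ)) := hgs.comp_left (g := fun x : ℝ => (x : ℂ)) (by simp)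
  let φ : SchwartzMap ℝ ℂ := hgs'.toSchwartzMap hg'
  have hφ : ∀ x, φ x = (g x : ℂ) := fun x => rfl
  have h1 := congrArg (fun T : TemperedDistribution ℝ ℂ => T φ)
    (Lp.fourier_toTemperedDistribution_eq (hf2.toLp f))
  simp only [TemperedDistribution.fourier_apply, Lp.toTemperedDistribution_apply] at h1
  have h2 : ∫ x, g x • 𝓕 f x = ∫ x, φ x • 𝓕 f x := by
    simp [hφ]
  have h3 : ∫ x, g x • (𝓕 (hf2.toLp f) : Lp ℂ 2 (volume : Measure ℝ)) x
      = ∫ x, φ x • (𝓕 (hf2.toLp f) : Lp ℂ 2 (volume : Measure ℝ)) x := by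
    simp [hφ]
  rw [h2, h3, ← h1]
  have h4 := VectorFourier.integral_fourierIntegral_smul_eq_flip (μ := volume) (ν := volume)
    (L := innerₗ ℝ) Real.continuous_fourierChar (by exact continuous_inner)
    (φ.integrable (μ := volume)) hf
  rw [flip_innerₗ] at h4
  have h5 : ∫ x, φ x • 𝓕 f x = ∫ x, (𝓕 (φ : ℝ → ℂ)) x • f x := h4.symm
  rw [h5]
  refine integral_congr_ae ?_
  filter_upwards [hf2.coeFn_toLp] with x hx
  rw [hx, SchwartzMap.fourier_coe]

theorem continuous_fourier {f : ℝ → ℂ} (hf : Integrable f) : Continuous (𝓕 f) :=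
  VectorFourier.fourierIntegral_continuous Real.continuous_fourierChar
    (by exact continuous_inner) hf

theorem continuous_fourierInv {f : ℝ → ℂ} (hf : Integrable f) : Continuous (𝓕⁻ f) := by
  have : 𝓕⁻ f = fun x => 𝓕 f (-x) := by
    ext x; exact Real.fourierInv_eq_fourier_neg f x
  rw [this]
  exact (continuous_fourier hf).comp continuous_neg

theorem norm_fourierInv_le (f : ℝ → ℂ) (x : ℝ) : ‖𝓕⁻ f x‖ ≤ ∫ y, ‖f y‖ := by
  rw [Real.fourierInv_eq_fourier_neg]
  exact VectorFourier.norm_fourierIntegral_le_integral_norm _ _ _ _ _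

theorem norm_fourier_le (f : ℝ → ℂ) (x : ℝ) : ‖𝓕 f x‖ ≤ ∫ y, ‖f y‖ :=
  VectorFourier.norm_fourierIntegral_le_integral_norm _ _ _ _ _

theorem memLp_fourier {f : ℝ → ℂ} (hf : Integrable f) (hf2 : MemLp f 2) : MemLp (𝓕 f) 2 :=
  (memLp_congr_ae (fourier_ae_eq_fourier_toLp hf hf2)).2 (Lp.memLp _)

theorem l2_fourier {f : ℝ → ℂ} (hf : Integrable f) (hf2 : MemLp f 2) : l2 (𝓕 f) = l2 f := by
  have h := Lp.norm_fourier_eq (hf2.toLp f)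
  rw [Lp.norm_def, Lp.norm_toLp] at h
  rw [l2, eLpNorm_congr_ae (fourier_ae_eq_fourier_toLp hf hf2), h, l2]

theorem conj_fourier (f : ℝ → ℂ) (x : ℝ) :
    conj (𝓕 f x) = 𝓕⁻ (fun y => conj (f y)) x := by
  rw [Real.fourier_eq', Real.fourierInv_eq', ← integral_conj]
  congr 1; ext y
  simp [← Complex.exp_conj, Complex.conj_ofNat]

/-! ### Fourier multipliers -/

/-- The Fourier multiplier operator with symbol `q`. -/
noncomputable def mulOp (q f : ℝ → ℂ) : ℝ → ℂ := 𝓕⁻ (fun η => q η * 𝓕 f η)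

section MulOp

variable {q f g : ℝ → ℂ}

theorem integrable_mul_fourier (hq : MemLp q 2) (hf : Integrable f) (hf2 : MemLp f 2) :
    Integrable (fun η => q η * 𝓕 f η) :=
  integrable_mul_of_memLp_two hq (memLp_fourier hf hf2)

theorem continuous_mulOp (hq : MemLp q 2) (hf : Integrable f) (hf2 : MemLp f 2) :
    Continuous (mulOp q f) :=
  continuous_fourierInv (integrable_mul_fourier hq hf hf2)

/-- Cauchy–Schwarz on the Fourier side followed by Plancherel. Through this estimate a symbol that
is small in `L²` becomes an operator that is small in sup norm. -/
theorem norm_mulOp_le (hq : MemLp q 2) (hf : Integrable f) (hf2 : MemLp f 2) (x : ℝ) :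
    ‖mulOp q f x‖ ≤ l2 q * l2 f := by
  refine (norm_fourierInv_le _ x).trans ?_
  rw [← l2_fourier hf hf2]
  exact integral_norm_mul_le_l2 hq (memLp_fourier hf hf2)

theorem mulOp_eq_integral (q f : ℝ → ℂ) (x : ℝ) :
    mulOp q f x = ∫ η : ℝ, Complex.exp (2 * Real.pi * Complex.I * x * η) * (q η * 𝓕 f η) := by
  rw [mulOp, Real.fourierInv_eq']
  congr 1; ext η
  simp only [smul_eq_mul]
  congr 2
  push_cast [RCLike.inner_apply, conj_trivial]
  ring

theorem integral_conj_mul_fourierInv {h : ℝ → ℂ} (hg : Integrable g) (hh : Integrable h) :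
    ∫ x, conj (g x) * 𝓕⁻ h x = ∫ η, conj (𝓕 g η) * h η := by
  have hg' : Integrable (fun x => conj (g x)) := (Complex.conjLIE.integrable_comp_iff).2 hg
  have h4 := VectorFourier.integral_fourierIntegral_smul_eq_flip (μ := volume) (ν := volume)
    (L := -innerₗ ℝ) (e := Real.fourierChar) Real.continuous_fourierChar
    (by exact continuous_inner.neg) hg' hh
  have e : (-innerₗ ℝ : ℝ →ₗ[ℝ] ℝ →ₗ[ℝ] ℝ).flip = -innerₗ ℝ := by
    ext; simp
  rw [e] at h4
  have e2 : ∀ f : ℝ → ℂ, VectorFourier.fourierIntegral Real.fourierChar volume (-innerₗ ℝ) f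
      = 𝓕⁻ f := fun f => rfl
  rw [e2, e2] at h4
  simp only [smul_eq_mul] at h4
  simp only [conj_fourier]
  exact h4.symm

theorem integral_conj_mul_mulOp (hq : MemLp q 2) (hf : Integrable f) (hf2 : MemLp f 2)
    (hg : Integrable g) :
    ∫ x, conj (g x) * mulOp q f x = ∫ η, conj (𝓕 g η) * (q η * 𝓕 f η) :=
  integral_conj_mul_fourierInv hg (integrable_mul_fourier hq hf hf2)

/-- Once the output is paired with an `L²` function, only the supremum of the symbol matters. For
the gauged symbol this is of size `1/λ`, better than the `λ^{-1/2}` of its `L²` norm. -/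
theorem norm_integral_conj_mul_mulOp_le (hq : MemLp q 2) {C : ℝ} (hC : 0 ≤ C)
    (hqC : ∀ η, ‖q η‖ ≤ C) (hf : Integrable f) (hf2 : MemLp f 2)
    (hg : Integrable g) (hg2 : MemLp g 2) :
    ‖∫ x, conj (g x) * mulOp q f x‖ ≤ C * (l2 g * l2 f) := by
  rw [integral_conj_mul_mulOp hq hf hf2 hg, ← l2_fourier hf hf2, ← l2_fourier hg hg2]
  refine (norm_integral_le_integral_norm _).trans ?_
  refine le_trans ?_ (mul_le_mul_of_nonneg_left
    (integral_norm_mul_le_l2 (memLp_fourier hg hg2) (memLp_fourier hf hf2)) hC)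
  rw [← integral_const_mul]
  refine integral_mono_of_nonneg (Eventually.of_forall fun x => norm_nonneg _)
    ((integrable_mul_of_memLp_two (memLp_fourier hg hg2) (memLp_fourier hf hf2)).norm.const_mul C)
    (Eventually.of_forall fun x => ?_)
  simp only [norm_mul, RCLike.norm_conj]
  calc ‖𝓕 g x‖ * (‖q x‖ * ‖𝓕 f x‖) ≤ ‖𝓕 g x‖ * (C * ‖𝓕 f x‖) := by gcongr; exact hqC x
    _ = _ := by ring

theorem fourier_planeWave_mul (f : ℝ → ℂ) (l η : ℝ) :
    𝓕 (fun x => planeWave l x * f x) η = 𝓕 f (η - l / (2 * Real.pi)) := by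
  rw [Real.fourier_eq', Real.fourier_eq']
  congr 1; ext x
  rw [smul_eq_mul, smul_eq_mul, ← mul_assoc, planeWave, ← Complex.exp_add]
  congr 2
  have : (Real.pi : ℂ) ≠ 0 := by exact_mod_cast Real.pi_ne_zero
  push_cast [RCLike.inner_apply, conj_trivial]
  field_simp
  ring

/-- Modulation is translation on the Fourier side. This identity carries the gauge `e^{iλx}` through
a multiplier. -/
theorem mulOp_planeWave_mul (q f : ℝ → ℂ) (l x : ℝ) :
    mulOp q (fun x => planeWave l x * f x) x
      = planeWave l x * mulOp (fun η => q (η + l / (2 * Real.pi))) f x := by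
  rw [mulOp_eq_integral, mulOp_eq_integral, ← integral_const_mul,
    ← integral_add_right_eq_self _ (l / (2 * Real.pi))]
  congr 1; ext η
  rw [fourier_planeWave_mul, add_sub_cancel_right, ← mul_assoc (planeWave l x), planeWave,
    ← Complex.exp_add]
  congr 2
  have : (Real.pi : ℂ) ≠ 0 := by exact_mod_cast Real.pi_ne_zero
  push_cast
  field_simp
  ring

theorem fourierInv_fun_add {f g : ℝ → ℂ} (hf : Integrable f) (hg : Integrable g) (x : ℝ) :
    𝓕⁻ (fun η => f η + g η) x = 𝓕⁻ f x + 𝓕⁻ g x := by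
  simp only [Real.fourierInv_eq_fourier_neg, Real.fourier_eq]
  rw [← integral_add ((Real.fourierIntegral_convergent_iff (-x)).2 hf)
    ((Real.fourierIntegral_convergent_iff (-x)).2 hg)]
  simp only [smul_add]

theorem fourierInv_fun_const_mul (c : ℂ) (f : ℝ → ℂ) (x : ℝ) :
    𝓕⁻ (fun η => c * f η) x = c * 𝓕⁻ f x := by
  simp only [Real.fourierInv_eq, ← integral_const_mul]
  congr 1; ext y
  simp only [Circle.smul_def, smul_eq_mul]
  ring

theorem fourier_fun_add (hf : Integrable f) (hg : Integrable g) (x : ℝ) :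
    𝓕 (fun η => f η + g η) x = 𝓕 f x + 𝓕 g x := by
  have h := fourierInv_fun_add hf hg (-x)
  simpa only [Real.fourierInv_eq_fourier_neg, neg_neg] using h

theorem fourier_fun_const_mul (c : ℂ) (f : ℝ → ℂ) (x : ℝ) :
    𝓕 (fun η => c * f η) x = c * 𝓕 f x := by
  have h := fourierInv_fun_const_mul c f (-x)
  simpa only [Real.fourierInv_eq_fourier_neg, neg_neg] using h

theorem mulOp_add_left {q' : ℝ → ℂ} (hq : MemLp q 2) (hq' : MemLp q' 2) (hf : Integrable f)
    (hf2 : MemLp f 2) (x : ℝ) :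
    mulOp (fun η => q η + q' η) f x = mulOp q f x + mulOp q' f x := by
  simp only [mulOp, add_mul]
  exact fourierInv_fun_add (integrable_mul_fourier hq hf hf2) (integrable_mul_fourier hq' hf hf2) x

theorem mulOp_add_right (hq : MemLp q 2) (hf : Integrable f) (hf2 : MemLp f 2)
    (hg : Integrable g) (hg2 : MemLp g 2) (x : ℝ) :
    mulOp q (fun y => f y + g y) x = mulOp q f x + mulOp q g x := by
  simp only [mulOp, fourier_fun_add hf hg, mul_add]
  exact fourierInv_fun_add (integrable_mul_fourier hq hf hf2) (integrable_mul_fourier hq hg hg2) x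

theorem mulOp_const_mul_right (c : ℂ) (q f : ℝ → ℂ) (x : ℝ) :
    mulOp q (fun y => c * f y) x = c * mulOp q f x := by
  simp only [mulOp, fourier_fun_const_mul, mul_left_comm _ c]
  exact fourierInv_fun_const_mul c _ x

end MulOp

/-! ### The convolution kernels -/

theorem norm_planeWave (l x : ℝ) : ‖planeWave l x‖ = 1 := by
  rw [planeWave, mul_assoc, mul_comm, ← Complex.ofReal_mul, Complex.norm_exp_ofReal_mul_I]

theorem planeWave_comm (l x : ℝ) : planeWave l x = planeWave x l := by
  simp only [planeWave]; ring_nf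

theorem continuous_planeWave (l : ℝ) : Continuous (planeWave l) := by
  unfold planeWave; fun_prop

theorem planeWave_add_left (l l' x : ℝ) :
    planeWave (l + l') x = planeWave l x * planeWave l' x := by
  rw [planeWave, planeWave, planeWave, ← Complex.exp_add]
  push_cast; ring_nf

theorem planeWave_sub_right (l x y : ℝ) :
    planeWave l (x - y) = planeWave l x * planeWave (-l) y := by
  rw [planeWave, planeWave, planeWave, ← Complex.exp_add]
  push_cast; ring_nf

theorem planeWave_neg_mul (l x : ℝ) : planeWave (-l) x * planeWave l x = 1 := by
  rw [← planeWave_add_left]; simp [planeWave]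

theorem conj_planeWave (l x : ℝ) : conj (planeWave l x) = planeWave (-l) x := by
  simp [planeWave, ← Complex.exp_conj]

theorem fourier_eq_integral_planeWave (f : ℝ → ℂ) (ξ : ℝ) :
    𝓕 f (ξ / (2 * Real.pi)) = ∫ y, planeWave ξ (-y) * f y := by
  rw [Real.fourier_eq']
  congr 1; ext y
  rw [smul_eq_mul, planeWave]
  congr 2
  have : (Real.pi : ℂ) ≠ 0 := by exact_mod_cast Real.pi_ne_zero
  push_cast [RCLike.inner_apply, conj_trivial]
  field_simp

theorem exists_one_add_le_mul_norm_sub {k : ℂ} (hk : ∀ r : ℝ, 0 ≤ r → k ≠ (r : ℂ)) :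
    ∃ C : ℝ, 0 < C ∧ ∀ ξ : ℝ, 0 ≤ ξ → 1 + ξ ≤ C * ‖(ξ : ℂ) - k‖ := by
  have hcl : IsClosed ((fun r : ℝ => (r : ℂ)) '' Set.Ici 0) :=
    Complex.isometry_ofReal.isClosedEmbedding.isClosedMap _ isClosed_Ici
  have hne : ((fun r : ℝ => (r : ℂ)) '' Set.Ici 0).Nonempty := ⟨_, 0, by simp, rfl⟩
  have hk' : k ∉ ((fun r : ℝ => (r : ℂ)) '' Set.Ici 0) := by
    rintro ⟨r, hr, h⟩
    exact hk r hr h.symm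
  have hδ := (hcl.notMem_iff_infDist_pos hne).1 hk'
  set δ := Metric.infDist k ((fun r : ℝ => (r : ℂ)) '' Set.Ici 0)
  -- From `1 + ξ ≤ (1 + ‖k‖) + ‖ξ - k‖`: the first term is absorbed because `δ ≤ ‖ξ - k‖`, and the
  -- summand `1` takes care of the second.
  refine ⟨(1 + ‖k‖) / δ + 1, by positivity, fun ξ hξ => ?_⟩
  have h1 : δ ≤ ‖(ξ : ℂ) - k‖ := by
    rw [← dist_eq_norm, dist_comm]
    exact Metric.infDist_le_dist_of_mem ⟨ξ, hξ, rfl⟩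
  have h2 : ξ ≤ ‖(ξ : ℂ) - k‖ + ‖k‖ := by
    calc ξ = ‖(ξ : ℂ)‖ := by rw [Complex.norm_real, Real.norm_of_nonneg hξ]
      _ = ‖((ξ : ℂ) - k) + k‖ := by rw [sub_add_cancel]
      _ ≤ _ := norm_add_le _ _
  have h3 : (1 + ‖k‖) / δ * δ ≤ (1 + ‖k‖) / δ * ‖(ξ : ℂ) - k‖ := by gcongr
  rw [div_mul_cancel₀ _ hδ.ne'] at h3
  linarith

/-- The truncated integral whose limit is `kernelG`. -/
noncomputable def truncG (k : ℂ) (R x : ℝ) : ℂ :=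
  (1 / (2 * Real.pi) : ℂ) * ∫ ξ in (0 : ℝ)..R, planeWave ξ x / ((ξ : ℂ) - k)

theorem norm_inv_sub_le {k : ℂ} {C : ℝ} (hC : ∀ ξ : ℝ, 0 ≤ ξ → 1 + ξ ≤ C * ‖(ξ : ℂ) - k‖)
    {ξ : ℝ} (hξ : 0 ≤ ξ) : ‖((ξ : ℂ) - k)⁻¹‖ ≤ C * (1 + ξ)⁻¹ := by
  have h := hC ξ hξ
  have hp : 0 < ‖(ξ : ℂ) - k‖ := by
    rcases (norm_nonneg ((ξ : ℂ) - k)).eq_or_lt with h0 | h0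
    · rw [← h0] at h; linarith
    · exact h0
  rw [norm_inv, ← div_eq_mul_inv, inv_le_comm₀ hp (by
    have : 0 < C * ‖(ξ : ℂ) - k‖ := by linarith
    have : 0 < C := pos_of_mul_pos_left this hp.le
    positivity), inv_div, div_le_iff₀ (by
      have : 0 < C * ‖(ξ : ℂ) - k‖ := by linarith
      exact pos_of_mul_pos_left this hp.le), mul_comm]
  exact h

/-- Integration by parts in `ξ` gains a factor `1/x` and squares the denominator, turning
conditional convergence at infinity into absolute convergence. -/
theorem integral_planeWave_div_eq {k : ℂ} (hk : ∀ r : ℝ, 0 ≤ r → k ≠ (r : ℂ)) {x : ℝ} (hx : x ≠ 0)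
    {a b : ℝ} (ha : 0 ≤ a) (hab : a ≤ b) :
    ∫ ξ in a..b, planeWave ξ x / ((ξ : ℂ) - k) =
      (Complex.I * x)⁻¹ * (planeWave b x * ((b : ℂ) - k)⁻¹ - planeWave a x * ((a : ℂ) - k)⁻¹
        + ∫ ξ in a..b, planeWave ξ x * (((ξ : ℂ) - k)⁻¹) ^ 2) := by
  have hne : ∀ ξ ∈ Set.uIcc a b, (ξ : ℂ) - k ≠ 0 := by
    intro ξ hξ h
    rw [Set.uIcc_of_le hab] at hξ
    exact hk ξ (ha.trans hξ.1) (sub_eq_zero.1 h).symm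
  have hix : Complex.I * (x : ℂ) ≠ 0 := mul_ne_zero Complex.I_ne_zero (by exact_mod_cast hx)
  have hcw : Continuous fun ξ : ℝ => planeWave ξ x := by unfold planeWave; fun_prop
  have hci : ContinuousOn (fun ξ : ℝ => ((ξ : ℂ) - k)⁻¹) (Set.uIcc a b) :=
    ContinuousOn.inv₀ (by fun_prop) hne
  have hi1 : IntervalIntegrable (fun ξ : ℝ => planeWave ξ x * ((ξ : ℂ) - k)⁻¹) volume a b :=
    (hcw.continuousOn.mul hci).intervalIntegrable
  have hi2 : IntervalIntegrable (fun ξ : ℝ => planeWave ξ x * (((ξ : ℂ) - k)⁻¹) ^ 2) volume a b :=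
    (hcw.continuousOn.mul (hci.pow 2)).intervalIntegrable
  have hd : ∀ ξ ∈ Set.uIcc a b, HasDerivAt
      (fun ξ : ℝ => planeWave ξ x * ((ξ : ℂ) - k)⁻¹)
      ((Complex.I * x) * (planeWave ξ x * ((ξ : ℂ) - k)⁻¹)
        - planeWave ξ x * (((ξ : ℂ) - k)⁻¹) ^ 2) ξ := by
    intro ξ hξ
    have h1 : HasDerivAt (fun ξ : ℝ => (ξ : ℂ)) 1 ξ := Complex.ofRealCLM.hasDerivAt
    have h2 : HasDerivAt (fun ξ : ℝ => planeWave ξ x) (planeWave ξ x * (Complex.I * 1 * x)) ξ := by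
      unfold planeWave
      exact ((h1.const_mul Complex.I).mul_const (x : ℂ)).cexp
    have h3 := (h1.sub_const k).inv (hne ξ hξ)
    refine (h2.mul h3).congr_deriv ?_
    simp only [Pi.inv_apply]
    have := hne ξ hξ
    field_simp
    ring
  have h := intervalIntegral.integral_eq_sub_of_hasDerivAt hd
    ((hi1.const_mul _).sub hi2)
  rw [intervalIntegral.integral_sub (hi1.const_mul _) hi2, intervalIntegral.integral_const_mul] at h
  rw [eq_inv_mul_iff_mul_eq₀ hix, ← h]
  simp only [div_eq_mul_inv]
  ring

theorem integral_inv_one_add_sq_eq {a b : ℝ} (ha : 0 ≤ a) (hab : a ≤ b) :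
    ∫ ξ in a..b, ((1 + ξ)⁻¹) ^ 2 = (1 + a)⁻¹ - (1 + b)⁻¹ := by
  have hne : ∀ ξ ∈ Set.uIcc a b, 1 + ξ ≠ 0 := by
    intro ξ hξ
    rw [Set.uIcc_of_le hab] at hξ
    linarith [hξ.1]
  have hd : ∀ ξ ∈ Set.uIcc a b, HasDerivAt (fun ξ : ℝ => -(1 + ξ)⁻¹) (((1 + ξ)⁻¹) ^ 2) ξ := by
    intro ξ hξ
    have := (((hasDerivAt_id ξ).const_add 1).inv (hne ξ hξ)).neg
    refine this.congr_deriv ?_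
    simp [div_eq_mul_inv]
  rw [intervalIntegral.integral_eq_sub_of_hasDerivAt hd
    ((ContinuousOn.inv₀ (by fun_prop) hne).pow 2).intervalIntegrable]
  ring

theorem norm_integral_planeWave_div_le {k : ℂ} {C : ℝ}
    (hC : ∀ ξ : ℝ, 0 ≤ ξ → 1 + ξ ≤ C * ‖(ξ : ℂ) - k‖) (hC0 : 0 < C) {x : ℝ} (hx : x ≠ 0)
    {a b : ℝ} (ha : 0 ≤ a) (hab : a ≤ b) :
    ‖∫ ξ in a..b, planeWave ξ x / ((ξ : ℂ) - k)‖ ≤ (2 * C + C ^ 2) * (|x|⁻¹ * (1 + a)⁻¹) := by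
  have hk : ∀ r : ℝ, 0 ≤ r → k ≠ (r : ℂ) := by
    rintro r hr rfl
    have := hC r hr
    simp at this; linarith
  have hb := ha.trans hab
  rw [integral_planeWave_div_eq hk hx ha hab, norm_mul, norm_inv, norm_mul, Complex.norm_I, one_mul,
    Complex.norm_real, Real.norm_eq_abs]
  have h1 : ‖planeWave b x * ((b : ℂ) - k)⁻¹‖ ≤ C * (1 + a)⁻¹ := by
    rw [norm_mul, norm_planeWave, one_mul]
    refine (norm_inv_sub_le hC hb).trans ?_
    gcongr
  have h2 : ‖planeWave a x * ((a : ℂ) - k)⁻¹‖ ≤ C * (1 + a)⁻¹ := by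
    rw [norm_mul, norm_planeWave, one_mul]
    exact norm_inv_sub_le hC ha
  have h3 : ‖∫ ξ in a..b, planeWave ξ x * (((ξ : ℂ) - k)⁻¹) ^ 2‖ ≤ C ^ 2 * (1 + a)⁻¹ := by
    have h4 : ‖∫ ξ in a..b, planeWave ξ x * (((ξ : ℂ) - k)⁻¹) ^ 2‖
        ≤ ∫ ξ in a..b, C ^ 2 * ((1 + ξ)⁻¹) ^ 2 := by
      refine intervalIntegral.norm_integral_le_of_norm_le hab ?_ ?_
      · refine Eventually.of_forall fun ξ hξ => ?_
        rw [norm_mul, norm_planeWave, one_mul, norm_pow, ← mul_pow]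
        gcongr
        exact norm_inv_sub_le hC (ha.trans hξ.1.le)
      · refine (ContinuousOn.mul continuousOn_const (ContinuousOn.pow (ContinuousOn.inv₀ (by fun_prop) ?_) 2)).intervalIntegrable
        intro ξ hξ
        rw [Set.uIcc_of_le hab] at hξ
        linarith [hξ.1]
    refine h4.trans ?_
    rw [intervalIntegral.integral_const_mul, integral_inv_one_add_sq_eq ha hab]
    have : 0 ≤ (1 + b)⁻¹ := by positivity
    gcongr
    linarith
  calc |x|⁻¹ * ‖_‖ ≤ |x|⁻¹ * (C * (1 + a)⁻¹ + C * (1 + a)⁻¹ + C ^ 2 * (1 + a)⁻¹) := by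
        gcongr
        exact (norm_add_le _ _).trans (add_le_add ((norm_sub_le _ _).trans (add_le_add h1 h2)) h3)
    _ = _ := by ring

/-- The growth in `R` is really logarithmic. A power is simpler to handle, and any exponent below
`1/2` would leave the kernel square integrable near the origin. -/
theorem norm_integral_planeWave_div_le_rpow {k : ℂ} {C : ℝ}
    (hC : ∀ ξ : ℝ, 0 ≤ ξ → 1 + ξ ≤ C * ‖(ξ : ℂ) - k‖) (hC0 : 0 < C) {R : ℝ} (hR : 0 ≤ R) (x : ℝ) :
    ‖∫ ξ in (0:ℝ)..R, planeWave ξ x / ((ξ : ℂ) - k)‖ ≤ 4 * C * R ^ (1 / 4 : ℝ) := by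
  have hi : IntervalIntegrable (fun ξ : ℝ => ξ ^ (-3 / 4 : ℝ)) volume 0 R :=
    intervalIntegral.intervalIntegrable_rpow' (by norm_num)
  refine (intervalIntegral.norm_integral_le_of_norm_le hR (g := fun ξ => C * ξ ^ (-3 / 4 : ℝ))
    (Eventually.of_forall fun ξ hξ => ?_) (hi.const_mul C)).trans ?_
  · rw [div_eq_mul_inv, norm_mul, norm_planeWave, one_mul]
    refine (norm_inv_sub_le hC hξ.1.le).trans ?_
    gcongr
    have h0 := hξ.1
    rw [neg_div, Real.rpow_neg h0.le]
    gcongr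
    calc ξ ^ (3 / 4 : ℝ) ≤ (1 + ξ) ^ (3 / 4 : ℝ) := by gcongr; linarith
      _ ≤ (1 + ξ) ^ (1 : ℝ) := Real.rpow_le_rpow_of_exponent_le (by linarith) (by norm_num)
      _ = _ := Real.rpow_one _
  · rw [intervalIntegral.integral_const_mul, integral_rpow (Or.inl (by norm_num))]
    norm_num
    apply le_of_eq; ring

/-- The constant does not depend on `R`, so the bounds pass to the limit kernel and also serve as a
majorant for dominated convergence. -/
theorem exists_norm_truncG_le {k : ℂ} (hk : ∀ r : ℝ, 0 ≤ r → k ≠ (r : ℂ)) :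
    ∃ C : ℝ, 0 < C ∧ ∀ R x : ℝ, 0 ≤ R → x ≠ 0 →
      ‖truncG k R x‖ ≤ C * |x|⁻¹ ∧ ‖truncG k R x‖ ≤ C * |x| ^ (-1 / 4 : ℝ) := by
  obtain ⟨C, hC0, hC⟩ := exists_one_add_le_mul_norm_sub hk
  refine ⟨6 * C + C ^ 2, by positivity, fun R x hR hx => ?_⟩
  have hx' : 0 < |x| := abs_pos.2 hx
  have hle : ‖truncG k R x‖ ≤ ‖∫ ξ in (0:ℝ)..R, planeWave ξ x / ((ξ : ℂ) - k)‖ := by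
    rw [truncG, norm_mul]
    refine mul_le_of_le_one_left (norm_nonneg _) ?_
    rw [norm_div, norm_mul, Complex.norm_real, Real.norm_of_nonneg Real.pi_pos.le]
    rw [norm_one, div_le_one (by norm_num; positivity)]
    norm_num
    nlinarith [Real.pi_gt_three]
  refine ⟨hle.trans ?_, hle.trans ?_⟩
  · refine (norm_integral_planeWave_div_le hC hC0 hx le_rfl hR).trans ?_
    simp only [add_zero, inv_one, mul_one]
    gcongr
    linarith
  · have e : (|x|⁻¹) ^ (1 / 4 : ℝ) = |x| ^ (-1 / 4 : ℝ) := by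
      rw [Real.inv_rpow hx'.le, ← Real.rpow_neg hx'.le]; norm_num
    have hp : 0 < |x| ^ (-1 / 4 : ℝ) := by positivity
    -- The frequencies are cut at `|x|⁻¹`: below it the exponential does not oscillate and absolute
    -- values suffice, above it integration by parts is efficient.
    rcases le_total R |x|⁻¹ with h | h
    · refine (norm_integral_planeWave_div_le_rpow hC hC0 hR x).trans ?_
      rw [← e]
      gcongr
      nlinarith
    · have hii : ∀ a b : ℝ, 0 ≤ a → 0 ≤ b → IntervalIntegrable
          (fun ξ : ℝ => planeWave ξ x / ((ξ : ℂ) - k)) volume a b := by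
        intro a b ha hb
        have hcw : Continuous fun ξ : ℝ => planeWave ξ x := by unfold planeWave; fun_prop
        refine (hcw.continuousOn.div (by fun_prop) ?_).intervalIntegrable
        intro ξ hξ h
        exact hk ξ ((le_min ha hb).trans hξ.1) (sub_eq_zero.1 h).symm
      have hxi : 0 ≤ |x|⁻¹ := by positivity
      rw [← intervalIntegral.integral_add_adjacent_intervals (hii 0 |x|⁻¹ le_rfl hxi)
        (hii _ R hxi hR)]
      refine (norm_add_le _ _).trans ?_
      have h1 := norm_integral_planeWave_div_le_rpow hC hC0 hxi x
      have h2 := norm_integral_planeWave_div_le hC hC0 hx hxi h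
      rw [e] at h1
      have h3 : |x|⁻¹ * (1 + |x|⁻¹)⁻¹ ≤ |x| ^ (-1 / 4 : ℝ) := by
        have : |x|⁻¹ * (1 + |x|⁻¹)⁻¹ = (|x| + 1)⁻¹ := by field_simp
        rw [this, neg_div, Real.rpow_neg hx'.le]
        gcongr
        calc |x| ^ (1 / 4 : ℝ) ≤ (|x| + 1) ^ (1 / 4 : ℝ) := by gcongr; linarith
          _ ≤ (|x| + 1) ^ (1 : ℝ) := Real.rpow_le_rpow_of_exponent_le (by linarith) (by norm_num)
          _ = _ := Real.rpow_one _
      have h4 : (2 * C + C ^ 2) * (|x|⁻¹ * (1 + |x|⁻¹)⁻¹) ≤ (2 * C + C ^ 2) * |x| ^ (-1 / 4 : ℝ) := by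
        gcongr
      calc _ ≤ 4 * C * |x| ^ (-1 / 4 : ℝ) + (2 * C + C ^ 2) * |x| ^ (-1 / 4 : ℝ) :=
            add_le_add h1 (h2.trans h4)
        _ = _ := by ring

theorem tendsto_truncG {k : ℂ} (hk : ∀ r : ℝ, 0 ≤ r → k ≠ (r : ℂ)) {x : ℝ} (hx : x ≠ 0) :
    Tendsto (fun R => truncG k R x) atTop (𝓝 (kernelG k x)) := by
  refine tendsto_nhds_limUnder ?_
  obtain ⟨C, hC0, hC⟩ := exists_one_add_le_mul_norm_sub hk
  have hne : ∀ ξ ∈ Set.Ici (0:ℝ), (ξ : ℂ) - k ≠ 0 := fun ξ hξ h => hk ξ hξ (sub_eq_zero.1 h).symm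
  have hcw : Continuous fun ξ : ℝ => planeWave ξ x := by unfold planeWave; fun_prop
  have hci : ContinuousOn (fun ξ : ℝ => ((ξ : ℂ) - k)⁻¹) (Set.Ici 0) :=
    ContinuousOn.inv₀ (by fun_prop) hne
  have hint : IntegrableOn (fun ξ : ℝ => planeWave ξ x * (((ξ : ℂ) - k)⁻¹) ^ 2) (Set.Ioi 0) := by
    have hdom : IntegrableOn (fun ξ : ℝ => C ^ 2 * (1 + ‖ξ‖) ^ (-2 : ℝ)) (Set.Ioi 0) :=
      ((integrable_one_add_norm (E := ℝ) (μ := volume) (r := 2) (by norm_num)).const_mul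
        (C ^ 2)).integrableOn
    refine Integrable.mono' hdom
      (((hcw.continuousOn.mul (hci.pow 2)).mono Set.Ioi_subset_Ici_self).aestronglyMeasurable
        measurableSet_Ioi) ?_
    filter_upwards [ae_restrict_mem measurableSet_Ioi] with ξ hξ
    have hξ0 : (0:ℝ) < ξ := hξ
    rw [norm_mul, norm_planeWave, one_mul, norm_pow, Real.norm_of_nonneg hξ0.le,
      Real.rpow_neg (by positivity), Real.rpow_ofNat, ← inv_pow, ← mul_pow]
    gcongr
    exact norm_inv_sub_le hC hξ0.le
  have h1 := intervalIntegral_tendsto_integral_Ioi (b := fun R => R) 0 hint tendsto_id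
  have h2 : Tendsto (fun R : ℝ => planeWave R x * ((R : ℂ) - k)⁻¹) atTop (𝓝 0) := by
    refine squeeze_zero_norm' (a := fun R : ℝ => C * (1 + R)⁻¹) ?_ ?_
    · filter_upwards [eventually_ge_atTop 0] with R hR
      rw [norm_mul, norm_planeWave, one_mul]
      exact norm_inv_sub_le hC hR
    · have : Tendsto (fun R : ℝ => (1 + R)⁻¹) atTop (𝓝 0) :=
        tendsto_inv_atTop_zero.comp (tendsto_atTop_add_const_left _ _ tendsto_id)
      simpa using this.const_mul C
  have h3 := (((h2.sub_const (planeWave 0 x * (((0:ℝ) : ℂ) - k)⁻¹)).add h1).const_mul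
    ((Complex.I * x)⁻¹)).const_mul (1 / (2 * Real.pi) : ℂ)
  refine ⟨_, h3.congr' ?_⟩
  filter_upwards [eventually_ge_atTop 0] with R hR
  rw [truncG, integral_planeWave_div_eq hk hx le_rfl hR]

theorem exists_norm_kernelG_le {k : ℂ} (hk : ∀ r : ℝ, 0 ≤ r → k ≠ (r : ℂ)) :
    ∃ C : ℝ, 0 < C ∧ ∀ x : ℝ, x ≠ 0 →
      ‖kernelG k x‖ ≤ C * |x|⁻¹ ∧ ‖kernelG k x‖ ≤ C * |x| ^ (-1 / 4 : ℝ) := by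
  obtain ⟨C, hC0, hC⟩ := exists_norm_truncG_le hk
  refine ⟨C, hC0, fun x hx => ⟨?_, ?_⟩⟩
  · refine le_of_tendsto (tendsto_truncG hk hx).norm ?_
    filter_upwards [eventually_ge_atTop 0] with R hR using (hC R x hR hx).1
  · refine le_of_tendsto (tendsto_truncG hk hx).norm ?_
    filter_upwards [eventually_ge_atTop 0] with R hR using (hC R x hR hx).2

/-! ### Convolutions with the kernels as Fourier multipliers -/

/-- The convolution `G * f`. -/
noncomputable def conv (G f : ℝ → ℂ) (x : ℝ) : ℂ := ∫ y, G (x - y) * f y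

/-- The part of `|x|^{-1/4}` near the origin. -/
noncomputable def singPart (x : ℝ) : ℂ :=
  Set.indicator (Set.Ioo (-1) 1) (fun x : ℝ => ((|x| ^ (-1 / 4 : ℝ) : ℝ) : ℂ)) x

theorem memLp_singPart : MemLp singPart 2 := by
  have hm : Measurable singPart := by
    unfold singPart
    refine Measurable.indicator ?_ measurableSet_Ioo
    fun_prop
  rw [memLp_two_iff_integrable_sq_norm hm.aestronglyMeasurable]
  have h1 : IntegrableOn (fun x : ℝ => |x| ^ (-1 / 2 : ℝ)) (Set.Ioo (-1) 1) := by
    have h2 : IntervalIntegrable (fun x : ℝ => x ^ (-1 / 2 : ℝ)) volume 0 1 :=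
      intervalIntegral.intervalIntegrable_rpow' (by norm_num)
    have h3 : IntegrableOn (fun x : ℝ => |x| ^ (-1 / 2 : ℝ)) (Set.Ioc 0 1) := by
      rw [intervalIntegrable_iff_integrableOn_Ioc_of_le zero_le_one] at h2
      refine h2.congr_fun (fun x hx => ?_) measurableSet_Ioc
      simp only [abs_of_pos hx.1]
    have h4 : IntegrableOn (fun x : ℝ => |x| ^ (-1 / 2 : ℝ)) (Set.Ico (-1) 0) := by
      have h5 : IntegrableOn ((fun x : ℝ => |x| ^ (-1 / 2 : ℝ)) ∘ Neg.neg) (Neg.neg ⁻¹' Set.Ioc 0 1) :=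
        ((Measure.measurePreserving_neg (volume : Measure ℝ)).integrableOn_comp_preimage
          (Homeomorph.neg ℝ).measurableEmbedding).2 h3
      have e : (Neg.neg ⁻¹' Set.Ioc (0:ℝ) 1) = Set.Ico (-1) 0 := by
        ext x; simp only [Set.mem_preimage, Set.mem_Ioc, Set.mem_Ico]
        constructor <;> rintro ⟨h, h'⟩ <;> constructor <;> linarith
      rw [e] at h5
      refine h5.congr_fun (fun x _ => ?_) measurableSet_Ico
      simp
    have h6 : IntegrableOn (fun x : ℝ => |x| ^ (-1 / 2 : ℝ)) {0} := by
      simp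
    refine ((h4.union h6).union h3).mono_set ?_
    intro x hx
    rcases lt_trichotomy x 0 with h | h | h
    · exact Or.inl (Or.inl ⟨hx.1.le, h⟩)
    · exact Or.inl (Or.inr h)
    · exact Or.inr ⟨h, hx.2.le⟩
  rw [← integrable_indicator_iff measurableSet_Ioo] at h1
  refine h1.congr (Eventually.of_forall fun x => ?_)
  by_cases hx : x ∈ Set.Ioo (-1:ℝ) 1
  · simp only [singPart, Set.indicator_of_mem hx]
    rw [Complex.norm_real, Real.norm_of_nonneg (by positivity), ← Real.rpow_natCast,
      ← Real.rpow_mul (abs_nonneg x)]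
    norm_num
  · simp only [singPart, Set.indicator_of_notMem hx]
    simp

theorem rpow_abs_le (x : ℝ) : |x| ^ (-1 / 4 : ℝ) ≤ 1 + ‖singPart x‖ := by
  by_cases hx : x ∈ Set.Ioo (-1:ℝ) 1
  · simp only [singPart, Set.indicator_of_mem hx]
    rw [Complex.norm_real, Real.norm_of_nonneg (by positivity)]
    linarith
  · simp only [singPart, Set.indicator_of_notMem hx, norm_zero, add_zero]
    have : 1 ≤ |x| := by
      by_contra h
      exact hx (abs_lt.1 (not_le.1 h))
    exact Real.rpow_le_one_of_one_le_of_nonpos this (by norm_num)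

theorem memLp_singPart_sub (x : ℝ) : MemLp (fun y => singPart (x - y)) 2 :=
  memLp_singPart.comp_measurePreserving (Measure.measurePreserving_sub_left volume x)

theorem l2_comp_sub (f : ℝ → ℂ) (hf : MemLp f 2) (x : ℝ) : l2 (fun y => f (x - y)) = l2 f := by
  have := eLpNorm_comp_measurePreserving (p := 2) hf.1 (Measure.measurePreserving_sub_left volume x)
  rw [l2, l2, ← this]
  rfl

theorem integrable_one_add_singPart_mul {f : ℝ → ℂ} (hf : Integrable f) (hf2 : MemLp f 2) (x : ℝ) :
    Integrable (fun y => (1 + ‖singPart (x - y)‖) * ‖f y‖) := by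
  have h := (integrable_mul_of_memLp_two (memLp_singPart_sub x) hf2).norm
  refine (hf.norm.add h).congr (Eventually.of_forall fun y => ?_)
  simp [add_mul]

theorem integral_one_add_singPart_mul_le {f : ℝ → ℂ} (hf : Integrable f) (hf2 : MemLp f 2) (x : ℝ) :
    ∫ y, (1 + ‖singPart (x - y)‖) * ‖f y‖ ≤ (∫ y, ‖f y‖) + l2 singPart * l2 f := by
  have h := (integrable_mul_of_memLp_two (memLp_singPart_sub x) hf2).norm
  have e : ∀ y, (1 + ‖singPart (x - y)‖) * ‖f y‖ = ‖f y‖ + ‖singPart (x - y) * f y‖ := by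
    intro y; rw [norm_mul]; ring
  simp only [e]
  rw [integral_add hf.norm h]
  have := integral_norm_mul_le_l2 (memLp_singPart_sub x) hf2
  rw [l2_comp_sub _ memLp_singPart] at this
  linarith

theorem norm_conv_le {G f : ℝ → ℂ} {C : ℝ} (hC : 0 ≤ C)
    (hG : ∀ x ≠ 0, ‖G x‖ ≤ C * (1 + ‖singPart x‖)) (hf : Integrable f) (hf2 : MemLp f 2) (x : ℝ) :
    ‖conv G f x‖ ≤ C * ((∫ y, ‖f y‖) + l2 singPart * l2 f) := by
  refine (norm_integral_le_integral_norm _).trans ?_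
  refine le_trans ?_ (mul_le_mul_of_nonneg_left (integral_one_add_singPart_mul_le hf hf2 x) hC)
  rw [← integral_const_mul]
  refine integral_mono_of_nonneg (Eventually.of_forall fun x => norm_nonneg _)
    ((integrable_one_add_singPart_mul hf hf2 x).const_mul C) ?_
  have : ∀ᵐ y : ℝ, y ≠ x := by simp [ae_iff]
  filter_upwards [this] with y hy
  rw [norm_mul, ← mul_assoc]
  gcongr
  exact hG _ (sub_ne_zero.2 hy.symm)

/-- The symbol of the convolution with `kernelG k`. -/
noncomputable def symbolPos (k : ℂ) (η : ℝ) : ℂ :=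
  Set.indicator (Set.Ioi 0) (fun η : ℝ => ((2 * Real.pi * η : ℝ) - k : ℂ)⁻¹) η

/-- The symbol of the convolution with `kernelGTilde k`. -/
noncomputable def symbolNeg (k : ℂ) (η : ℝ) : ℂ :=
  Set.indicator (Set.Iio 0) (fun η : ℝ => ((2 * Real.pi * η : ℝ) - k : ℂ)⁻¹) η

theorem symbolNeg_eq (k : ℂ) (η : ℝ) : symbolNeg k η = -symbolPos (-k) (-η) := by
  by_cases h : η < 0
  · have h1 : η ∈ Set.Iio (0:ℝ) := h
    have h2 : -η ∈ Set.Ioi (0:ℝ) := by simpa using h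
    rw [symbolNeg, symbolPos, Set.indicator_of_mem h1, Set.indicator_of_mem h2, ← inv_neg]
    congr 1; push_cast; ring
  · have h1 : η ∉ Set.Iio (0:ℝ) := h
    have h2 : -η ∉ Set.Ioi (0:ℝ) := by simpa using h
    rw [symbolNeg, symbolPos, Set.indicator_of_notMem h1, Set.indicator_of_notMem h2, neg_zero]

theorem measurable_symbolPos (k : ℂ) : Measurable (symbolPos k) := by
  unfold symbolPos
  exact Measurable.indicator (by fun_prop) measurableSet_Ioi

theorem memLp_symbolPos {k : ℂ} (hk : ∀ r : ℝ, 0 ≤ r → k ≠ (r : ℂ)) : MemLp (symbolPos k) 2 := by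
  obtain ⟨C, hC0, hC⟩ := exists_one_add_le_mul_norm_sub hk
  rw [memLp_two_iff_integrable_sq_norm (measurable_symbolPos k).aestronglyMeasurable]
  refine Integrable.mono' ((integrable_one_add_norm (E := ℝ) (μ := volume) (r := 2)
    (by norm_num)).const_mul (C ^ 2))
    ((measurable_symbolPos k).norm.pow_const 2).aestronglyMeasurable
    (Eventually.of_forall fun η => ?_)
  rw [Real.norm_of_nonneg (by positivity), Real.rpow_neg (by positivity), Real.rpow_ofNat,
    ← inv_pow, ← mul_pow]
  gcongr
  by_cases h : 0 < η
  · have h1 : η ∈ Set.Ioi (0:ℝ) := h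
    have h3 : 0 ≤ 2 * Real.pi * η := by positivity
    rw [symbolPos, Set.indicator_of_mem h1]
    refine (norm_inv_sub_le hC h3).trans ?_
    rw [Real.norm_of_nonneg h.le]
    gcongr
    nlinarith [Real.pi_gt_three]
  · have h1 : η ∉ Set.Ioi (0:ℝ) := h
    rw [symbolPos, Set.indicator_of_notMem h1, norm_zero]
    positivity

theorem memLp_symbolNeg {k : ℂ} (hk : ∀ r : ℝ, r ≤ 0 → k ≠ (r : ℂ)) : MemLp (symbolNeg k) 2 := by
  have h := (memLp_symbolPos (k := -k) (fun r hr h => hk (-r) (by linarith) (by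
    rw [← neg_neg k, h]; push_cast; rfl))).comp_measurePreserving
      (Measure.measurePreserving_neg (volume : Measure ℝ))
  have e : symbolNeg k = -(symbolPos (-k) ∘ Neg.neg) := by
    ext η; simp [symbolNeg_eq]
  rw [e]
  exact h.neg

theorem conv_truncG {k : ℂ} (hk : ∀ r : ℝ, 0 ≤ r → k ≠ (r : ℂ)) {f : ℝ → ℂ} (hf : Integrable f)
    {R : ℝ} (hR : 0 ≤ R) (x : ℝ) :
    conv (truncG k R) f x = (1 / (2 * Real.pi) : ℂ) *
      ∫ ξ in (0 : ℝ)..R, planeWave ξ x / ((ξ : ℂ) - k) * 𝓕 f (ξ / (2 * Real.pi)) := by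
  have hq : IntegrableOn (fun ξ : ℝ => ((ξ : ℂ) - k)⁻¹) (Set.Ioc 0 R) := by
    refine ((ContinuousOn.inv₀ (by fun_prop) ?_ : ContinuousOn (fun ξ : ℝ => ((ξ : ℂ) - k)⁻¹)
      (Set.Icc 0 R)).integrableOn_Icc).mono_set Set.Ioc_subset_Icc_self
    intro ξ hξ h
    exact hk ξ hξ.1 (sub_eq_zero.1 h).symm
  have hprod : Integrable (fun p : ℝ × ℝ => planeWave p.2 (x - p.1) * (f p.1 * ((p.2 : ℂ) - k)⁻¹))
      (volume.prod (volume.restrict (Set.Ioc 0 R))) := by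
    refine (hf.mul_prod hq).bdd_mul (c := 1) ?_ (Eventually.of_forall fun p => (norm_planeWave _ _).le)
    refine Continuous.aestronglyMeasurable ?_
    unfold planeWave; fun_prop
  have h1 : conv (truncG k R) f x = (1 / (2 * Real.pi) : ℂ) *
      ∫ y, ∫ ξ in Set.Ioc 0 R, planeWave ξ (x - y) * (f y * ((ξ : ℂ) - k)⁻¹) := by
    rw [conv, ← integral_const_mul]
    congr 1; ext y
    rw [truncG, mul_assoc, intervalIntegral.integral_of_le hR, ← integral_mul_const]
    congr 2; ext ξ
    rw [div_eq_mul_inv]; ring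
  rw [h1, integral_integral_swap hprod, intervalIntegral.integral_of_le hR]
  congr 2; ext ξ
  rw [fourier_eq_integral_planeWave, ← integral_const_mul]
  congr 1; ext y
  have : planeWave ξ (x - y) = planeWave ξ x * planeWave ξ (-y) := by
    rw [sub_eq_add_neg, planeWave_comm, planeWave_add_left, planeWave_comm x, planeWave_comm (-y)]
  rw [this]; ring

theorem stronglyMeasurable_truncG (k : ℂ) {R : ℝ} (hR : 0 ≤ R) :
    StronglyMeasurable (truncG k R) := by
  unfold truncG
  refine StronglyMeasurable.const_mul ?_ _
  simp only [intervalIntegral.integral_of_le hR]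
  refine StronglyMeasurable.integral_prod_right (f := fun x ξ => planeWave ξ x / ((ξ : ℂ) - k)) ?_
  refine Measurable.stronglyMeasurable ?_
  unfold Function.uncurry planeWave
  fun_prop

/-- For a finite cutoff the identity is Fubini. On the kernel side the cutoff is removed by
dominated convergence with the uniform kernel bound, on the frequency side because the product of
the symbol and `𝓕 f`, both in `L²`, is integrable. -/
theorem conv_kernelG {k : ℂ} (hk : ∀ r : ℝ, 0 ≤ r → k ≠ (r : ℂ)) {f : ℝ → ℂ} (hf : Integrable f)
    (hf2 : MemLp f 2) (x : ℝ) : conv (kernelG k) f x = mulOp (symbolPos k) f x := by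
  obtain ⟨C, hC0, hC⟩ := exists_norm_truncG_le hk
  have hyx : ∀ᵐ y : ℝ, y ≠ x := by simp [ae_iff]
  have hpi : (0:ℝ) < 2 * Real.pi := by positivity
  have h1 : Tendsto (fun R => conv (truncG k R) f x) atTop (𝓝 (conv (kernelG k) f x)) := by
    refine tendsto_integral_filter_of_dominated_convergence
      (fun y => C * ((1 + ‖singPart (x - y)‖) * ‖f y‖)) ?_ ?_
      ((integrable_one_add_singPart_mul hf hf2 x).const_mul C) ?_
    · filter_upwards [eventually_ge_atTop 0] with R hR
      exact ((stronglyMeasurable_truncG k hR).comp_measurable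
        (measurable_const.sub measurable_id)).aestronglyMeasurable.mul hf.1
    · filter_upwards [eventually_ge_atTop 0] with R hR
      filter_upwards [hyx] with y hy
      rw [norm_mul, ← mul_assoc]
      gcongr
      refine ((hC R (x - y) hR (sub_ne_zero.2 hy.symm)).2).trans ?_
      gcongr
      exact rpow_abs_le _
    · filter_upwards [hyx] with y hy
      exact (tendsto_truncG hk (sub_ne_zero.2 hy.symm)).mul_const _
  have hint : Integrable (fun η => planeWave (2 * Real.pi * η) x * (symbolPos k η * 𝓕 f η)) := by
    refine (integrable_mul_fourier (memLp_symbolPos hk) hf hf2).bdd_mul (c := 1) ?_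
      (Eventually.of_forall fun p => (norm_planeWave _ _).le)
    refine Continuous.aestronglyMeasurable ?_
    unfold planeWave; fun_prop
  have e1 : ∀ η ∈ Set.Ioi (0:ℝ), planeWave (2 * Real.pi * η) x * (symbolPos k η * 𝓕 f η) =
      (fun ξ : ℝ => planeWave ξ x / ((ξ : ℂ) - k) * 𝓕 f (ξ / (2 * Real.pi))) (2 * Real.pi * η) := by
    intro η hη
    simp only [symbolPos, Set.indicator_of_mem hη, mul_div_cancel_left₀ η hpi.ne', div_eq_mul_inv]
    ring
  have hint2 : IntegrableOn (fun ξ : ℝ => planeWave ξ x / ((ξ : ℂ) - k) * 𝓕 f (ξ / (2 * Real.pi)))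
      (Set.Ioi 0) := by
    have := (integrableOn_Ioi_comp_mul_left_iff
      (fun ξ : ℝ => planeWave ξ x / ((ξ : ℂ) - k) * 𝓕 f (ξ / (2 * Real.pi))) 0 hpi).1
      (hint.integrableOn.congr_fun e1 measurableSet_Ioi)
    simpa using this
  have h2 := (intervalIntegral_tendsto_integral_Ioi (b := fun R => R) 0 hint2 tendsto_id).const_mul
    (1 / (2 * Real.pi) : ℂ)
  have h3 : Tendsto (fun R => conv (truncG k R) f x) atTop (𝓝 ((1 / (2 * Real.pi) : ℂ) *
      ∫ ξ in Set.Ioi (0:ℝ), planeWave ξ x / ((ξ : ℂ) - k) * 𝓕 f (ξ / (2 * Real.pi)))) := by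
    refine h2.congr' ?_
    filter_upwards [eventually_ge_atTop 0] with R hR
    rw [conv_truncG hk hf hR]
  rw [tendsto_nhds_unique h1 h3, mulOp_eq_integral]
  have h4 := integral_comp_mul_left_Ioi
    (fun ξ : ℝ => planeWave ξ x / ((ξ : ℂ) - k) * 𝓕 f (ξ / (2 * Real.pi))) 0 hpi
  rw [mul_zero] at h4
  have h5 : ((2 * Real.pi)⁻¹ : ℝ) • ∫ ξ in Set.Ioi (0:ℝ),
      planeWave ξ x / ((ξ : ℂ) - k) * 𝓕 f (ξ / (2 * Real.pi)) = (1 / (2 * Real.pi) : ℂ) *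
      ∫ ξ in Set.Ioi (0:ℝ), planeWave ξ x / ((ξ : ℂ) - k) * 𝓕 f (ξ / (2 * Real.pi)) := by
    rw [Complex.real_smul]; push_cast; rw [one_div]
  rw [← h5, ← h4, ← setIntegral_congr_fun measurableSet_Ioi e1]
  rw [setIntegral_eq_integral_of_forall_compl_eq_zero]
  · congr 1; ext η
    congr 1
    rw [planeWave]; congr 1; push_cast; ring
  · intro η hη
    simp [symbolPos, Set.indicator_of_notMem hη]

theorem kernelGTilde_eq {k : ℂ} (hk : ∀ r : ℝ, r ≤ 0 → k ≠ (r : ℂ)) {x : ℝ} (hx : x ≠ 0) :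
    kernelGTilde k x = -kernelG (-k) (-x) := by
  have hk' : ∀ r : ℝ, 0 ≤ r → -k ≠ (r : ℂ) := fun r hr h => hk (-r) (by linarith) (by
    rw [← neg_neg k, h]; push_cast; rfl)
  refine Tendsto.limUnder_eq ?_
  refine (tendsto_truncG hk' (neg_ne_zero.2 hx)).neg.congr fun R => ?_
  rw [truncG, ← mul_neg]
  congr 1
  have := intervalIntegral.integral_comp_neg (a := 0) (b := R)
    (fun ξ : ℝ => planeWave ξ x / ((ξ : ℂ) - k))
  rw [neg_zero] at this
  rw [← this, ← intervalIntegral.integral_neg]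
  congr 1; ext ξ
  have e : planeWave ξ (-x) = planeWave (-ξ) x := by simp [planeWave]
  rw [e, ← div_neg]
  congr 1
  push_cast; ring

theorem fourier_comp_neg (f : ℝ → ℂ) (η : ℝ) : 𝓕 (fun y => f (-y)) η = 𝓕 f (-η) := by
  rw [← Real.fourierInv_eq_fourier_neg, ← Real.fourierInv_eq_fourier_comp_neg]

theorem conv_kernelGTilde {k : ℂ} (hk : ∀ r : ℝ, r ≤ 0 → k ≠ (r : ℂ)) {f : ℝ → ℂ}
    (hf : Integrable f) (hf2 : MemLp f 2) (x : ℝ) :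
    conv (kernelGTilde k) f x = mulOp (symbolNeg k) f x := by
  have hk' : ∀ r : ℝ, 0 ≤ r → -k ≠ (r : ℂ) := fun r hr h => hk (-r) (by linarith) (by
    rw [← neg_neg k, h]; push_cast; rfl)
  have hyx : ∀ᵐ y : ℝ, y ≠ x := by simp [ae_iff]
  have h1 : conv (kernelGTilde k) f x = -conv (kernelG (-k)) (fun y => f (-y)) (-x) := by
    rw [conv, conv, ← integral_neg, ← integral_neg_eq_self]
    refine integral_congr_ae ?_
    have : ∀ᵐ y : ℝ, y ≠ -x := by simp [ae_iff]
    filter_upwards [this] with y hy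
    rw [kernelGTilde_eq hk (by intro h; apply hy; linarith)]
    rw [neg_mul]; congr 3; ring
  rw [h1, conv_kernelG hk' hf.comp_neg
    (hf2.comp_measurePreserving (Measure.measurePreserving_neg (volume : Measure ℝ))),
    mulOp_eq_integral, mulOp_eq_integral, ← integral_neg, ← integral_neg_eq_self]
  congr 1; ext η
  rw [fourier_comp_neg, symbolNeg_eq]
  push_cast
  simp only [neg_neg, mul_neg, neg_mul]

/-! ### The Volterra operator -/

/-- `∫_{-∞}^x e^{ik(x-y)} f(y) dy`. -/
noncomputable def volterra (k : ℂ) (f : ℝ → ℂ) (x : ℝ) : ℂ :=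
  ∫ y in Set.Iic x, Complex.exp (Complex.I * k * (x - y)) * f y

section Volterra

variable {k : ℂ} {f g : ℝ → ℂ}

theorem norm_exp_sub_le (hk : 0 ≤ k.im) {x y : ℝ} (h : y ≤ x) :
    ‖Complex.exp (Complex.I * k * (x - y))‖ ≤ 1 := by
  rw [Complex.norm_exp, Real.exp_le_one_iff]
  have : (Complex.I * k * (x - y)).re = -(k.im * (x - y)) := by
    simp [Complex.mul_re, Complex.sub_re, Complex.sub_im]
  rw [this]
  have := mul_nonneg hk (sub_nonneg.2 h)
  linarith

theorem integrableOn_volterra (hk : 0 ≤ k.im) (hf : Integrable f) (x : ℝ) :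
    IntegrableOn (fun y : ℝ => Complex.exp (Complex.I * k * (x - y)) * f y) (Set.Iic x) := by
  refine Integrable.bdd_mul (c := 1) hf.integrableOn ?_ ?_
  · exact Continuous.aestronglyMeasurable (by fun_prop)
  · filter_upwards [ae_restrict_mem measurableSet_Iic] with y hy
    exact norm_exp_sub_le hk hy

theorem norm_volterra_le_setIntegral (hk : 0 ≤ k.im) (hf : Integrable f) (x : ℝ) :
    ‖volterra k f x‖ ≤ ∫ y in Set.Iic x, ‖f y‖ := by
  refine norm_integral_le_of_norm_le hf.norm.integrableOn ?_
  filter_upwards [ae_restrict_mem measurableSet_Iic] with y hy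
  rw [norm_mul]
  exact mul_le_of_le_one_left (norm_nonneg _) (norm_exp_sub_le hk hy)

theorem norm_volterra_le (hk : 0 ≤ k.im) (hf : Integrable f) (x : ℝ) :
    ‖volterra k f x‖ ≤ ∫ y, ‖f y‖ :=
  (norm_volterra_le_setIntegral hk hf x).trans
    (setIntegral_le_integral hf.norm (Eventually.of_forall fun _ => norm_nonneg _))

theorem volterra_eq_integral_indicator (k : ℂ) (f : ℝ → ℂ) (x : ℝ) :
    volterra k f x = ∫ y, Set.indicator (Set.Iic x)
      (fun y : ℝ => Complex.exp (Complex.I * k * (x - y)) * f y) y := by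
  rw [volterra, integral_indicator measurableSet_Iic]

theorem continuous_volterra (hk : 0 ≤ k.im) (hf : Integrable f) : Continuous (volterra k f) := by
  rw [continuous_iff_continuousAt]
  intro x₀
  rw [funext (volterra_eq_integral_indicator k f)]
  refine continuousAt_of_dominated (bound := fun y => ‖f y‖) ?_ ?_ hf.norm ?_
  · refine Eventually.of_forall fun x => ?_
    refine AEStronglyMeasurable.indicator ?_ measurableSet_Iic
    exact (Continuous.aestronglyMeasurable (by fun_prop)).mul hf.1
  · refine Eventually.of_forall fun x => Eventually.of_forall fun y => ?_
    by_cases hy : y ∈ Set.Iic x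
    · rw [Set.indicator_of_mem hy, norm_mul]
      exact mul_le_of_le_one_left (norm_nonneg _) (norm_exp_sub_le hk hy)
    · rw [Set.indicator_of_notMem hy, norm_zero]
      exact norm_nonneg _
  · have : ∀ᵐ y : ℝ, y ≠ x₀ := by simp [ae_iff]
    filter_upwards [this] with y hy
    rcases hy.lt_or_gt with h | h
    · have : ContinuousAt (fun x : ℝ => Complex.exp (Complex.I * k * (x - y)) * f y) x₀ := by
        fun_prop
      refine this.congr ?_
      filter_upwards [lt_mem_nhds h] with x hx
      rw [Set.indicator_of_mem (show y ∈ Set.Iic x from hx.le)]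
    · refine (continuousAt_const (y := (0:ℂ))).congr ?_
      filter_upwards [gt_mem_nhds h] with x hx
      rw [Set.indicator_of_notMem (show y ∉ Set.Iic x from not_le.2 hx)]

theorem volterra_zero (f : ℝ → ℂ) : volterra 0 f = fun x => ∫ y in Set.Iic x, f y := by
  ext x; simp [volterra]

theorem volterra_add (hk : 0 ≤ k.im) (hf : Integrable f) (hg : Integrable g) (x : ℝ) :
    volterra k (fun y => f y + g y) x = volterra k f x + volterra k g x := by
  simp only [volterra, mul_add]
  exact integral_add (integrableOn_volterra hk hf x) (integrableOn_volterra hk hg x)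

theorem volterra_const_mul (c k : ℂ) (f : ℝ → ℂ) (x : ℝ) :
    volterra k (fun y => c * f y) x = c * volterra k f x := by
  simp only [volterra, ← integral_const_mul]
  congr 1; ext y; ring

/-- Fubini on the triangle `y ≤ t ≤ x`: the exponentials multiply to one that does not involve `t`,
so the inner integral is a plain integral of `f`. -/
theorem volterra_mul_volterra (hk : 0 ≤ k.im) (hf : Integrable f) (hg : Integrable g) (x : ℝ) :
    volterra k (fun t => f t * volterra k g t) x =
      volterra k (fun y => g y * ∫ t in y..x, f t) x := by
  set S : Set (ℝ × ℝ) := {p | p.1 ≤ x ∧ p.2 ≤ p.1} with hS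
  have hSm : MeasurableSet S :=
    (measurableSet_le measurable_fst measurable_const).inter
      (measurableSet_le measurable_snd measurable_fst)
  have hint : Integrable (S.indicator fun p : ℝ × ℝ =>
      Complex.exp (Complex.I * k * (x - p.2)) * (f p.1 * g p.2)) (volume.prod volume) := by
    rw [integrable_indicator_iff hSm]
    refine Integrable.bdd_mul (c := 1) (hf.mul_prod hg).integrableOn ?_ ?_
    · exact Continuous.aestronglyMeasurable (by fun_prop)
    · filter_upwards [ae_restrict_mem hSm] with p hp
      exact norm_exp_sub_le hk (hp.2.trans hp.1)
  have hswap := integral_integral_swap (f := fun t y => S.indicator (fun p : ℝ × ℝ =>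
      Complex.exp (Complex.I * k * (x - p.2)) * (f p.1 * g p.2)) (t, y)) hint
  have hl : volterra k (fun t => f t * volterra k g t) x = ∫ t, ∫ y, S.indicator (fun p : ℝ × ℝ =>
      Complex.exp (Complex.I * k * (x - p.2)) * (f p.1 * g p.2)) (t, y) := by
    rw [volterra_eq_integral_indicator]
    congr 1; ext t
    by_cases ht : t ∈ Set.Iic x
    · rw [Set.indicator_of_mem ht, volterra_eq_integral_indicator, ← mul_assoc,
        ← integral_const_mul]
      congr 1; ext y
      by_cases hy : y ∈ Set.Iic t
      · rw [Set.indicator_of_mem hy, Set.indicator_of_mem (show (t, y) ∈ S from ⟨ht, hy⟩)]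
        have : Complex.exp (Complex.I * k * (x - y)) = Complex.exp (Complex.I * k * (x - t)) *
            Complex.exp (Complex.I * k * (t - y)) := by
          rw [← Complex.exp_add]; ring_nf
        rw [this]; ring
      · rw [Set.indicator_of_notMem hy, Set.indicator_of_notMem (fun h => hy h.2), mul_zero]
    · rw [Set.indicator_of_notMem ht]
      simp [hS, show ¬ t ≤ x from ht]
  have hr : volterra k (fun y => g y * ∫ t in y..x, f t) x =
      ∫ y, ∫ t, S.indicator (fun p : ℝ × ℝ =>
      Complex.exp (Complex.I * k * (x - p.2)) * (f p.1 * g p.2)) (t, y) := by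
    rw [volterra_eq_integral_indicator]
    congr 1; ext y
    by_cases hy : y ∈ Set.Iic x
    · rw [Set.indicator_of_mem hy, intervalIntegral.integral_of_le hy, ← mul_assoc,
        ← integral_const_mul, ← integral_Icc_eq_integral_Ioc, ← integral_indicator measurableSet_Icc]
      congr 1; ext t
      by_cases ht : t ∈ Set.Icc y x
      · rw [Set.indicator_of_mem ht, Set.indicator_of_mem (show (t, y) ∈ S from ⟨ht.2, ht.1⟩)]
        ring
      · rw [Set.indicator_of_notMem ht, Set.indicator_of_notMem (fun h => ht ⟨h.2, h.1⟩)]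
    · rw [Set.indicator_of_notMem hy]
      have : ∀ t, (t, y) ∉ S := fun t h => hy (h.2.trans h.1)
      simp [this]
  rw [hl, hr, hswap]

/-- The double integral of `f(x) g(y)` is split along the diagonal. This is integration by parts for
primitives, with no regularity of the densities. -/
theorem integral_mul_primitive_add (hf : Integrable f) (hg : Integrable g) :
    (∫ x, f x * ∫ y in Set.Iic x, g y) + ∫ x, g x * ∫ y in Set.Iic x, f y =
      (∫ x, f x) * ∫ x, g x := by
  set S : Set (ℝ × ℝ) := {p | p.1 ≤ p.2} with hS
  have hSm : MeasurableSet S := measurableSet_le measurable_fst measurable_snd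
  have hint : Integrable (S.indicator fun p : ℝ × ℝ => f p.1 * g p.2) (volume.prod volume) :=
    (hf.mul_prod hg).indicator hSm
  have hswap := integral_integral_swap
    (f := fun x y => S.indicator (fun p : ℝ × ℝ => f p.1 * g p.2) (x, y)) hint
  have h1 : ∀ x, ∫ y, S.indicator (fun p : ℝ × ℝ => f p.1 * g p.2) (x, y)
      = f x * ∫ y in Set.Ioi x, g y := by
    intro x
    rw [← integral_Ici_eq_integral_Ioi, ← integral_const_mul, ← integral_indicator measurableSet_Ici]
    rfl
  have h2 : ∀ y, ∫ x, S.indicator (fun p : ℝ × ℝ => f p.1 * g p.2) (x, y)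
      = g y * ∫ x in Set.Iic y, f x := by
    intro y
    rw [← integral_const_mul, ← integral_indicator measurableSet_Iic]
    congr 1; ext x
    by_cases h : x ≤ y
    · rw [Set.indicator_of_mem (show x ∈ Set.Iic y from h),
        Set.indicator_of_mem (show (x, y) ∈ S from h), mul_comm]
    · rw [Set.indicator_of_notMem (show x ∉ Set.Iic y from h),
        Set.indicator_of_notMem (show (x, y) ∉ S from h)]
  simp only [h1, h2] at hswap
  have hc : Continuous fun x => ∫ y in Set.Iic x, g y := by
    simpa only [volterra_zero] using continuous_volterra (k := 0) (by simp) hg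
  have hi1 : Integrable fun x => f x * ∫ y in Set.Iic x, g y := by
    refine hf.mul_bdd (c := ∫ y, ‖g y‖) hc.aestronglyMeasurable (Eventually.of_forall fun x => ?_)
    exact (norm_integral_le_integral_norm _).trans
      (setIntegral_le_integral hg.norm (Eventually.of_forall fun _ => norm_nonneg _))
  have hi2 : Integrable fun x => f x * ∫ y in Set.Ioi x, g y := by
    have := hint.integral_prod_left
    simpa only [h1] using this
  rw [← hswap, ← integral_add hi1 hi2, ← integral_mul_const]
  congr 1; ext x
  rw [← mul_add]
  congr 1
  exact intervalIntegral.integral_Iic_add_Ioi hg.integrableOn hg.integrableOn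

end Volterra

/-! ### The phase function -/

/-- `e^{i ∫_{-∞}^x u}`. -/
noncomputable def phase (u : ℝ → ℝ) (x : ℝ) : ℂ :=
  Complex.exp (Complex.I * ((∫ t in Set.Iic x, u t : ℝ) : ℂ))

section Phase

variable {u v : ℝ → ℝ}

theorem norm_phase (u : ℝ → ℝ) (x : ℝ) : ‖phase u x‖ = 1 := by
  rw [phase, mul_comm, Complex.norm_exp_ofReal_mul_I]

theorem phase_neg (u : ℝ → ℝ) (x : ℝ) : phase (fun t => -u t) x = conj (phase u x) := by
  simp [phase, ← Complex.exp_conj, integral_neg]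

theorem phase_mul_conj (u : ℝ → ℝ) (x : ℝ) : phase u x * conj (phase u x) = 1 := by
  rw [Complex.mul_conj, Complex.normSq_eq_norm_sq, norm_phase]; simp

theorem continuous_phase (hu : Integrable u) : Continuous (phase u) := by
  have hc := continuous_volterra (k := 0) (by simp) (hu.ofReal (𝕜 := ℂ))
  have : phase u = fun x => Complex.exp (Complex.I * volterra 0 (fun t => (u t : ℂ)) x) := by
    ext x; simp [phase, volterra, integral_complex_ofReal]
  rw [this]
  exact Complex.continuous_exp.comp (continuous_const.mul hc)

theorem integrable_mul_phase (hu : Integrable u) : Integrable (fun t => (u t : ℂ) * phase u t) :=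
  hu.ofReal.mul_bdd (c := 1) (continuous_phase hu).aestronglyMeasurable
    (Eventually.of_forall fun x => (norm_phase u x).le)

theorem phase_eq_of_continuous (hu : Continuous u) (hi : Integrable u) (x : ℝ) :
    phase u x = 1 + Complex.I * ∫ t in Set.Iic x, (u t : ℂ) * phase u t := by
  have hU : ∀ y, HasDerivAt (fun y => ∫ t in Set.Iic y, u t) (u y) y := by
    intro y
    have h1 : HasDerivAt (fun y => ∫ t in (0:ℝ)..y, u t) (u y) y :=
      intervalIntegral.integral_hasDerivAt_right (hu.intervalIntegrable _ _)
        (hu.stronglyMeasurableAtFilter _ _) hu.continuousAt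
    have h2 : (fun y => ∫ t in Set.Iic y, u t) =
        fun y => (∫ t in Set.Iic 0, u t) + ∫ t in (0:ℝ)..y, u t := by
      ext y
      rw [← intervalIntegral.integral_Iic_sub_Iic hi.integrableOn hi.integrableOn]; ring
    rw [h2]
    exact h1.const_add _
  have hd : ∀ y ∈ Set.Iic x, HasDerivAt (phase u) (Complex.I * ((u y : ℂ) * phase u y)) y := by
    intro y _
    unfold phase
    refine (((hU y).ofReal_comp).const_mul Complex.I).cexp.congr_deriv ?_
    ring
  have hlim : Tendsto (phase u) atBot (𝓝 1) := by
    have h0 : Tendsto (fun y => ∫ t in Set.Iic y, u t) atBot (𝓝 0) :=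
      tendsto_integral_Iic_zero tendsto_id
    have : ContinuousAt (fun r : ℝ => Complex.exp (Complex.I * (r : ℂ))) 0 := by fun_prop
    have h1 := this.tendsto.comp h0
    simp only [Complex.ofReal_zero, mul_zero, Complex.exp_zero] at h1
    exact h1
  have := integral_Iic_of_hasDerivAt_of_tendsto' hd
    (((integrable_mul_phase hi).const_mul Complex.I).integrableOn) hlim
  rw [integral_const_mul] at this
  rw [this]; ring

theorem norm_phase_sub_le (hu : Integrable u) (hv : Integrable v) (x : ℝ) :
    ‖phase u x - phase v x‖ ≤ ∫ t, ‖u t - v t‖ := by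
  have h1 : ‖phase u x - phase v x‖ ≤ ‖(∫ t in Set.Iic x, u t) - ∫ t in Set.Iic x, v t‖ := by
    have e : phase u x - phase v x = phase v x *
        (Complex.exp (Complex.I * (((∫ t in Set.Iic x, u t) - ∫ t in Set.Iic x, v t : ℝ) : ℂ)) - 1) := by
      rw [mul_sub, phase, phase, ← Complex.exp_add, mul_one]
      push_cast; ring_nf
    rw [e, norm_mul, norm_phase, one_mul]
    exact Real.norm_exp_I_mul_ofReal_sub_one_le
  refine h1.trans ?_
  rw [← integral_sub hu.integrableOn hv.integrableOn]
  exact (norm_integral_le_integral_norm _).trans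
    (setIntegral_le_integral (hu.sub hv).norm (Eventually.of_forall fun _ => norm_nonneg _))

/-- For continuous `u` this is the fundamental theorem of calculus. Both sides are Lipschitz in the
`L¹` distance to a fixed `u`, at least near it, so density of continuous functions gives the general
case. -/
theorem phase_eq (hu : Integrable u) (x : ℝ) :
    phase u x = 1 + Complex.I * ∫ t in Set.Iic x, (u t : ℂ) * phase u t := by
  rw [← sub_eq_zero, ← norm_eq_zero]
  refine le_antisymm (le_of_forall_pos_le_add fun ε hε => ?_) (norm_nonneg _)
  set M := ∫ t, ‖u t‖ with hM
  have hM0 : 0 ≤ M := integral_nonneg fun _ => norm_nonneg _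
  -- The total error is `δ` from the phases plus `M δ + δ` from the integrals, hence the divisor `2
  -- + M`.
  obtain ⟨v, -, hvd, hvc, hvi⟩ := hu.exists_hasCompactSupport_integral_sub_le
    (ε := ε / (2 + M)) (by positivity)
  have hsub := norm_phase_sub_le hu hvi
  set δ := ∫ t, ‖u t - v t‖ with hδ
  have h1 : ‖∫ t in Set.Iic x, ((v t : ℂ) * phase v t - (u t : ℂ) * phase u t)‖ ≤ M * δ + δ := by
    have hi : Integrable fun t => ‖u t‖ * δ + ‖u t - v t‖ :=
      (hu.norm.mul_const δ).add (hu.sub hvi).norm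
    have hb : ∀ t, ‖(v t : ℂ) * phase v t - (u t : ℂ) * phase u t‖ ≤ ‖u t‖ * δ + ‖u t - v t‖ := by
      intro t
      have e : (v t : ℂ) * phase v t - (u t : ℂ) * phase u t =
          -((u t : ℂ) * (phase u t - phase v t)) + -((u t - v t : ℝ) : ℂ) * phase v t := by
        push_cast; ring
      rw [e]
      refine (norm_add_le _ _).trans ?_
      rw [norm_neg, norm_mul, norm_mul, norm_neg, norm_phase, Complex.norm_real, Complex.norm_real,
        mul_one]
      gcongr
      exact hsub t
    calc _ ≤ ∫ t in Set.Iic x, (‖u t‖ * δ + ‖u t - v t‖) :=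
          norm_integral_le_of_norm_le hi.integrableOn (Eventually.of_forall hb)
      _ ≤ ∫ t, (‖u t‖ * δ + ‖u t - v t‖) :=
          setIntegral_le_integral hi (Eventually.of_forall fun t =>
            (norm_nonneg _).trans (hb t))
      _ = _ := by
          rw [← integral_mul_const, hδ]
          exact integral_add (hu.norm.mul_const δ) (hu.sub hvi).norm
  rw [integral_sub (integrable_mul_phase hvi).integrableOn (integrable_mul_phase hu).integrableOn]
    at h1
  have e : phase u x - (1 + Complex.I * ∫ t in Set.Iic x, (u t : ℂ) * phase u t) =
      (phase u x - phase v x) + Complex.I * ((∫ t in Set.Iic x, (v t : ℂ) * phase v t)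
        - ∫ t in Set.Iic x, (u t : ℂ) * phase u t) := by
    rw [phase_eq_of_continuous hvc hvi x]; ring
  rw [e]
  refine (norm_add_le _ _).trans ?_
  rw [norm_mul, Complex.norm_I, one_mul, zero_add]
  calc _ ≤ δ + (M * δ + δ) := add_le_add (hsub x) h1
    _ = (2 + M) * δ := by ring
    _ ≤ (2 + M) * (ε / (2 + M)) := by gcongr
    _ = ε := by field_simp

theorem phase_sub_phase (hu : Integrable u) (x y : ℝ) :
    phase u x - phase u y = Complex.I * ∫ t in y..x, (u t : ℂ) * phase u t := by
  rw [← intervalIntegral.integral_Iic_sub_Iic (integrable_mul_phase hu).integrableOn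
    (integrable_mul_phase hu).integrableOn, mul_sub]
  rw [phase_eq hu x, phase_eq hu y]
  ring

end Phase

/-! ### Uniform decay of oscillatory Volterra integrals -/

theorem volterra_eq_of_contDiff {k : ℂ} (hk : 0 ≤ k.im) {f : ℝ → ℂ} (hf : ContDiff ℝ 1 f)
    (hs : HasCompactSupport f) (x : ℝ) :
    Complex.I * k * volterra k f x = volterra k (deriv f) x - f x := by
  have hfi : Integrable f := hf.continuous.integrable_of_hasCompactSupport hs
  have hdi : Integrable (deriv f) :=
    (hf.continuous_deriv le_rfl).integrable_of_hasCompactSupport hs.deriv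
  have hd : ∀ y ∈ Set.Iic x, HasDerivAt (fun y : ℝ => Complex.exp (Complex.I * k * (x - y)) * f y)
      (Complex.exp (Complex.I * k * (x - y)) * deriv f y
        - (Complex.I * k) * (Complex.exp (Complex.I * k * (x - y)) * f y)) y := by
    intro y _
    have h1 : HasDerivAt (fun y : ℝ => (y : ℂ)) 1 y := Complex.ofRealCLM.hasDerivAt
    have h2 := ((h1.const_sub (x : ℂ)).const_mul (Complex.I * k)).cexp
    have h3 := h2.mul ((hf.differentiable one_ne_zero) y).hasDerivAt
    refine h3.congr_deriv ?_
    ring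
  have hlim : Tendsto (fun y : ℝ => Complex.exp (Complex.I * k * (x - y)) * f y) atBot (𝓝 0) := by
    have h0 : Tendsto f atBot (𝓝 0) := hs.is_zero_at_infty.mono_left atBot_le_cocompact
    refine squeeze_zero_norm' ?_ (tendsto_zero_iff_norm_tendsto_zero.1 h0)
    filter_upwards [eventually_le_atBot x] with y hy
    rw [norm_mul]
    exact mul_le_of_le_one_left (norm_nonneg _) (norm_exp_sub_le hk hy)
  have h := integral_Iic_of_hasDerivAt_of_tendsto' hd
    ((integrableOn_volterra hk hdi x).sub ((integrableOn_volterra hk hfi x).const_mul _)) hlim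
  rw [integral_sub (integrableOn_volterra hk hdi x)
    ((integrableOn_volterra hk hfi x).const_mul _), integral_const_mul] at h
  simp only [sub_self, mul_zero, Complex.exp_zero, one_mul, sub_zero] at h
  rw [volterra, volterra, ← h]
  ring

/-- A Riemann–Lebesgue lemma uniform in `x` and over the closed upper half plane. The exponential
has modulus at most one there, so an `L¹`-small error stays small, and a smooth compactly supported
approximant gains `1/‖k‖` by parts. -/
theorem exists_norm_volterra_le {f : ℝ → ℂ} (hf : Integrable f) {ε : ℝ} (hε : 0 < ε) :
    ∃ K : ℝ, 0 < K ∧ ∀ k : ℂ, 0 ≤ k.im → K ≤ ‖k‖ → ∀ x, ‖volterra k f x‖ ≤ ε := by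
  obtain ⟨g, hgs, hgc, hfg⟩ := MeasureTheory.MemLp.exist_eLpNorm_sub_le (μ := volume)
    ENNReal.one_ne_top le_rfl (memLp_one_iff_integrable.2 hf) (half_pos hε)
  have hg1 : ContDiff ℝ 1 g := hgc.of_le (by exact_mod_cast le_top)
  have hgi : Integrable g := hg1.continuous.integrable_of_hasCompactSupport hgs
  have hdi : Integrable (deriv g) :=
    (hg1.continuous_deriv le_rfl).integrable_of_hasCompactSupport hgs.deriv
  obtain ⟨B, hB⟩ := hgs.exists_bound_of_continuous hg1.continuous
  have hB0 : 0 ≤ B := (norm_nonneg _).trans (hB 0)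
  set D := ∫ y, ‖deriv g y‖ with hD
  have hD0 : 0 ≤ D := integral_nonneg fun _ => norm_nonneg _
  -- Integration by parts gives `‖k‖ ‖volterra k g x‖ ≤ D + B`; the extra `1` makes the threshold
  -- positive and the final contradiction strict.
  refine ⟨(D + B + 1) / (ε / 2), by positivity, fun k hk hkK x => ?_⟩
  have hfg' : ∫ y, ‖(f - g) y‖ ≤ ε / 2 := by
    rw [integral_norm_eq_lintegral_enorm (hf.sub hgi).1, ← eLpNorm_one_eq_lintegral_enorm]
    exact ENNReal.toReal_le_of_le_ofReal (by positivity) hfg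
  have h1 : ‖volterra k (f - g) x‖ ≤ ε / 2 := (norm_volterra_le hk (hf.sub hgi) x).trans hfg'
  have h2 : ‖volterra k g x‖ ≤ ε / 2 := by
    have h3 := congrArg norm (volterra_eq_of_contDiff hk hg1 hgs x)
    rw [norm_mul, norm_mul, Complex.norm_I, one_mul] at h3
    have h4 : ‖k‖ * ‖volterra k g x‖ ≤ D + B := by
      rw [h3]
      exact (norm_sub_le _ _).trans (add_le_add (norm_volterra_le hk hdi x) (hB x))
    rw [div_le_iff₀ (by positivity)] at hkK
    by_contra hcon
    have h5 := mul_le_mul hkK (not_le.1 hcon).le (by positivity)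
      (by positivity)
    nlinarith [norm_nonneg k, not_le.1 hcon]
  have e : f = fun y => (f - g) y + g y := by ext y; simp
  rw [e, volterra_add hk (hf.sub hgi) hgi]
  exact (norm_add_le _ _).trans (by linarith)

/-! ### The kernel in the upper half plane -/

/-- For `Im k > 0` the Volterra operator is convolution with the integrable one-sided function
`e^{iky}` on `y > 0`, whose transform is elementary. -/
theorem integrable_volterra_and_fourier {k : ℂ} (hk : 0 < k.im) {f : ℝ → ℂ}
    (hf : Integrable f) : Integrable (volterra k f) ∧
      ∀ η, Complex.I * 𝓕 (volterra k f) η = ((2 * Real.pi * η : ℝ) - k : ℂ)⁻¹ * 𝓕 f η := by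
  have hkr : ∀ r : ℝ, k ≠ (r : ℂ) := by rintro r rfl; simp at hk
  set κ : ℝ → ℂ := (Set.Ioi 0).indicator fun y : ℝ => Complex.exp (Complex.I * k * y) with hκ
  have hre : (Complex.I * k).re < 0 := by simpa using hk
  have hκi : Integrable κ := by
    rw [hκ, integrable_indicator_iff measurableSet_Ioi]
    exact integrableOn_exp_mul_complex_Ioi hre 0
  have hconv : convolution f κ (ContinuousLinearMap.mul ℂ ℂ) volume = volterra k f := by
    ext x
    rw [convolution_def, volterra, integral_Iic_eq_integral_Iio, ← integral_indicator measurableSet_Iio]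
    congr 1; ext y
    rw [ContinuousLinearMap.mul_apply', hκ]
    by_cases hy : y < x
    · rw [Set.indicator_of_mem (show x - y ∈ Set.Ioi (0:ℝ) by simpa using hy),
        Set.indicator_of_mem (show y ∈ Set.Iio x from hy), mul_comm]
      push_cast; rfl
    · rw [Set.indicator_of_notMem (show x - y ∉ Set.Ioi (0:ℝ) by simpa using hy),
        Set.indicator_of_notMem (show y ∉ Set.Iio x from hy), mul_zero]
  have hvi : Integrable (volterra k f) := by
    rw [← hconv]; exact hf.integrable_convolution _ hκi
  have hFκ : ∀ η, Complex.I * 𝓕 κ η = ((2 * Real.pi * η : ℝ) - k : ℂ)⁻¹ := by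
    intro η
    have hne : ((2 * Real.pi * η : ℝ) - k : ℂ) ≠ 0 := fun h => hkr _ (sub_eq_zero.1 h).symm
    have hre2 : (Complex.I * (k - (2 * Real.pi * η : ℝ))).re < 0 := by
      simp [Complex.mul_re]; exact hk
    have h1 : 𝓕 κ η = ∫ y in Set.Ioi (0:ℝ), Complex.exp (Complex.I * (k - (2 * Real.pi * η : ℝ)) * y) := by
      rw [Real.fourier_eq', ← integral_indicator measurableSet_Ioi]
      congr 1; ext y
      by_cases hy : y ∈ Set.Ioi (0:ℝ)
      · rw [hκ, Set.indicator_of_mem hy, Set.indicator_of_mem hy, smul_eq_mul, ← Complex.exp_add]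
        congr 1
        push_cast [RCLike.inner_apply, conj_trivial]
        ring
      · rw [hκ, Set.indicator_of_notMem hy, Set.indicator_of_notMem hy, smul_zero]
    rw [h1, integral_exp_mul_complex_Ioi hre2]
    have hne2 : k - ((2 * Real.pi * η : ℝ) : ℂ) ≠ 0 := by
      rw [← neg_ne_zero, neg_sub]; exact hne
    simp only [Complex.ofReal_zero, mul_zero, Complex.exp_zero]
    have := Complex.I_ne_zero
    refine eq_inv_of_mul_eq_one_left ?_
    field_simp
    ring
  have hF : ∀ η, 𝓕 (volterra k f) η = 𝓕 f η * 𝓕 κ η := by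
    intro η
    rw [← hconv]
    exact Real.fourier_mul_convolution_eq hf hκi η
  refine ⟨hvi, fun η => ?_⟩
  rw [hF, mul_left_comm, hFκ, mul_comm]

/-- The two half-line symbols together form the full symbol `1/(2πη - k)`, and Fourier inversion
applies because its product with `𝓕 f` is integrable. Consequently `G_k` off the real axis has the
same structure, Volterra minus `G̃_k`, as the boundary kernel. -/
theorem mulOp_symbol_add_eq_volterra {k : ℂ} (hk : 0 < k.im) {f : ℝ → ℂ} (hf : Integrable f)
    (hf2 : MemLp f 2) (x : ℝ) :
    mulOp (symbolPos k) f x + mulOp (symbolNeg k) f x = Complex.I * volterra k f x := by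
  have hkr : ∀ r : ℝ, k ≠ (r : ℂ) := by rintro r rfl; simp at hk
  have hp := memLp_symbolPos (k := k) fun r _ => hkr r
  have hn := memLp_symbolNeg (k := k) fun r _ => hkr r
  obtain ⟨hvi, hF⟩ := integrable_volterra_and_fourier hk hf
  have hae : (fun η => Complex.I * 𝓕 (volterra k f) η) =ᵐ[volume]
      fun η => (symbolPos k η + symbolNeg k η) * 𝓕 f η := by
    have : ∀ᵐ η : ℝ, η ≠ 0 := by simp [ae_iff]
    filter_upwards [this] with η hη
    rw [hF]
    congr 1
    rcases hη.lt_or_gt with h | h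
    · rw [symbolPos, symbolNeg, Set.indicator_of_notMem (show η ∉ Set.Ioi (0:ℝ) from not_lt.2 h.le),
        Set.indicator_of_mem (show η ∈ Set.Iio (0:ℝ) from h), zero_add]
    · rw [symbolPos, symbolNeg, Set.indicator_of_mem (show η ∈ Set.Ioi (0:ℝ) from h),
        Set.indicator_of_notMem (show η ∉ Set.Iio (0:ℝ) from not_lt.2 h.le), add_zero]
  have hFi : Integrable (𝓕 (volterra k f)) := by
    have := ((integrable_mul_fourier (hp.add hn) hf hf2).congr hae.symm).const_mul (-Complex.I)
    refine this.congr (Eventually.of_forall fun η => ?_)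
    simp only [← mul_assoc]
    simp
  have hinv := hvi.fourierInv_fourier_eq hFi (continuous_volterra hk.le hf).continuousAt (v := x)
  rw [← mulOp_add_left hp hn hf hf2, mulOp, ← hinv, ← fourierInv_fun_const_mul]
  simp only [Real.fourierInv_eq]
  refine integral_congr_ae ?_
  filter_upwards [hae] with η hη
  simp only [hη]

/-! ### Operators on bounded continuous functions -/

/-- A linear operator on bounded continuous functions given by its values. -/
noncomputable def mkOp (A : (ℝ →ᵇ ℂ) → ℝ → ℂ) (hc : ∀ m, Continuous (A m))
    (ha : ∀ m n x, A (m + n) x = A m x + A n x) (hs : ∀ (c : ℂ) m x, A (c • m) x = c * A m x)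
    (C : ℝ) (hb : ∀ m x, ‖A m x‖ ≤ C * ‖m‖) : (ℝ →ᵇ ℂ) →L[ℂ] (ℝ →ᵇ ℂ) :=
  LinearMap.mkContinuous
    { toFun := fun m => BoundedContinuousFunction.ofNormedAddCommGroup (A m) (hc m) (C * ‖m‖) (hb m)
      map_add' := fun m n => by ext x; exact ha m n x
      map_smul' := fun c m => by ext x; exact hs c m x } C
    (fun m => by
      refine BoundedContinuousFunction.norm_le_of_nonempty.2 (hb m))

theorem norm_mkOp_le {A : (ℝ →ᵇ ℂ) → ℝ → ℂ} {hc ha hs} {C : ℝ} {hb} (hC : 0 ≤ C) :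
    ‖mkOp A hc ha hs C hb‖ ≤ C :=
  ContinuousLinearMap.opNorm_le_bound _ hC fun m =>
    BoundedContinuousFunction.norm_le_of_nonempty.2 (hb m)

section Weight

variable {w : ℝ → ℂ}

theorem integrable_mul_bcf (hw : Integrable w) (m : ℝ →ᵇ ℂ) : Integrable (fun y => w y * m y) :=
  hw.mul_bdd (c := ‖m‖) m.continuous.aestronglyMeasurable
    (Eventually.of_forall fun x => m.norm_coe_le_norm x)

theorem memLp_mul_bcf (hw2 : MemLp w 2) (m : ℝ →ᵇ ℂ) : MemLp (fun y => w y * m y) 2 :=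
  MemLp.of_le_mul (c := ‖m‖) hw2 (hw2.1.mul m.continuous.aestronglyMeasurable)
    (Eventually.of_forall fun x => by
      rw [norm_mul, mul_comm]
      gcongr
      exact m.norm_coe_le_norm x)

theorem integral_norm_mul_bcf_le (hw : Integrable w) (m : ℝ →ᵇ ℂ) :
    ∫ y, ‖w y * m y‖ ≤ (∫ y, ‖w y‖) * ‖m‖ := by
  rw [← integral_mul_const]
  refine integral_mono (integrable_mul_bcf hw m).norm (hw.norm.mul_const _) fun y => ?_
  simp only [norm_mul]
  gcongr
  exact m.norm_coe_le_norm y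

theorem l2_mul_bcf_le (hw2 : MemLp w 2) (m : ℝ →ᵇ ℂ) :
    l2 (fun y => w y * m y) ≤ l2 w * ‖m‖ := by
  rw [mul_comm]
  refine l2_mul_le hw2 (norm_nonneg _) fun x => ?_
  rw [norm_mul, mul_comm]
  gcongr
  exact m.norm_coe_le_norm x

/-- The operator `m ↦ i ∫_{-∞}^x e^{ik(x-y)} w(y) m(y) dy`. -/
noncomputable def vOp (k : ℂ) (hk : 0 ≤ k.im) (w : ℝ → ℂ) (hw : Integrable w) :
    (ℝ →ᵇ ℂ) →L[ℂ] (ℝ →ᵇ ℂ) :=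
  mkOp (fun m x => Complex.I * volterra k (fun y => w y * m y) x)
    (fun m => continuous_const.mul (continuous_volterra hk (integrable_mul_bcf hw m)))
    (fun m n x => by
      rw [← mul_add, ← volterra_add hk (integrable_mul_bcf hw m) (integrable_mul_bcf hw n)]
      simp only [BoundedContinuousFunction.coe_add, Pi.add_apply, mul_add])
    (fun c m x => by
      rw [mul_left_comm, ← volterra_const_mul c]
      simp only [BoundedContinuousFunction.coe_smul, smul_eq_mul, mul_left_comm c])
    (∫ y, ‖w y‖) (fun m x => by
      rw [norm_mul, Complex.norm_I, one_mul]
      exact (norm_volterra_le hk (integrable_mul_bcf hw m) x).trans (integral_norm_mul_bcf_le hw m))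

theorem vOp_apply (k : ℂ) (hk : 0 ≤ k.im) (hw : Integrable w) (m : ℝ →ᵇ ℂ) (x : ℝ) :
    vOp k hk w hw m x = Complex.I * volterra k (fun y => w y * m y) x := rfl

theorem norm_vOp_le (k : ℂ) (hk : 0 ≤ k.im) (hw : Integrable w) :
    ‖vOp k hk w hw‖ ≤ ∫ y, ‖w y‖ :=
  norm_mkOp_le (integral_nonneg fun _ => norm_nonneg _)

/-- The operator `m ↦ 𝓕⁻ (q 𝓕 (w m))`. -/
noncomputable def pOp (q : ℝ → ℂ) (hq : MemLp q 2) (w : ℝ → ℂ) (hw : Integrable w)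
    (hw2 : MemLp w 2) : (ℝ →ᵇ ℂ) →L[ℂ] (ℝ →ᵇ ℂ) :=
  mkOp (fun m => mulOp q (fun y => w y * m y))
    (fun m => continuous_mulOp hq (integrable_mul_bcf hw m) (memLp_mul_bcf hw2 m))
    (fun m n x => by
      rw [← mulOp_add_right hq (integrable_mul_bcf hw m) (memLp_mul_bcf hw2 m)
        (integrable_mul_bcf hw n) (memLp_mul_bcf hw2 n)]
      simp only [BoundedContinuousFunction.coe_add, Pi.add_apply, mul_add])
    (fun c m x => by
      rw [← mulOp_const_mul_right]
      simp only [BoundedContinuousFunction.coe_smul, smul_eq_mul, mul_left_comm c])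
    (l2 q * l2 w) (fun m x => by
      refine (norm_mulOp_le hq (integrable_mul_bcf hw m) (memLp_mul_bcf hw2 m) x).trans ?_
      rw [mul_assoc]
      exact mul_le_mul_of_nonneg_left (l2_mul_bcf_le hw2 m) (l2_nonneg q))

theorem pOp_apply {q : ℝ → ℂ} (hq : MemLp q 2) (hw : Integrable w) (hw2 : MemLp w 2)
    (m : ℝ →ᵇ ℂ) (x : ℝ) : pOp q hq w hw hw2 m x = mulOp q (fun y => w y * m y) x := rfl

theorem norm_pOp_le {q : ℝ → ℂ} (hq : MemLp q 2) (hw : Integrable w) (hw2 : MemLp w 2) :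
    ‖pOp q hq w hw hw2‖ ≤ l2 q * l2 w :=
  norm_mkOp_le (mul_nonneg (l2_nonneg _) (l2_nonneg _))

theorem pOp_sub {q q' : ℝ → ℂ} (hq : MemLp q 2) (hq' : MemLp q' 2) (hw : Integrable w)
    (hw2 : MemLp w 2) :
    pOp q hq w hw hw2 - pOp q' hq' w hw hw2 = pOp (q - q') (hq.sub hq') w hw hw2 := by
  ext m x
  have h := mulOp_add_left (hq.sub hq') hq' (integrable_mul_bcf hw m) (memLp_mul_bcf hw2 m) x
  simp only [Pi.sub_apply, sub_add_cancel] at h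
  change mulOp q (fun y => w y * m y) x - mulOp q' (fun y => w y * m y) x = _
  rw [pOp_apply, sub_eq_iff_eq_add]
  exact h

end Weight

/-! ### Inversion of the Volterra part -/

/-- Multiplication by a bounded continuous function. -/
noncomputable def mOp (φ : ℝ →ᵇ ℂ) : (ℝ →ᵇ ℂ) →L[ℂ] (ℝ →ᵇ ℂ) :=
  ContinuousLinearMap.mul ℂ (ℝ →ᵇ ℂ) φ

section Resolvent

variable {u : ℝ → ℝ}

theorem integrable_coe (hu : Integrable u) : Integrable (fun t => (u t : ℂ)) := hu.ofReal

/-- `phase u` as a bounded continuous function. -/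
noncomputable def phaseB (u : ℝ → ℝ) (hu : Integrable u) : ℝ →ᵇ ℂ :=
  BoundedContinuousFunction.ofNormedAddCommGroup (phase u) (continuous_phase hu) 1
    (fun x => (norm_phase u x).le)

theorem phaseB_apply (hu : Integrable u) (x : ℝ) : phaseB u hu x = phase u x := rfl

theorem norm_mOp_phaseB_le (hu : Integrable u) : ‖mOp (phaseB u hu)‖ ≤ 1 := by
  refine (ContinuousLinearMap.opNorm_mul_apply_le _ _ _).trans ?_
  exact BoundedContinuousFunction.norm_ofNormedAddCommGroup_le _ zero_le_one _

/-- With `E` multiplication by the phase, this is `EV - VE = VEV`. The commutator has the factor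
`phase u x - phase u y`, which is `i` times the integral of `u · phase u` between `y` and `x`, and
`volterra_mul_volterra` recognises the outcome as a product of two Volterra operators. -/
theorem mOp_phase_comm (k : ℂ) (hk : 0 ≤ k.im) (hu : Integrable u) :
    mOp (phaseB u hu) * vOp k hk _ (integrable_coe hu)
      - vOp k hk _ (integrable_coe hu) * mOp (phaseB u hu) =
    vOp k hk _ (integrable_coe hu) * mOp (phaseB u hu) * vOp k hk _ (integrable_coe hu) := by
  ext m x
  change phase u x * (Complex.I * volterra k (fun y => (u y : ℂ) * m y) x)
    - Complex.I * volterra k (fun y => (u y : ℂ) * (phase u y * m y)) x =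
    Complex.I * volterra k (fun t => (u t : ℂ) *
      (phase u t * (Complex.I * volterra k (fun y => (u y : ℂ) * m y) t))) x
  have hm := integrable_mul_bcf (integrable_coe hu) m
  have e1 : (fun t => (u t : ℂ) *
      (phase u t * (Complex.I * volterra k (fun y => (u y : ℂ) * m y) t))) =
      fun t => Complex.I * ((u t : ℂ) * phase u t * volterra k (fun y => (u y : ℂ) * m y) t) := by
    ext t; ring
  rw [e1, volterra_const_mul, volterra_mul_volterra hk (integrable_mul_phase hu) hm,
    mul_left_comm (phase u x), ← mul_sub]
  congr 1
  rw [← volterra_const_mul, ← volterra_const_mul]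
  have hi1 : Integrable fun y => phase u x * ((u y : ℂ) * m y) := hm.const_mul _
  have hi2 : Integrable fun y => (u y : ℂ) * (phase u y * m y) := by
    have := integrable_mul_bcf (integrable_mul_phase hu) m
    simpa only [mul_assoc] using this
  rw [sub_eq_iff_eq_add, ← volterra_add hk ?_ hi2]
  · congr 1; ext y
    linear_combination (u y * m y) * phase_sub_phase hu x y
  · have : (fun y => Complex.I * ((u y : ℂ) * m y * ∫ t in y..x, (u t : ℂ) * phase u t)) =
        fun y => phase u x * ((u y : ℂ) * m y) - (u y : ℂ) * (phase u y * m y) := by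
      ext y
      rw [mul_left_comm, ← phase_sub_phase hu x y]
      ring
    rw [this]
    exact hi1.sub hi2

/-- The inverse of `1 - V`, where `V` is the Volterra operator with weight `u`. -/
noncomputable def rOp (k : ℂ) (hk : 0 ≤ k.im) (u : ℝ → ℝ) (hu : Integrable u) :
    (ℝ →ᵇ ℂ) →L[ℂ] (ℝ →ᵇ ℂ) :=
  1 + mOp (phaseB u hu) * vOp k hk _ (integrable_coe hu) * mOp (phaseB (fun t => -u t) hu.neg)

theorem mOp_phase_mul_neg (hu : Integrable u) :
    mOp (phaseB u hu) * mOp (phaseB (fun t => -u t) hu.neg) = 1 := by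
  ext m x
  change phase u x * (phase (fun t => -u t) x * m x) = m x
  rw [← mul_assoc, phase_neg, phase_mul_conj, one_mul]

/-- The preceding commutation relation for `-u`: changing the sign of `u` replaces `V` by `-V` and
`E` by its inverse. The two relations give the right and the left inverse respectively. -/
theorem mOp_phase_neg_comm (k : ℂ) (hk : 0 ≤ k.im) (hu : Integrable u) :
    vOp k hk _ (integrable_coe hu) * mOp (phaseB (fun t => -u t) hu.neg)
      - mOp (phaseB (fun t => -u t) hu.neg) * vOp k hk _ (integrable_coe hu) =
    vOp k hk _ (integrable_coe hu) * mOp (phaseB (fun t => -u t) hu.neg)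
      * vOp k hk _ (integrable_coe hu) := by
  ext m x
  have h := DFunLike.congr_fun (DFunLike.congr_fun
    (mOp_phase_comm (u := fun t => -u t) k hk hu.neg) m) x
  set φ := phase (fun t => -u t) with hφ
  change φ x * (Complex.I * volterra k (fun y => ((-u y : ℝ) : ℂ) * m y) x)
    - Complex.I * volterra k (fun y => ((-u y : ℝ) : ℂ) * (φ y * m y)) x =
    Complex.I * volterra k (fun t => ((-u t : ℝ) : ℂ) *
      (φ t * (Complex.I * volterra k (fun y => ((-u y : ℝ) : ℂ) * m y) t))) x at h
  change Complex.I * volterra k (fun y => (u y : ℂ) * (φ y * m y)) x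
    - φ x * (Complex.I * volterra k (fun y => (u y : ℂ) * m y) x) =
    Complex.I * volterra k (fun t => (u t : ℂ) *
      (φ t * (Complex.I * volterra k (fun y => (u y : ℂ) * m y) t))) x
  have hv : ∀ (f : ℝ → ℂ) x, volterra k (fun y => ((-u y : ℝ) : ℂ) * f y) x =
      -1 * volterra k (fun y => (u y : ℂ) * f y) x := by
    intro f x
    rw [← volterra_const_mul (-1)]
    congr 1; funext y; push_cast; ring
  have hv2 : volterra k (fun t => (u t : ℂ) *
      (φ t * (Complex.I * (-1 * volterra k (fun y => (u y : ℂ) * m y) t)))) x =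
      -1 * volterra k (fun t => (u t : ℂ) *
      (φ t * (Complex.I * volterra k (fun y => (u y : ℂ) * m y) t))) x := by
    rw [← volterra_const_mul (-1)]
    congr 1; funext t; ring
  simp only [hv, hv2] at h
  linear_combination h

theorem one_sub_vOp_mul_rOp (k : ℂ) (hk : 0 ≤ k.im) (hu : Integrable u) :
    (1 - vOp k hk _ (integrable_coe hu)) * rOp k hk u hu = 1 := by
  have h1 := mOp_phase_comm k hk hu
  have h2 := mOp_phase_mul_neg hu
  rw [rOp]
  set V := vOp k hk _ (integrable_coe hu)
  set E := mOp (phaseB u hu)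
  set E' := mOp (phaseB (fun t => -u t) hu.neg)
  calc (1 - V) * (1 + E * V * E') = 1 - V + (E * V - V * E * V) * E' := by noncomm_ring
    _ = 1 - V + V * (E * E') := by
        rw [show E * V - V * E * V = V * E by rw [← h1, sub_sub_cancel], mul_assoc]
    _ = 1 := by rw [h2, mul_one, sub_add_cancel]

theorem rOp_mul_one_sub_vOp (k : ℂ) (hk : 0 ≤ k.im) (hu : Integrable u) :
    rOp k hk u hu * (1 - vOp k hk _ (integrable_coe hu)) = 1 := by
  have h1 := mOp_phase_neg_comm k hk hu
  have h2 := mOp_phase_mul_neg hu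
  rw [rOp]
  set V := vOp k hk _ (integrable_coe hu)
  set E := mOp (phaseB u hu)
  set E' := mOp (phaseB (fun t => -u t) hu.neg)
  have h3 : V * E' - V * E' * V = E' * V := by rw [← h1, sub_sub_cancel]
  calc (1 + E * V * E') * (1 - V) = 1 - V + E * (V * E' - V * E' * V) := by
        simp only [mul_sub, add_mul, one_mul, mul_one, mul_assoc]; abel
    _ = 1 - V + (E * E') * V := by rw [h3, mul_assoc]
    _ = 1 := by rw [h2, one_mul, sub_add_cancel]

theorem norm_rOp_le (k : ℂ) (hk : 0 ≤ k.im) (hu : Integrable u) :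
    ‖rOp k hk u hu‖ ≤ 1 + ∫ y, ‖u y‖ := by
  have h1 := norm_vOp_le k hk (integrable_coe hu)
  simp only [Complex.norm_real] at h1
  refine (norm_add_le _ _).trans (add_le_add (ContinuousLinearMap.norm_id_le) ?_)
  refine (norm_mul_le _ _).trans ?_
  refine (mul_le_mul (norm_mul_le _ _) (norm_mOp_phaseB_le _) (norm_nonneg _) (by positivity)).trans ?_
  rw [mul_one]
  refine (mul_le_mul (norm_mOp_phaseB_le _) h1 (norm_nonneg _) zero_le_one).trans ?_
  rw [one_mul]

end Resolvent

/-! ### Compactness -/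

/-- The functional `m ↦ ∫ w m`. -/
noncomputable def pairing (w : ℝ → ℂ) (hw : Integrable w) : (ℝ →ᵇ ℂ) →L[ℂ] ℂ :=
  LinearMap.mkContinuous
    { toFun := fun m => ∫ y, w y * m y
      map_add' := fun m n => by
        rw [← integral_add (integrable_mul_bcf hw m) (integrable_mul_bcf hw n)]
        simp only [BoundedContinuousFunction.coe_add, Pi.add_apply, mul_add]
      map_smul' := fun c m => by
        simp only [BoundedContinuousFunction.coe_smul, smul_eq_mul, RingHom.id_apply,
          ← integral_const_mul, mul_left_comm c] } (∫ y, ‖w y‖)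
    (fun m => (norm_integral_le_integral_norm _).trans (integral_norm_mul_bcf_le hw m))

theorem pairing_apply {w : ℝ → ℂ} (hw : Integrable w) (m : ℝ →ᵇ ℂ) :
    pairing w hw m = ∫ y, w y * m y := rfl

/-- The inverse Fourier transform of an integrable function as a bounded continuous function. -/
noncomputable def fourierInvB (q : ℝ → ℂ) (hq : Integrable q) : ℝ →ᵇ ℂ :=
  BoundedContinuousFunction.ofNormedAddCommGroup (𝓕⁻ q) (continuous_fourierInv hq) (∫ y, ‖q y‖)
    (norm_fourierInv_le q)

theorem isCompactOperator_smulRight (φ : (ℝ →ᵇ ℂ) →L[ℂ] ℂ) (b : ℝ →ᵇ ℂ) :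
    IsCompactOperator (φ.smulRight b) :=
  (isCompactOperator_of_locallyCompactSpace_rng
    (ContinuousLinearMap.toSpanSingleton ℂ b)).comp_clm φ

theorem isCompactOperator_sum {ι : Type*} (s : Finset ι)
    (T : ι → (ℝ →ᵇ ℂ) →L[ℂ] (ℝ →ᵇ ℂ)) (hT : ∀ i ∈ s, IsCompactOperator (T i)) :
    IsCompactOperator (∑ i ∈ s, T i : (ℝ →ᵇ ℂ) →L[ℂ] (ℝ →ᵇ ℂ)) := by
  classical
  induction s using Finset.induction_on with
  | empty => simpa using isCompactOperator_zero
  | insert i s hi ih =>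
    rw [Finset.sum_insert hi]
    exact (hT i (Finset.mem_insert_self _ _)).add
      (ih fun j hj => hT j (Finset.mem_insert_of_mem hj))

theorem isCompactOperator_of_forall_exists (T : (ℝ →ᵇ ℂ) →L[ℂ] (ℝ →ᵇ ℂ))
    (h : ∀ ε > 0, ∃ S : (ℝ →ᵇ ℂ) →L[ℂ] (ℝ →ᵇ ℂ), IsCompactOperator S ∧ ‖T - S‖ ≤ ε) :
    IsCompactOperator T := by
  have hcl : IsClosed {S : (ℝ →ᵇ ℂ) →L[ℂ] (ℝ →ᵇ ℂ) | IsCompactOperator S} :=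
    isClosed_setOfPred_isCompactOperator
  have : T ∈ closure {S : (ℝ →ᵇ ℂ) →L[ℂ] (ℝ →ᵇ ℂ) | IsCompactOperator S} := by
    rw [Metric.mem_closure_iff]
    intro ε hε
    obtain ⟨S, hS, hTS⟩ := h (ε / 2) (half_pos hε)
    refine ⟨S, hS, ?_⟩
    rw [dist_eq_norm]
    linarith
  rwa [hcl.closure_eq] at this

/-- On the product of the two compact supports the kernel `e^{-2πiyη}` is a uniform limit of its
Taylor polynomials. Each monomial `y^j η^j` separates variables, so the operator is a norm limit of
finite rank operators. -/
theorem isCompactOperator_pOp_of_hasCompactSupport {q w : ℝ → ℂ} (hqc : Continuous q)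
    (hqs : HasCompactSupport q) (hwc : Continuous w) (hws : HasCompactSupport w)
    (hq : MemLp q 2) (hw : Integrable w) (hw2 : MemLp w 2) :
    IsCompactOperator (pOp q hq w hw hw2) := by
  have hwj : ∀ j : ℕ, Integrable fun y : ℝ => (-2 * Real.pi * Complex.I * y) ^ j / j.factorial * w y :=
    fun j => (Continuous.mul (by fun_prop) hwc).integrable_of_hasCompactSupport hws.mul_left
  have hqj : ∀ j : ℕ, Integrable fun η : ℝ => (η : ℂ) ^ j * q η :=
    fun j => (Continuous.mul (by fun_prop) hqc).integrable_of_hasCompactSupport hqs.mul_left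
  have hqi : Integrable q := hqc.integrable_of_hasCompactSupport hqs
  obtain ⟨A, hA⟩ := hqs.isCompact.isBounded.exists_norm_le
  obtain ⟨B, hB⟩ := hws.isCompact.isBounded.exists_norm_le
  set Z : ℝ := 2 * Real.pi * (|A| * |B|) with hZ
  have hZ0 : 0 ≤ Z := by positivity
  set M : ℝ := (∫ y, ‖q y‖) * ∫ y, ‖w y‖ with hM
  have hM0 : 0 ≤ M := mul_nonneg (integral_nonneg fun _ => norm_nonneg _)
    (integral_nonneg fun _ => norm_nonneg _)
  refine isCompactOperator_of_forall_exists _ fun ε hε => ?_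
  have hlim : Tendsto (fun J : ℕ => Z ^ J / J.factorial * 2) atTop (𝓝 0) := by
    simpa using (FloorSemiring.tendsto_pow_div_factorial_atTop Z).mul_const 2
  -- Two demands on `J`: the Taylor remainder `2 Z^J / J!` must beat `ε / (M + 1)`, and `J ≥ 2Z` is
  -- needed for that form of the remainder to be valid.
  obtain ⟨J, hJ1, hJ2⟩ := ((hlim.eventually_lt_const (show 0 < ε / (M + 1) by positivity)).and
    (eventually_ge_atTop ⌈2 * Z⌉₊)).exists
  set δ := Z ^ J / J.factorial * 2 with hδ
  have hδ0 : 0 ≤ δ := by positivity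
  have hexp : ∀ η y : ℝ, q η ≠ 0 → w y ≠ 0 →
      ‖Complex.exp (-2 * Real.pi * Complex.I * y * η)
        - ∑ j ∈ Finset.range J, (-2 * Real.pi * Complex.I * y * η) ^ j / j.factorial‖ ≤ δ := by
    intro η y hη hy
    have h1 := hA η (subset_tsupport q hη)
    have h2 := hB y (subset_tsupport w hy)
    have hz : ‖(-2 * Real.pi * Complex.I * y * η : ℂ)‖ ≤ Z := by
      simp only [norm_mul, norm_neg, Complex.norm_I, Complex.norm_real, Complex.norm_ofNat,
        Real.norm_of_nonneg Real.pi_pos.le, mul_one]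
      rw [hZ, mul_assoc (2 * Real.pi), mul_comm ‖y‖]
      gcongr
      · exact h1.trans (le_abs_self A)
      · exact h2.trans (le_abs_self B)
    refine (Complex.exp_bound' ?_).trans ?_
    · rw [div_le_iff₀ (by positivity)]
      have : 2 * Z ≤ J := (Nat.le_ceil _).trans (by exact_mod_cast hJ2)
      push_cast
      linarith
    · rw [hδ]; gcongr
  refine ⟨∑ j ∈ Finset.range J, (pairing _ (hwj j)).smulRight (fourierInvB _ (hqj j)),
    isCompactOperator_sum _ _ fun j _ => isCompactOperator_smulRight _ _, ?_⟩
  refine ContinuousLinearMap.opNorm_le_bound _ hε.le fun m => ?_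
  rw [BoundedContinuousFunction.norm_le (by positivity)]
  intro x
  have hwm := integrable_mul_bcf hw m
  have hd : ∀ η, q η * 𝓕 (fun y => w y * m y) η
      - ∑ j ∈ Finset.range J, (η : ℂ) ^ j * q η * pairing _ (hwj j) m =
      q η * ∫ y : ℝ, (Complex.exp (-2 * Real.pi * Complex.I * y * η)
        - ∑ j ∈ Finset.range J, (-2 * Real.pi * Complex.I * y * η) ^ j / j.factorial) * (w y * m y) := by
    intro η
    have hi1 : Integrable fun y : ℝ => Complex.exp (-2 * Real.pi * Complex.I * y * η) * (w y * m y) := by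
      have := (Real.fourierIntegral_convergent_iff (f := fun y => w y * m y) (μ := volume) η).2 hwm
      refine this.congr (Eventually.of_forall fun y => ?_)
      simp only [Circle.smul_def, Real.fourierChar_apply, smul_eq_mul]
      congr 2
      push_cast [RCLike.inner_apply, conj_trivial]; ring
    have hi2 : ∀ j ∈ Finset.range J, Integrable fun y : ℝ =>
        (-2 * Real.pi * Complex.I * y * η : ℂ) ^ j / j.factorial * (w y * m y) := by
      intro j _
      refine ((integrable_mul_bcf (hwj j) m).const_mul ((η : ℂ) ^ j)).congr
        (Eventually.of_forall fun y => ?_)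
      simp only [mul_pow]; ring
    have e1 : ∫ y : ℝ, (Complex.exp (-2 * Real.pi * Complex.I * y * η)
        - ∑ j ∈ Finset.range J, (-2 * Real.pi * Complex.I * y * η) ^ j / j.factorial) * (w y * m y) =
        𝓕 (fun y => w y * m y) η - ∑ j ∈ Finset.range J, (η : ℂ) ^ j * pairing _ (hwj j) m := by
      simp only [sub_mul, Finset.sum_mul]
      rw [integral_sub hi1 (integrable_finsetSum _ hi2), integral_finsetSum _ hi2]
      congr 1
      · rw [Real.fourier_eq']
        congr 1; ext y
        rw [smul_eq_mul]
        congr 2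
        push_cast [RCLike.inner_apply, conj_trivial]; ring
      · refine Finset.sum_congr rfl fun j _ => ?_
        rw [pairing_apply, ← integral_const_mul]
        congr 1; ext y
        simp only [mul_pow]; ring
    rw [e1, mul_sub, Finset.mul_sum]
    congr 1
    exact Finset.sum_congr rfl fun j _ => by ring
  have hval : (pOp q hq w hw hw2 - ∑ j ∈ Finset.range J,
      (pairing _ (hwj j)).smulRight (fourierInvB _ (hqj j))) m x =
      𝓕⁻ (fun η => q η * 𝓕 (fun y => w y * m y) η
      - ∑ j ∈ Finset.range J, (η : ℂ) ^ j * q η * pairing _ (hwj j) m) x := by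
    have hi1 : Integrable fun η => q η * 𝓕 (fun y => w y * m y) η :=
      integrable_mul_fourier hq hwm (memLp_mul_bcf hw2 m)
    have hi2 : ∀ j ∈ Finset.range J, Integrable fun η : ℝ => (η : ℂ) ^ j * q η * pairing _ (hwj j) m :=
      fun j _ => (hqj j).mul_const _
    have hbdd : ∀ {f : ℝ → ℂ}, Integrable f →
        Integrable fun η : ℝ => Real.fourierChar (-(η * -x)) • f η := by
      intro f hf
      have := (Real.fourierIntegral_convergent_iff (f := f) (μ := volume) (-x)).2 hf
      simpa [mul_comm] using this
    simp only [sub_apply, sum_apply,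
      BoundedContinuousFunction.coe_sub, BoundedContinuousFunction.coe_sum, Pi.sub_apply,
      Finset.sum_apply, ContinuousLinearMap.smulRight_apply, BoundedContinuousFunction.coe_smul]
    rw [Real.fourierInv_eq_fourier_neg, Real.fourier_real_eq]
    simp only [smul_sub, Finset.smul_sum]
    rw [integral_sub (hbdd hi1) (integrable_finsetSum _ fun j hj => hbdd (hi2 j hj)),
      integral_finsetSum _ fun j hj => hbdd (hi2 j hj)]
    congr 1
    · rw [pOp_apply, mulOp, Real.fourierInv_eq_fourier_neg, Real.fourier_real_eq]
    · refine Finset.sum_congr rfl fun j _ => ?_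
      change pairing _ (hwj j) m * 𝓕⁻ (fun η : ℝ => (η : ℂ) ^ j * q η) x = _
      rw [← fourierInv_fun_const_mul, Real.fourierInv_eq_fourier_neg, Real.fourier_real_eq]
      simp only [mul_comm]
  rw [hval]
  refine (norm_fourierInv_le _ x).trans ?_
  have hb : ∀ η, ‖q η * 𝓕 (fun y => w y * m y) η
      - ∑ j ∈ Finset.range J, (η : ℂ) ^ j * q η * pairing _ (hwj j) m‖ ≤
      ‖q η‖ * (δ * ((∫ y, ‖w y‖) * ‖m‖)) := by
    intro η
    rw [hd, norm_mul]
    rcases eq_or_ne (q η) 0 with h0 | h0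
    · simp [h0]
    refine mul_le_mul_of_nonneg_left ?_ (norm_nonneg _)
    refine le_trans ?_ (mul_le_mul_of_nonneg_left (integral_norm_mul_bcf_le hw m) hδ0)
    rw [← integral_const_mul]
    refine norm_integral_le_of_norm_le (hwm.norm.const_mul δ) (Eventually.of_forall fun y => ?_)
    rw [norm_mul]
    rcases eq_or_ne (w y) 0 with hy | hy
    · simp [hy]
    · exact mul_le_mul_of_nonneg_right (hexp η y h0 hy) (norm_nonneg _)
  calc _ ≤ ∫ η, ‖q η‖ * (δ * ((∫ y, ‖w y‖) * ‖m‖)) :=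
        integral_mono_of_nonneg (Eventually.of_forall fun _ => norm_nonneg _)
          (hqi.norm.mul_const _) (Eventually.of_forall hb)
    _ = M * δ * ‖m‖ := by rw [integral_mul_const, hM]; ring
    _ ≤ ε * ‖m‖ := by
      gcongr
      rw [lt_div_iff₀ (by positivity)] at hJ1
      nlinarith

theorem pOp_sub_right {q w w' : ℝ → ℂ} (hq : MemLp q 2) (hw : Integrable w) (hw2 : MemLp w 2)
    (hw' : Integrable w') (hw2' : MemLp w' 2) :
    pOp q hq w hw hw2 - pOp q hq w' hw' hw2' = pOp q hq (w - w') (hw.sub hw') (hw2.sub hw2') := by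
  ext m x
  have h := mulOp_add_right hq (integrable_mul_bcf (hw.sub hw') m)
    (memLp_mul_bcf (hw2.sub hw2') m) (integrable_mul_bcf hw' m) (memLp_mul_bcf hw2' m) x
  change mulOp q (fun y => w y * m y) x - mulOp q (fun y => w' y * m y) x = _
  rw [pOp_apply, sub_eq_iff_eq_add, ← h]
  congr 1; ext y
  simp only [Pi.sub_apply]; ring

/-- The operator depends bilinearly on symbol and weight, with norm at most the product of their
`L²` norms. Compactly supported continuous functions are dense in `L²`, and compact operators are
closed in norm. -/
theorem isCompactOperator_pOp {q w : ℝ → ℂ} (hq : MemLp q 2) (hw : Integrable w)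
    (hw2 : MemLp w 2) : IsCompactOperator (pOp q hq w hw hw2) := by
  have approx : ∀ {f : ℝ → ℂ}, MemLp f 2 → ∀ ε : ℝ, 0 < ε →
      ∃ g : ℝ → ℂ, Continuous g ∧ HasCompactSupport g ∧ MemLp g 2 ∧ l2 (f - g) ≤ ε := by
    intro f hf ε hε
    obtain ⟨g, hgs, hfg, hgc, hg⟩ := hf.exists_hasCompactSupport_eLpNorm_sub_le (by norm_num)
      (ε := ENNReal.ofReal ε) (by simpa using hε)
    exact ⟨g, hgc, hgs, hg, ENNReal.toReal_le_of_le_ofReal hε.le hfg⟩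
  refine isCompactOperator_of_forall_exists _ fun ε hε => ?_
  obtain ⟨q', hqc, hqs, hq', hqq⟩ := approx hq (ε / 2 / (l2 w + 1))
    (by have := l2_nonneg w; positivity)
  -- The weight is approximated after the symbol, since its tolerance depends on the norm of the
  -- approximate symbol `q'`.
  obtain ⟨w', hwc, hws, hw2', hww⟩ := approx hw2 (ε / 2 / (l2 q' + 1))
    (by have := l2_nonneg q'; positivity)
  have hw' : Integrable w' := hwc.integrable_of_hasCompactSupport hws
  refine ⟨pOp q' hq' w' hw' hw2', isCompactOperator_pOp_of_hasCompactSupport hqc hqs hwc hws _ _ _, ?_⟩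
  have e : pOp q hq w hw hw2 - pOp q' hq' w' hw' hw2' =
      pOp (q - q') (hq.sub hq') w hw hw2 + pOp q' hq' (w - w') (hw.sub hw') (hw2.sub hw2') := by
    rw [← pOp_sub hq hq' hw hw2, ← pOp_sub_right hq' hw hw2 hw' hw2', sub_add_sub_cancel]
  rw [e]
  refine (norm_add_le _ _).trans ?_
  have hA := l2_nonneg w
  have hB := l2_nonneg q'
  have h1 : l2 (q - q') * l2 w ≤ ε / 2 := by
    calc _ ≤ ε / 2 / (l2 w + 1) * (l2 w + 1) := by gcongr; linarith
      _ = _ := by field_simp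
  have h2 : l2 q' * l2 (w - w') ≤ ε / 2 := by
    calc _ ≤ (l2 q' + 1) * (ε / 2 / (l2 q' + 1)) := by
          have := l2_nonneg (w - w')
          gcongr; linarith
      _ = _ := by field_simp
  have h3 := norm_pOp_le (hq.sub hq') hw hw2
  have h4 := norm_pOp_le hq' (hw.sub hw') (hw2.sub hw2')
  linarith

/-- The Fredholm alternative at the nonzero point `-1`: it is either an eigenvalue of `K` or in the
resolvent set. -/
theorem isUnit_one_add_of_isCompactOperator {K : (ℝ →ᵇ ℂ) →L[ℂ] (ℝ →ᵇ ℂ)}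
    (hK : IsCompactOperator K) (h : ∀ m, m + K m = 0 → m = 0) : IsUnit (1 + K) := by
  rcases IsCompactOperator.hasEigenvalue_or_mem_resolventSet (𝕜 := ℂ) (μ := -1) hK
    (by norm_num) with h1 | h1
  · obtain ⟨m, hm⟩ := h1.exists_hasEigenvector
    refine absurd (h m ?_) hm.2
    have : K m = (-1 : ℂ) • m := hm.apply_eq_smul
    rw [this]; simp
  · rw [spectrum.mem_resolventSet_iff] at h1
    have e : 1 + K = -(algebraMap ℂ ((ℝ →ᵇ ℂ) →L[ℂ] (ℝ →ᵇ ℂ)) (-1) - K) := by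
      rw [map_neg, map_one]; abel
    rw [e]
    exact h1.neg

/-! ### The gauged kernel -/

/-- The symbol of the convolution with `e^{-iλx} G̃_λ(x)`. -/
noncomputable def gaugeSymbol (l η : ℝ) : ℂ := symbolNeg l (η + l / (2 * Real.pi))

theorem gaugeSymbol_of_lt {l η : ℝ} (h : η < -(l / (2 * Real.pi))) :
    gaugeSymbol l η = (((2 * Real.pi * η)⁻¹ : ℝ) : ℂ) := by
  have : η + l / (2 * Real.pi) ∈ Set.Iio (0:ℝ) := by simp only [Set.mem_Iio]; linarith
  have hpi := Real.pi_ne_zero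
  rw [gaugeSymbol, symbolNeg, Set.indicator_of_mem this, ← Complex.ofReal_sub, ← Complex.ofReal_inv]
  congr 2
  field_simp
  ring

theorem gaugeSymbol_of_not_lt {l η : ℝ} (h : ¬ η < -(l / (2 * Real.pi))) :
    gaugeSymbol l η = 0 := by
  have : η + l / (2 * Real.pi) ∉ Set.Iio (0:ℝ) := by
    simp only [Set.mem_Iio]; intro h'; apply h; linarith
  rw [gaugeSymbol, symbolNeg, Set.indicator_of_notMem this]

theorem ofReal_ne_of_nonpos {l : ℝ} (hl : 0 < l) : ∀ r : ℝ, r ≤ 0 → (l : ℂ) ≠ (r : ℂ) := by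
  intro r hr h
  have : l = r := by exact_mod_cast h
  linarith

theorem memLp_gaugeSymbol {l : ℝ} (hl : 0 < l) : MemLp (gaugeSymbol l) 2 :=
  (memLp_symbolNeg (ofReal_ne_of_nonpos hl)).comp_measurePreserving
    (measurePreserving_add_right volume (l / (2 * Real.pi)))

/-- The gauged symbol is real valued, so its quadratic form is real; hence this part of the operator
drops out when imaginary parts are taken. -/
theorem conj_mul_gaugeSymbol_mul (l η : ℝ) (z : ℂ) : (conj z * (gaugeSymbol l η * z)).im = 0 := by
  have e : conj z * (gaugeSymbol l η * z) = (Complex.normSq z : ℂ) * gaugeSymbol l η := by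
    rw [Complex.normSq_eq_conj_mul_self]; ring
  rw [e]
  by_cases h : η < -(l / (2 * Real.pi))
  · rw [gaugeSymbol_of_lt h, ← Complex.ofReal_mul, Complex.ofReal_im]
  · rw [gaugeSymbol_of_not_lt h, mul_zero, Complex.zero_im]

/-- The kernel `e^{-iλx} G̃_λ(x)`. -/
noncomputable def gaugeKernel (l x : ℝ) : ℂ := planeWave (-l) x * kernelGTilde l x

theorem integrable_planeWave_mul {f : ℝ → ℂ} (hf : Integrable f) (l : ℝ) :
    Integrable fun x => planeWave l x * f x :=
  hf.bdd_mul (c := 1) (continuous_planeWave l).aestronglyMeasurable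
    (Eventually.of_forall fun x => (norm_planeWave l x).le)

theorem memLp_planeWave_mul {f : ℝ → ℂ} (hf : MemLp f 2) (l : ℝ) :
    MemLp (fun x => planeWave l x * f x) 2 :=
  hf.of_le ((continuous_planeWave l).aestronglyMeasurable.mul hf.1)
    (Eventually.of_forall fun x => by rw [norm_mul, norm_planeWave, one_mul])

theorem conv_kernelGTilde_planeWave_mul {l : ℝ} (hl : 0 < l) {f : ℝ → ℂ} (hf : Integrable f)
    (hf2 : MemLp f 2) (x : ℝ) :
    conv (kernelGTilde l) (fun y => planeWave l y * f y) x =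
      planeWave l x * mulOp (gaugeSymbol l) f x := by
  rw [conv_kernelGTilde (ofReal_ne_of_nonpos hl) (integrable_planeWave_mul hf l)
    (memLp_planeWave_mul hf2 l), mulOp_planeWave_mul]
  rfl

theorem conv_gaugeKernel {l : ℝ} (hl : 0 < l) {f : ℝ → ℂ} (hf : Integrable f)
    (hf2 : MemLp f 2) (x : ℝ) :
    conv (gaugeKernel l) f x = mulOp (gaugeSymbol l) f x := by
  have h := conv_kernelGTilde_planeWave_mul hl hf hf2 x
  have e : conv (gaugeKernel l) f x =
      planeWave (-l) x * conv (kernelGTilde l) (fun y => planeWave l y * f y) x := by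
    rw [conv, conv, ← integral_const_mul]
    congr 1; ext y
    rw [gaugeKernel, planeWave_sub_right, neg_neg]; ring
  rw [e, h, ← mul_assoc, planeWave_neg_mul, one_mul]

/-- Combines the decay `1/|x|` at infinity with the singularity bound `|x|^{-1/4}` at the origin.
The kernel can absorb exactly one power of `1 + |x|`, which is why the bootstrap below stops at
decay of order one. -/
theorem exists_gaugeKernel_bound {l : ℝ} (hl : 0 < l) :
    ∃ C : ℝ, 0 < C ∧ ∀ x : ℝ, x ≠ 0 → (1 + |x|) * ‖gaugeKernel l x‖ ≤ C * (1 + ‖singPart x‖) := by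
  have hk : ∀ r : ℝ, 0 ≤ r → -(l : ℂ) ≠ (r : ℂ) := by
    intro r hr h
    have : -l = r := by exact_mod_cast h
    linarith
  obtain ⟨C, hC0, hC⟩ := exists_norm_kernelG_le hk
  refine ⟨2 * C, by positivity, fun x hx => ?_⟩
  have h := hC (-x) (neg_ne_zero.2 hx)
  rw [gaugeKernel, norm_mul, norm_planeWave, one_mul,
    kernelGTilde_eq (ofReal_ne_of_nonpos hl) hx, norm_neg]
  rw [abs_neg] at h
  have hx' : 0 < |x| := abs_pos.2 hx
  have h1 : |x| * ‖kernelG (-l) (-x)‖ ≤ C := by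
    calc _ ≤ |x| * (C * |x|⁻¹) := by gcongr; exact h.1
      _ = C := by field_simp
  have h2 : ‖kernelG (-l) (-x)‖ ≤ C * (1 + ‖singPart x‖) :=
    h.2.trans (by gcongr; exact rpow_abs_le x)
  have h3 : 0 ≤ C * ‖singPart x‖ := by positivity
  nlinarith

/-! ### Uniqueness for the homogeneous equation -/

section Homogeneous

variable {u : ℝ → ℝ} {l a : ℝ} {n : ℝ →ᵇ ℂ}

/-- Pair the equation with the conjugate of `g = u n`. The left side `∫ u |n|²` is real and the
multiplier has a real form, so the real part of `∫ conj g · F`, with `F` the primitive of `g`, must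
vanish; that real part is half of `|∫ g|²`. -/
theorem integral_eq_zero_of_homogeneous (hl : 0 < l) (hu : Integrable u)
    (hu2 : MemLp (fun x => (u x : ℂ)) 2)
    (hn : ∀ x, n x = Complex.I * (∫ y in Set.Iic x, (u y : ℂ) * n y)
      - mulOp (gaugeSymbol l) (fun y => (u y : ℂ) * n y) x) :
    ∫ y, (u y : ℂ) * n y = 0 := by
  set g : ℝ → ℂ := fun y => (u y : ℂ) * n y with hg
  have hgi : Integrable g := integrable_mul_bcf (integrable_coe hu) n
  have hg2 : MemLp g 2 := memLp_mul_bcf hu2 n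
  have hq := memLp_gaugeSymbol hl
  have hcg : Integrable fun x => conj (g x) := (Complex.conjLIE.integrable_comp_iff).2 hgi
  set F : ℝ → ℂ := fun x => ∫ y in Set.Iic x, g y with hF
  have hFc : Continuous F := by
    simpa only [volterra_zero] using continuous_volterra (k := 0) (by simp) hgi
  have hFb : ∀ x, ‖F x‖ ≤ ∫ y, ‖g y‖ := fun x => by
    simpa only [volterra_zero] using norm_volterra_le (k := 0) (by simp) hgi x
  have hi1 : Integrable fun x => conj (g x) * F x :=
    hcg.mul_bdd hFc.aestronglyMeasurable (Eventually.of_forall hFb)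
  have hi2 : Integrable fun x => conj (g x) * mulOp (gaugeSymbol l) g x :=
    hcg.mul_bdd (continuous_mulOp hq hgi hg2).aestronglyMeasurable
      (Eventually.of_forall (norm_mulOp_le hq hgi hg2))
  have h1 : ∫ x, conj (g x) * n x = Complex.I * (∫ x, conj (g x) * F x)
      - ∫ x, conj (g x) * mulOp (gaugeSymbol l) g x := by
    rw [← integral_const_mul, ← integral_sub (hi1.const_mul _) hi2]
    congr 1; ext x
    rw [hn x]; ring
  have h2 : (∫ x, conj (g x) * n x).im = 0 := by
    have : ∀ x, conj (g x) * n x = ((u x * Complex.normSq (n x) : ℝ) : ℂ) := by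
      intro x
      simp only [hg, map_mul, Complex.conj_ofReal]
      push_cast
      rw [Complex.normSq_eq_conj_mul_self]; ring
    simp only [this]
    rw [integral_complex_ofReal, Complex.ofReal_im]
  have h3 : (∫ x, conj (g x) * mulOp (gaugeSymbol l) g x).im = 0 := by
    rw [integral_conj_mul_mulOp hq hgi hg2 hgi]
    have hi : Integrable fun η => conj (𝓕 g η) * (gaugeSymbol l η * 𝓕 g η) :=
      ((integrable_mul_fourier hq hgi hg2).bdd_mul (c := ∫ y, ‖g y‖)
        (Complex.continuous_conj.comp (continuous_fourier hgi)).aestronglyMeasurable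
        (Eventually.of_forall fun η => by
          simp only [RCLike.norm_conj]
          exact norm_fourier_le g η))
    have := Complex.imCLM.integral_comp_comm hi
    simp only [Complex.imCLM_apply] at this
    rw [← this]
    simp only [conj_mul_gaugeSymbol_mul, integral_zero]
  -- The two terms on the left of this identity are complex conjugates, so it says that twice the
  -- real part of `∫ conj g · F` equals `|∫ g|²`.
  have h4 := integral_mul_primitive_add hcg hgi
  have h5 : ∫ x, g x * ∫ y in Set.Iic x, conj (g y) = conj (∫ x, conj (g x) * F x) := by
    rw [← integral_conj]
    congr 1; ext x
    rw [integral_conj, map_mul, Complex.conj_conj]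
  rw [h5, integral_conj, ← Complex.normSq_eq_conj_mul_self] at h4
  have h6 : (∫ x, conj (g x) * F x).re = 0 := by
    have := congrArg Complex.im h1
    rw [h2, Complex.sub_im, h3] at this
    simpa using this.symm
  have h7 : Complex.normSq (∫ x, g x) = 0 := by
    have := congrArg Complex.re h4
    rw [Complex.add_re, Complex.conj_re, Complex.ofReal_re] at this
    have h8 : (∫ x, conj (g x) * ∫ y in Set.Iic x, g y).re = 0 := h6
    linarith
  exact Complex.normSq_eq_zero.1 h7

/-- Because the total integral is zero, the primitive at `x` is, up to sign, an integral over a half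
line on which `|y| ≥ |x|`. There the surplus weight of `u` can be exchanged for decay in `x`. -/
theorem norm_primitive_le (hw1 : Integrable fun x => (1 + |x|) ^ a * u x)
    (hz : ∫ y, (u y : ℂ) * n y = 0) (hu : Integrable u)
    {a' τ C : ℝ} (ha' : 0 < a') (haa : a' ≤ a) (hτ : 0 ≤ τ) (hC : 0 ≤ C)
    (hb : ∀ x, ‖n x‖ ≤ C * (1 + |x|) ^ (-τ)) (x : ℝ) :
    ‖∫ y in Set.Iic x, (u y : ℂ) * n y‖ ≤
      C * (∫ y, ‖(1 + |y|) ^ a * u y‖) * (1 + |x|) ^ (-(τ + a')) := by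
  have hgi := integrable_mul_bcf (integrable_coe hu) n
  have key : ∀ y, |x| ≤ |y| → ‖(u y : ℂ) * n y‖ ≤
      C * (1 + |x|) ^ (-(τ + a')) * ‖(1 + |y|) ^ a * u y‖ := by
    intro y hy
    have hy1 : 1 ≤ 1 + |y| := by linarith [abs_nonneg y]
    have hx1 : 0 < 1 + |x| := by linarith [abs_nonneg x]
    rw [norm_mul, norm_mul, Complex.norm_real,
      Real.norm_of_nonneg (show 0 ≤ (1 + |y|) ^ a by positivity)]
    calc ‖u y‖ * ‖n y‖ ≤ ‖u y‖ * (C * (1 + |y|) ^ (-τ)) := by gcongr; exact hb y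
      _ = ‖u y‖ * (C * ((1 + |y|) ^ (-(τ + a')) * (1 + |y|) ^ a')) := by
          rw [← Real.rpow_add (by linarith)]; congr 3; ring
      _ ≤ ‖u y‖ * (C * ((1 + |x|) ^ (-(τ + a')) * (1 + |y|) ^ a)) := by
          gcongr ‖u y‖ * (C * (?_ * ?_))
          · exact Real.rpow_le_rpow_of_nonpos hx1 (by linarith) (by linarith)
          · exact Real.rpow_le_rpow_of_exponent_le hy1 haa
      _ = _ := by ring
  have fin : ∀ s : Set ℝ, MeasurableSet s → (∀ y ∈ s, |x| ≤ |y|) →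
      ‖∫ y in s, (u y : ℂ) * n y‖ ≤
      C * (∫ y, ‖(1 + |y|) ^ a * u y‖) * (1 + |x|) ^ (-(τ + a')) := by
    intro s hs hsy
    calc _ ≤ ∫ y in s, C * (1 + |x|) ^ (-(τ + a')) * ‖(1 + |y|) ^ a * u y‖ := by
          refine norm_integral_le_of_norm_le (hw1.norm.const_mul _).integrableOn ?_
          filter_upwards [ae_restrict_mem hs] with y hy using key y (hsy y hy)
      _ ≤ ∫ y, C * (1 + |x|) ^ (-(τ + a')) * ‖(1 + |y|) ^ a * u y‖ :=
          setIntegral_le_integral (hw1.norm.const_mul _)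
            (Eventually.of_forall fun y => by positivity)
      _ = _ := by rw [integral_const_mul]; ring
  rcases le_total x 0 with h | h
  · refine fin _ measurableSet_Iic fun y hy => ?_
    rw [abs_of_nonpos h, abs_of_nonpos (le_trans hy h)]
    exact neg_le_neg hy
  · have := intervalIntegral.integral_Iic_add_Ioi (b := x) hgi.integrableOn hgi.integrableOn
    rw [hz] at this
    rw [eq_neg_of_add_eq_zero_left this, norm_neg]
    refine fin _ measurableSet_Ioi fun y hy => ?_
    rw [abs_of_nonneg h, abs_of_nonneg (h.trans (le_of_lt hy))]
    exact le_of_lt hy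

/-- The primitive gains `a'` by the cancellation `∫ u n = 0`. In the convolution the weight is moved
onto `u n` through `(1+|x|)^{τ+a'} ≤ (1+|x-y|) (1+|y|)^{τ+a'}`, which requires `τ + a' ≤ 1`; the
factor `1+|x-y|` is paid by the kernel. -/
theorem exists_decay_step (hl : 0 < l)
    (hw1 : Integrable fun x => (1 + |x|) ^ a * u x)
    (hw2 : MemLp (fun x => (((1 + |x|) ^ a * u x : ℝ) : ℂ)) 2)
    (hu : Integrable u) (hu2 : MemLp (fun x => (u x : ℂ)) 2)
    (hn : ∀ x, n x = Complex.I * (∫ y in Set.Iic x, (u y : ℂ) * n y)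
      - mulOp (gaugeSymbol l) (fun y => (u y : ℂ) * n y) x)
    {a' τ : ℝ} (ha' : 0 < a') (haa : a' ≤ a) (hτ : 0 ≤ τ) (hτ1 : τ + a' ≤ 1)
    (hb : ∃ C : ℝ, 0 ≤ C ∧ ∀ x, ‖n x‖ ≤ C * (1 + |x|) ^ (-τ)) :
    ∃ C : ℝ, 0 ≤ C ∧ ∀ x, ‖n x‖ ≤ C * (1 + |x|) ^ (-(τ + a')) := by
  obtain ⟨C, hC, hb⟩ := hb
  have hz := integral_eq_zero_of_homogeneous hl hu hu2 hn
  have hF := norm_primitive_le hw1 hz hu ha' haa hτ hC hb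
  have hgi := integrable_mul_bcf (integrable_coe hu) n
  have hg2 := memLp_mul_bcf hu2 n
  obtain ⟨B, hB0, hB⟩ := exists_gaugeKernel_bound hl
  set G : ℝ → ℂ := fun y => (((1 + |y|) ^ (τ + a') : ℝ) : ℂ) * ((u y : ℂ) * n y) with hG
  have hGb : ∀ y, ‖G y‖ ≤ C * ‖(((1 + |y|) ^ a * u y : ℝ) : ℂ)‖ := by
    intro y
    have hy1 : 1 ≤ 1 + |y| := by linarith [abs_nonneg y]
    rw [hG]
    simp only [norm_mul, Complex.norm_real]
    rw [Real.norm_of_nonneg (show 0 ≤ (1 + |y|) ^ (τ + a') by positivity),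
      Real.norm_of_nonneg (show 0 ≤ (1 + |y|) ^ a by positivity)]
    calc (1 + |y|) ^ (τ + a') * (‖u y‖ * ‖n y‖)
        ≤ (1 + |y|) ^ (τ + a') * (‖u y‖ * (C * (1 + |y|) ^ (-τ))) := by gcongr; exact hb y
      _ = C * (((1 + |y|) ^ (τ + a') * (1 + |y|) ^ (-τ)) * ‖u y‖) := by ring
      _ = C * ((1 + |y|) ^ a' * ‖u y‖) := by
          rw [← Real.rpow_add (by linarith)]; congr 3; ring
      _ ≤ C * ((1 + |y|) ^ a * ‖u y‖) := by
          gcongr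
  have hGm : AEStronglyMeasurable G :=
    AEStronglyMeasurable.mul (Measurable.aestronglyMeasurable (by fun_prop)) hgi.1
  have hGi : Integrable G :=
    Integrable.mono' (g := fun y => C * ‖(((1 + |y|) ^ a * u y : ℝ) : ℂ)‖)
      (by simpa only [Complex.norm_real] using hw1.norm.const_mul C) hGm (Eventually.of_forall hGb)
  have hG2 : MemLp G 2 := hw2.of_le_mul hGm (Eventually.of_forall hGb)
  set K := (∫ y, ‖G y‖) + l2 singPart * l2 G with hK
  have hK0 : 0 ≤ K := add_nonneg (integral_nonneg fun _ => norm_nonneg _)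
    (mul_nonneg (l2_nonneg _) (l2_nonneg _))
  have hconv : ∀ x, (1 + |x|) ^ (τ + a') *
      ‖mulOp (gaugeSymbol l) (fun y => (u y : ℂ) * n y) x‖ ≤ B * K := by
    intro x
    rw [← conv_gaugeKernel hl hgi hg2, conv]
    have h1 : ∀ y, y ≠ x → (1 + |x|) ^ (τ + a') * ‖gaugeKernel l (x - y) * ((u y : ℂ) * n y)‖ ≤
        B * ((1 + ‖singPart (x - y)‖) * ‖G y‖) := by
      intro y hy
      have e1 : (1 + |x|) ^ (τ + a') ≤ (1 + |x - y|) * (1 + |y|) ^ (τ + a') := by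
        calc (1 + |x|) ^ (τ + a') ≤ ((1 + |x - y|) * (1 + |y|)) ^ (τ + a') := by
              have h := abs_add_le (x - y) y
              rw [sub_add_cancel] at h
              gcongr
              nlinarith [abs_nonneg (x - y), abs_nonneg y]
          _ = (1 + |x - y|) ^ (τ + a') * (1 + |y|) ^ (τ + a') :=
              Real.mul_rpow (by positivity) (by positivity)
          _ ≤ (1 + |x - y|) ^ (1:ℝ) * (1 + |y|) ^ (τ + a') := by
              gcongr
              linarith [abs_nonneg (x - y)]
          _ = _ := by rw [Real.rpow_one]
      have e2 : ‖G y‖ = (1 + |y|) ^ (τ + a') * ‖(u y : ℂ) * n y‖ := by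
        rw [hG]
        simp only [norm_mul, Complex.norm_real]
        rw [Real.norm_of_nonneg (show 0 ≤ (1 + |y|) ^ (τ + a') by positivity)]
      rw [norm_mul (gaugeKernel _ _), e2]
      calc _ ≤ ((1 + |x - y|) * (1 + |y|) ^ (τ + a')) *
            (‖gaugeKernel l (x - y)‖ * ‖(u y : ℂ) * n y‖) := by gcongr
        _ = ((1 + |x - y|) * ‖gaugeKernel l (x - y)‖) *
            ((1 + |y|) ^ (τ + a') * ‖(u y : ℂ) * n y‖) := by ring
        _ ≤ (B * (1 + ‖singPart (x - y)‖)) *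
            ((1 + |y|) ^ (τ + a') * ‖(u y : ℂ) * n y‖) := by
            exact mul_le_mul_of_nonneg_right (hB _ (sub_ne_zero.2 hy.symm)) (by positivity)
        _ = _ := by ring
    calc _ ≤ (1 + |x|) ^ (τ + a') * ∫ y, ‖gaugeKernel l (x - y) * ((u y : ℂ) * n y)‖ := by
          gcongr; exact norm_integral_le_integral_norm _
      _ = ∫ y, (1 + |x|) ^ (τ + a') * ‖gaugeKernel l (x - y) * ((u y : ℂ) * n y)‖ := by
          rw [integral_const_mul]
      _ ≤ ∫ y, B * ((1 + ‖singPart (x - y)‖) * ‖G y‖) := by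
          have hyx : ∀ᵐ y : ℝ, y ≠ x := by simp [ae_iff]
          refine integral_mono_of_nonneg (Eventually.of_forall fun y => by positivity)
            ((integrable_one_add_singPart_mul hGi hG2 x).const_mul B) ?_
          filter_upwards [hyx] with y hy using h1 y hy
      _ ≤ B * K := by
          rw [integral_const_mul]
          gcongr
          exact integral_one_add_singPart_mul_le hGi hG2 x
  set W := ∫ y, ‖(1 + |y|) ^ a * u y‖ with hW
  have hW0 : 0 ≤ W := integral_nonneg fun _ => norm_nonneg _
  refine ⟨C * W + B * K, by positivity, fun x => ?_⟩
  have hx1 : 0 < 1 + |x| := by positivity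
  rw [hn x]
  refine (norm_sub_le _ _).trans ?_
  rw [norm_mul, Complex.norm_I, one_mul, add_mul]
  refine add_le_add (hF x) ?_
  rw [Real.rpow_neg hx1.le, ← div_eq_mul_inv, le_div_iff₀ (by positivity), mul_comm]
  exact hconv x

theorem exists_decay (hl : 0 < l) (ha : 0 < a)
    (hw1 : Integrable fun x => (1 + |x|) ^ a * u x)
    (hw2 : MemLp (fun x => (((1 + |x|) ^ a * u x : ℝ) : ℂ)) 2)
    (hu : Integrable u) (hu2 : MemLp (fun x => (u x : ℂ)) 2)
    (hn : ∀ x, n x = Complex.I * (∫ y in Set.Iic x, (u y : ℂ) * n y)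
      - mulOp (gaugeSymbol l) (fun y => (u y : ℂ) * n y) x) :
    ∃ C : ℝ, 0 ≤ C ∧ ∀ x, ‖n x‖ ≤ C * (1 + |x|) ^ (-1 : ℝ) := by
  -- Steps of size `1/(N+1) < a` reach the exponent `1` exactly after `N + 1` iterations, without
  -- violating `τ + a' ≤ 1` on the way.
  obtain ⟨N, hN⟩ := exists_nat_one_div_lt ha
  have hN0 : (0:ℝ) < (N : ℝ) + 1 := by positivity
  have key : ∀ j : ℕ, j ≤ N + 1 →
      ∃ C : ℝ, 0 ≤ C ∧ ∀ x, ‖n x‖ ≤ C * (1 + |x|) ^ (-((j : ℝ) / (N + 1))) := by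
    intro j
    induction j with
    | zero =>
      intro _
      refine ⟨‖n‖, norm_nonneg _, fun x => ?_⟩
      simpa using n.norm_coe_le_norm x
    | succ j ih =>
      intro hj
      have hj' : ((j : ℝ) + 1) ≤ N + 1 := by exact_mod_cast hj
      have := exists_decay_step hl hw1 hw2 hu hu2 hn (a' := 1 / ((N : ℝ) + 1))
        (τ := (j : ℝ) / (N + 1)) (by positivity) hN.le (by positivity)
        (by rw [← add_div, div_le_one hN0]; exact hj') (ih (by omega))
      rw [← add_div] at this
      push_cast
      exact this
  have := key (N + 1) le_rfl
  push_cast at this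
  rwa [div_self hN0.ne'] at this

end Homogeneous

/-! ### Fourier transform of a primitive -/

/-- If `F` is the primitive of `g`, then formally `F' + F = g + F`, and `volterra I` inverts `d/dx +
1`. The integrated form needs no differentiability of `F`. -/
theorem volterra_I_add {g : ℝ → ℂ} (hg : Integrable g) (x : ℝ) :
    volterra Complex.I g x + volterra Complex.I (fun y => ∫ t in Set.Iic y, g t) x =
      ∫ t in Set.Iic x, g t := by
  -- The exponential weight `e^{-(x-y)}` on `y ≤ x` has total mass one; the identity is the diagonal
  -- splitting of `f(y) g(t)`.
  set f : ℝ → ℂ := (Set.Iic x).indicator fun y : ℝ => Complex.exp (Complex.I * Complex.I * (x - y))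
    with hf
  have he : ∀ t : ℝ, (∀ y : ℝ, Complex.exp (Complex.I * Complex.I * (x - y)) =
      Complex.exp (-x) * Complex.exp (1 * (y : ℂ))) := by
    intro t y
    rw [← Complex.exp_add, Complex.I_mul_I]; ring_nf
  have hfi : Integrable f := by
    rw [hf, integrable_indicator_iff measurableSet_Iic]
    simp only [he 0]
    exact (integrableOn_exp_mul_complex_Iic (a := 1) (by simp) x).const_mul _
  have hint : ∀ t : ℝ, ∫ y in Set.Iic t, Complex.exp (Complex.I * Complex.I * (x - y)) =
      Complex.exp (Complex.I * Complex.I * (x - t)) := by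
    intro t
    simp only [he 0]
    rw [integral_const_mul, integral_exp_mul_complex_Iic (by simp), div_one]
  have h1 : ∫ y, f y = 1 := by
    rw [hf, integral_indicator measurableSet_Iic, hint]; simp
  have h2 : ∀ t, ∫ y in Set.Iic t, f y =
      1 - (Set.Iic x).indicator (fun t : ℝ => 1 - Complex.exp (Complex.I * Complex.I * (x - t))) t := by
    intro t
    rw [hf, setIntegral_indicator measurableSet_Iic, Set.Iic_inter_Iic, hint]
    rcases le_total t x with h | h
    · rw [min_eq_left h, Set.indicator_of_mem (show t ∈ Set.Iic x from h)]; ring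
    · rw [min_eq_right h]
      rcases h.eq_or_lt with rfl | h
      · rw [Set.indicator_of_mem (show x ∈ Set.Iic x from le_refl x)]; ring
      · rw [Set.indicator_of_notMem (show t ∉ Set.Iic x from not_le.2 h)]; simp
  have h3 := integral_mul_primitive_add hfi hg
  have h4 : ∫ y, f y * ∫ t in Set.Iic y, g t =
      volterra Complex.I (fun y => ∫ t in Set.Iic y, g t) x := by
    rw [volterra, ← integral_indicator measurableSet_Iic]
    congr 1; ext y
    rw [hf, Set.indicator_mul_left]
  have hv := integrableOn_volterra (k := Complex.I) (by simp) hg x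
  have h5 : ∫ t, g t * ∫ y in Set.Iic t, f y =
      (∫ t, g t) - ((∫ t in Set.Iic x, g t) - volterra Complex.I g x) := by
    rw [volterra, ← integral_sub hg.integrableOn hv, ← integral_indicator measurableSet_Iic,
      ← integral_sub hg ((show IntegrableOn (fun t : ℝ => g t - Complex.exp (Complex.I * Complex.I * (x - t)) * g t)
        (Set.Iic x) from hg.integrableOn.sub hv).integrable_indicator measurableSet_Iic)]
    congr 1; ext t
    rw [h2, mul_sub, mul_one]
    congr 1
    by_cases h : t ∈ Set.Iic x
    · rw [Set.indicator_of_mem h, Set.indicator_of_mem h]; ring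
    · rw [Set.indicator_of_notMem h, Set.indicator_of_notMem h, mul_zero]
  rw [h4, h5, h1] at h3
  linear_combination h3

/-- The rule for the transform of a derivative, for a merely integrable `g`. Transforming the
preceding identity, with `volterra I` acting by `-i/(2πη - i)`, and clearing the denominator gives
it. -/
theorem fourier_eq_mul_fourier_primitive {g : ℝ → ℂ} (hg : Integrable g)
    (hF : Integrable fun x => ∫ t in Set.Iic x, g t) (η : ℝ) :
    𝓕 g η = 2 * Real.pi * η * (Complex.I * 𝓕 (fun x => ∫ t in Set.Iic x, g t) η) := by
  obtain ⟨hv1, h1⟩ := integrable_volterra_and_fourier (k := Complex.I) (by simp) hg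
  obtain ⟨hv2, h2⟩ := integrable_volterra_and_fourier (k := Complex.I) (by simp) hF
  have h3 := fourier_fun_add hv1 hv2 η
  simp only [volterra_I_add hg] at h3
  have hne : ((2 * Real.pi * η : ℝ) : ℂ) - Complex.I ≠ 0 := by
    intro h
    have := congrArg Complex.im h
    simp at this
  have h1' := h1 η
  have h2' := h2 η
  rw [eq_inv_mul_iff_mul_eq₀ hne] at h1' h2'
  push_cast at h1' h2'
  linear_combination (-(1:ℂ)) * h1' - h2' - (2 * Real.pi * η - Complex.I) * Complex.I * h3 -
    (𝓕 (fun x => ∫ t in Set.Iic x, g t) η) * Complex.I_sq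

theorem memLp_two_rpow_neg {r : ℝ} (hr : 1 / 2 < r) :
    MemLp (fun x : ℝ => (((1 + |x|) ^ (-r) : ℝ) : ℂ)) 2 := by
  have hm : AEStronglyMeasurable (fun x : ℝ => (((1 + |x|) ^ (-r) : ℝ) : ℂ)) :=
    Measurable.aestronglyMeasurable (by fun_prop)
  rw [memLp_two_iff_integrable_sq_norm hm]
  have := integrable_one_add_norm (E := ℝ) (μ := volume) (r := 2 * r) (by simp; linarith)
  refine this.congr (Eventually.of_forall fun x => ?_)
  have hx : 0 < 1 + |x| := by positivity
  simp only [Complex.norm_real, Real.norm_eq_abs]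
  rw [abs_of_nonneg (show 0 ≤ (1 + |x|) ^ (-r) by positivity), ← Real.rpow_natCast, ← Real.rpow_mul hx.le]
  congr 1; push_cast; ring

/-- Cauchy–Schwarz against the square integrable function `1/(1+|η|)`. -/
theorem integrable_of_memLp_two_mul {f : ℝ → ℂ} (hf : MemLp f 2)
    (hf' : MemLp (fun η : ℝ => (η : ℂ) * f η) 2) : Integrable f := by
  have h1 := memLp_two_rpow_neg (r := 1) (by norm_num)
  have h2 : MemLp (fun η : ℝ => ((1 + |η| : ℝ) : ℂ) * f η) 2 := by
    refine (hf.norm.add hf'.norm).of_le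
      ((Measurable.aestronglyMeasurable (by fun_prop)).mul hf.1)
      (Eventually.of_forall fun η => ?_)
    simp only [Pi.add_apply, norm_mul, Complex.norm_real, Real.norm_eq_abs]
    rw [abs_of_nonneg (by positivity : (0:ℝ) ≤ 1 + |η|),
      abs_of_nonneg (show 0 ≤ ‖f η‖ + |η| * ‖f η‖ by positivity)]
    linarith
  refine (integrable_mul_of_memLp_two h1 h2).congr (Eventually.of_forall fun η => ?_)
  have hx : (0:ℝ) < 1 + |η| := by positivity
  simp only
  rw [Real.rpow_neg_one, ← mul_assoc, ← Complex.ofReal_mul, inv_mul_cancel₀ hx.ne',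
    Complex.ofReal_one, one_mul]

/-! ### A virial identity -/

/-- If `D = 2πηψ` and `D` is differentiable, the quantity `2πη|ψ|²` has derivative
`2 Re (D' ψ̄) - 2π|ψ|²` away from the origin; integrating over `(-c, ∞)` shows that `ψ = 0`
there. -/
theorem ae_eq_zero_of_virial {c : ℝ} (hc : 0 < c) {D D1 ψ : ℝ → ℂ} (hψc : Continuous ψ)
    (hψ2 : MemLp ψ 2) (hψi : Integrable ψ) (hψ0 : Tendsto ψ atTop (𝓝 0)) (hD0 : Tendsto D atTop (𝓝 0))
    (hDψ : ∀ η, D η = 2 * Real.pi * η * ψ η) (hD1 : ∀ η, HasDerivAt D (D1 η) η)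
    (hD1c : Continuous D1) {B : ℝ} (hD1b : ∀ η, ‖D1 η‖ ≤ B)
    (hz : (∫ η in Set.Ioi (-c), conj (D1 η) * ψ η).re = 0) :
    ∀ᵐ η ∂volume.restrict (Set.Ioi (-c)), ψ η = 0 := by
  set Q : ℝ → ℝ := fun η => (conj (D η) * ψ η).re with hQ
  set Q' : ℝ → ℝ := fun η => 2 * (conj (D1 η) * ψ η).re - 2 * Real.pi * ‖ψ η‖ ^ 2 with hQ'
  have hDc : Continuous D := continuous_iff_continuousAt.2 fun η => (hD1 η).continuousAt
  have hQc : Continuous Q := Complex.continuous_re.comp ((Complex.continuous_conj.comp hDc).mul hψc)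
  have hi1 : Integrable fun η => conj (D1 η) * ψ η :=
    hψi.bdd_mul (c := B) (Complex.continuous_conj.comp hD1c).aestronglyMeasurable
      (Eventually.of_forall fun η => by simpa using hD1b η)
  have hi2 : Integrable fun η => ‖ψ η‖ ^ 2 := (memLp_two_iff_integrable_sq_norm hψ2.1).1 hψ2
  have hQ'i : Integrable Q' := (hi1.re.const_mul 2).sub (hi2.const_mul _)
  have hpi := Real.pi_pos
  -- Only `D` is known to be differentiable. Away from the origin `Q = |D|²/(2πη)`; at the origin
  -- `ψ` is merely continuous, so `0` is left out.
  have hder : ∀ η : ℝ, η ≠ 0 → HasDerivAt Q (Q' η) η := by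
    intro η hη
    have hre : HasDerivAt (fun η => (D η).re) (D1 η).re η :=
      Complex.reCLM.hasFDerivAt.comp_hasDerivAt η (hD1 η)
    have him : HasDerivAt (fun η => (D η).im) (D1 η).im η :=
      Complex.imCLM.hasFDerivAt.comp_hasDerivAt η (hD1 η)
    have h := (((hre.mul hre).add (him.mul him)).div ((hasDerivAt_id η).const_mul (2 * Real.pi))
      (by simp [hη, hpi.ne']))
    have hψeq : ∀ t : ℝ, t ≠ 0 → ψ t = D t * (((2 * Real.pi * t)⁻¹ : ℝ) : ℂ) := by
      intro t ht
      rw [hDψ]; push_cast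
      have : (Real.pi : ℂ) ≠ 0 := by exact_mod_cast hpi.ne'
      have : (t : ℂ) ≠ 0 := by exact_mod_cast ht
      field_simp
    have hQe : ∀ᶠ t in 𝓝 η, Q t =
        (((D t).re * (D t).re + (D t).im * (D t).im) / (2 * Real.pi * t)) := by
      filter_upwards [eventually_ne_nhds hη] with t ht
      rw [hQ]
      simp only [hψeq t ht, Complex.mul_re, Complex.mul_im, Complex.conj_re, Complex.conj_im,
        Complex.ofReal_re, Complex.ofReal_im]
      field_simp; ring
    have h2 := h.congr_of_eventuallyEq (f₁ := Q) hQe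
    refine h2.congr_deriv ?_
    change _ = 2 * (conj (D1 η) * ψ η).re - 2 * Real.pi * ‖ψ η‖ ^ 2
    rw [← Complex.normSq_eq_norm_sq, Complex.normSq_apply]
    simp only [hψeq η hη, Complex.mul_re, Complex.mul_im, Complex.conj_re, Complex.conj_im,
      Complex.ofReal_re, Complex.ofReal_im, Pi.add_apply, Pi.mul_apply, id]
    field_simp
    ring
  have hQ0 : Q 0 = 0 := by simp [hQ, hDψ]
  have hQt : Tendsto Q atTop (𝓝 0) := by
    have := (Complex.continuous_re.tendsto _).comp
      (((Complex.continuous_conj.tendsto _).comp hD0).mul hψ0)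
    rw [map_zero, zero_mul, Complex.zero_re] at this
    exact this
  -- The integral is split at the exceptional point `0`, where `Q` is continuous and vanishes, so no
  -- boundary term arises there.
  have e1 : ∫ η in Set.Ioi (0:ℝ), Q' η = 0 := by
    rw [integral_Ioi_of_hasDerivAt_of_tendsto hQc.continuousWithinAt
      (fun x hx => hder x (ne_of_gt hx)) hQ'i.integrableOn hQt, hQ0, sub_zero]
  have e2 : ∫ η in (-c)..0, Q' η = - Q (-c) := by
    rw [intervalIntegral.integral_eq_sub_of_hasDerivAt_of_le (by linarith) hQc.continuousOn
      (fun x hx => hder x (ne_of_lt hx.2)) hQ'i.intervalIntegrable, hQ0, zero_sub]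
  have e3 := intervalIntegral.integral_interval_add_Ioi (a := -c) (b := 0) (f := Q') (μ := volume)
    hQ'i.integrableOn hQ'i.integrableOn
  have e4 : ∫ η in Set.Ioi (-c), Q' η = - (2 * Real.pi * ∫ η in Set.Ioi (-c), ‖ψ η‖ ^ 2) := by
    have := integral_re (hi1.integrableOn (s := Set.Ioi (-c)))
    have h0 : ∫ η in Set.Ioi (-c), (conj (D1 η) * ψ η).re = 0 := this.trans hz
    have h1 : IntegrableOn (fun η => (conj (D1 η) * ψ η).re) (Set.Ioi (-c)) := hi1.re.integrableOn
    change ∫ η in Set.Ioi (-c), (2 * (conj (D1 η) * ψ η).re - 2 * Real.pi * ‖ψ η‖ ^ 2) = _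
    rw [integral_sub (h1.const_mul 2) (hi2.const_mul _).integrableOn,
      integral_const_mul, integral_const_mul, h0]
    ring
  -- The sign that closes the argument: the integral of `Q'` over `(-c, ∞)` equals `-Q(-c) ≥ 0` and
  -- also `-2π ∫ |ψ|² ≤ 0`.
  have e5 : Q (-c) ≤ 0 := by
    have : Q (-c) = -(2 * Real.pi * c * ‖ψ (-c)‖ ^ 2) := by
      rw [hQ, ← Complex.normSq_eq_norm_sq, Complex.normSq_apply]
      simp [hDψ, Complex.mul_re, Complex.mul_im]; ring
    rw [this]
    have : 0 ≤ 2 * Real.pi * c * ‖ψ (-c)‖ ^ 2 := by positivity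
    linarith
  have e6 : ∫ η in Set.Ioi (-c), ‖ψ η‖ ^ 2 = 0 := by
    refine le_antisymm ?_ (integral_nonneg fun _ => by positivity)
    rw [e1, e2, e4, add_zero] at e3
    by_contra h
    have : 0 < 2 * Real.pi * ∫ η in Set.Ioi (-c), ‖ψ η‖ ^ 2 := by
      have := not_le.1 h; positivity
    linarith
  have := (setIntegral_eq_zero_iff_of_nonneg_ae (Eventually.of_forall fun η => by positivity)
    hi2.integrableOn).1 e6
  filter_upwards [this] with η hη
  simpa using hη

/-! ### Triviality of the homogeneous solutions -/

section Homogeneous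

variable {u : ℝ → ℝ} {l a : ℝ} {n : ℝ →ᵇ ℂ}

/-- On the Fourier side the primitive of `g = u n` contributes `ψ` and the multiplier removes `ψ` on
`η < -c`, so `n` is carried by `[-c, ∞)`. Parseval makes the virial integral purely imaginary,
because `x u |n|²` is real, and the virial identity then annihilates `ψ` on that half line. -/
theorem eq_zero_of_homogeneous (hl : 0 < l) (ha : 0 < a)
    (hw1 : Integrable fun x => (1 + |x|) ^ a * u x)
    (hw2 : MemLp (fun x => (((1 + |x|) ^ a * u x : ℝ) : ℂ)) 2)
    (hu : Integrable u) (hu2 : MemLp (fun x => (u x : ℂ)) 2)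
    (hn : ∀ x, n x = Complex.I * (∫ y in Set.Iic x, (u y : ℂ) * n y)
      - mulOp (gaugeSymbol l) (fun y => (u y : ℂ) * n y) x) : n = 0 := by
  obtain ⟨C, hC, hb⟩ := exists_decay hl ha hw1 hw2 hu hu2 hn
  have hz := integral_eq_zero_of_homogeneous hl hu hu2 hn
  set g : ℝ → ℂ := fun y => (u y : ℂ) * n y with hg
  set F : ℝ → ℂ := fun x => ∫ y in Set.Iic x, g y with hFdef
  have hgi : Integrable g := integrable_mul_bcf (integrable_coe hu) n
  have hg2 : MemLp g 2 := memLp_mul_bcf hu2 n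
  have hFb := norm_primitive_le hw1 hz hu ha le_rfl zero_le_one hC hb
  have hFc : Continuous F := by
    simpa only [volterra_zero] using continuous_volterra (k := 0) (by simp) hgi
  have hFi : Integrable F := by
    have := integrable_one_add_norm (E := ℝ) (μ := volume) (r := 1 + a) (by simpa using ha)
    exact (this.const_mul _).mono' hFc.aestronglyMeasurable (Eventually.of_forall hFb)
  have hF2 : MemLp F 2 := by
    have := memLp_two_rpow_neg (r := 1 + a) (by linarith)
    refine this.of_le_mul (c := C * ∫ y, ‖(1 + |y|) ^ a * u y‖) hFc.aestronglyMeasurable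
      (Eventually.of_forall fun x => (hFb x).trans ?_)
    rw [Complex.norm_real, Real.norm_of_nonneg (show 0 ≤ (1 + |x|) ^ (-(1 + a)) by positivity)]
  set ψ : ℝ → ℂ := fun η => Complex.I * 𝓕 F η with hψ
  have hD : ∀ η, 𝓕 g η = 2 * Real.pi * η * ψ η := fourier_eq_mul_fourier_primitive hgi hFi
  have hψc : Continuous ψ := continuous_const.mul (continuous_fourier hFi)
  have hψ2 : MemLp ψ 2 := (memLp_fourier hFi hF2).const_mul _
  -- `ηψ` is a multiple of `𝓕 g`, so both `ψ` and `ηψ` are square integrable.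
  have hψi : Integrable ψ := by
    refine integrable_of_memLp_two_mul hψ2 ?_
    refine ((memLp_fourier hgi hg2).const_mul ((2 * Real.pi : ℂ)⁻¹)).congr_norm
      ((Complex.measurable_ofReal.aestronglyMeasurable).mul hψ2.1)
      (Eventually.of_forall fun η => ?_)
    rw [hD]
    have : (Real.pi : ℂ) ≠ 0 := by exact_mod_cast Real.pi_ne_zero
    congr 1; field_simp
  set c := l / (2 * Real.pi) with hc
  have hc0 : 0 < c := by positivity
  have hFi' : Integrable (𝓕 F) := by
    refine (hψi.const_mul (-Complex.I)).congr (Eventually.of_forall fun η => ?_)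
    simp only [hψ, ← mul_assoc]; simp
  have hni : ∀ x, n x = 𝓕⁻ ((Set.Ici (-c)).indicator ψ) x := by
    intro x
    rw [hn x]
    have h1 : Complex.I * F x = 𝓕⁻ ψ x := by
      rw [hψ, fourierInv_fun_const_mul, hFi.fourierInv_fourier_eq hFi' hFc.continuousAt]
    have h2 : (fun η => gaugeSymbol l η * 𝓕 g η) = (Set.Iio (-c)).indicator ψ := by
      ext η
      by_cases h : η < -c
      · rw [Set.indicator_of_mem (show η ∈ Set.Iio (-c) from h), gaugeSymbol_of_lt h, hD]
        have h3 : (Real.pi : ℂ) ≠ 0 := by exact_mod_cast Real.pi_ne_zero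
        have h4 : (η : ℂ) ≠ 0 := by
          have : η ≠ 0 := by linarith
          exact_mod_cast this
        push_cast
        field_simp
      · rw [Set.indicator_of_notMem (show η ∉ Set.Iio (-c) from h), gaugeSymbol_of_not_lt h,
          zero_mul]
    rw [h1, mulOp, h2, sub_eq_iff_eq_add, ← fourierInv_fun_add
      (hψi.indicator measurableSet_Ici) (hψi.indicator measurableSet_Iio)]
    refine congrArg (fun f : ℝ → ℂ => 𝓕⁻ f x) (funext fun η => ?_)
    have := congrFun (Set.indicator_compl_add_self (Set.Iio (-c)) ψ) η
    rw [Set.compl_Iio] at this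
    exact this.symm
  -- This is where decay of order one is needed: `|x| |n|` is bounded, so `x g` is dominated by a
  -- multiple of `u` and `𝓕 g` is differentiable.
  have hxg : Integrable fun x : ℝ => x • g x := by
    refine (hu.norm.const_mul C).mono'
      (AEStronglyMeasurable.smul measurable_id.aestronglyMeasurable hgi.1)
      (Eventually.of_forall fun x => ?_)
    rw [norm_smul, hg, norm_mul, Complex.norm_real, Real.norm_eq_abs]
    have h1 := hb x
    have hx : 0 < 1 + |x| := by positivity
    rw [Real.rpow_neg_one, ← div_eq_mul_inv, le_div_iff₀ hx] at h1
    have h2 : |x| * ‖n x‖ ≤ C := by nlinarith [norm_nonneg (n x)]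
    calc |x| * (‖u x‖ * ‖n x‖) = (|x| * ‖n x‖) * ‖u x‖ := by ring
      _ ≤ _ := by gcongr
  have hder := Real.hasDerivAt_fourier hgi hxg
  set X : ℝ → ℂ := fun x => (-2 * ↑Real.pi * Complex.I * ↑x) • g x with hX
  have hXi : Integrable X := by
    refine (hxg.const_mul (-2 * ↑Real.pi * Complex.I)).congr (Eventually.of_forall fun x => ?_)
    simp only [hX, smul_eq_mul, Complex.real_smul]; ring
  -- `X` is `g` times `-2πix`, with transform `(𝓕 g)'`. By Parseval the integral equals `i ∫ 2πx u
  -- |n|²`.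
  have hzero : (∫ η in Set.Ioi (-c), conj (𝓕 X η) * ψ η).re = 0 := by
    have h1 := integral_conj_mul_fourierInv hXi (hψi.indicator measurableSet_Ici (s := Set.Ici (-c)))
    have h2 : ∫ x, conj (X x) * 𝓕⁻ ((Set.Ici (-c)).indicator ψ) x =
        Complex.I * ((∫ x, 2 * Real.pi * x * u x * Complex.normSq (n x) : ℝ) : ℂ) := by
      rw [← integral_complex_ofReal, ← integral_const_mul]
      congr 1; ext x
      rw [← hni, hX, hg]
      push_cast
      rw [Complex.normSq_eq_conj_mul_self]
      simp only [smul_eq_mul, map_mul, map_neg, Complex.conj_ofReal, Complex.conj_I, map_ofNat]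
      ring
    have h3 : ∫ η, conj (𝓕 X η) * (Set.Ici (-c)).indicator ψ η =
        ∫ η in Set.Ioi (-c), conj (𝓕 X η) * ψ η := by
      rw [← integral_Ici_eq_integral_Ioi, ← integral_indicator measurableSet_Ici]
      congr 1; ext η
      by_cases h : η ∈ Set.Ici (-c)
      · rw [Set.indicator_of_mem h, Set.indicator_of_mem h]
      · rw [Set.indicator_of_notMem h, Set.indicator_of_notMem h, mul_zero]
    rw [← h3, ← h1, h2]
    simp
  have hcoc : (atTop : Filter ℝ) ≤ cocompact ℝ := by
    rw [cocompact_eq_atBot_atTop]; exact le_sup_right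
  have hψ0 : Tendsto ψ atTop (𝓝 0) := by
    have := ((Real.zero_at_infty_fourier F).mono_left hcoc).const_mul Complex.I
    simpa using this
  have hfin := ae_eq_zero_of_virial hc0 hψc hψ2 hψi hψ0
    ((Real.zero_at_infty_fourier g).mono_left hcoc) hD hder (continuous_fourier hXi)
    (norm_fourier_le X) hzero
  ext x
  rw [hni, Real.fourierInv_eq]
  have : (fun v : ℝ => Real.fourierChar (inner ℝ v x) • (Set.Ici (-c)).indicator ψ v) =ᵐ[volume]
      fun _ => (0 : ℂ) := by
    rw [ae_restrict_iff' measurableSet_Ioi] at hfin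
    have hne : ∀ᵐ v : ℝ, v ≠ -c := by simp [ae_iff]
    filter_upwards [hfin, hne] with v hv hvc
    by_cases h : v ∈ Set.Ici (-c)
    · rw [Set.indicator_of_mem h, hv (lt_of_le_of_ne h hvc.symm), smul_zero]
    · rw [Set.indicator_of_notMem h, smul_zero]
  rw [integral_congr_ae this, integral_zero]
  rfl

end Homogeneous

/-! ### Weights -/

/-- The consequences of `u ∈ L²_s` that are used: `(1 + |x|)^a u ∈ L¹ ∩ L²`. -/
structure Admissible (u : ℝ → ℝ) (a : ℝ) : Prop where
  pos : 0 < a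
  weighted : Integrable fun x => (1 + |x|) ^ a * u x
  weighted_two : MemLp (fun x => (((1 + |x|) ^ a * u x : ℝ) : ℂ)) 2
  int : Integrable u
  two : MemLp (fun x => (u x : ℂ)) 2

/-- For the `L¹` bound, `(1+|x|)^{s-s₁} u` is the product of `(1+|x|)^s u ∈ L²` and `(1+|x|)^{-s₁}`,
which is in `L²` precisely because `s₁ > 1/2`. -/
theorem Admissible.of_memWeightedLp {s s₁ : ℝ} (hs₁ : 1 / 2 < s₁) (hs : s₁ < s) {u : ℝ → ℝ}
    (hu : MemWeightedLp 2 s u) : Admissible u (s - s₁) := by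
  have hpos : ∀ x : ℝ, 0 < 1 + |x| := fun x => by positivity
  have hm : AEStronglyMeasurable u := by
    have h1 : AEStronglyMeasurable (fun x : ℝ => (1 + |x|) ^ (-s)) :=
      Measurable.aestronglyMeasurable (by fun_prop)
    refine (h1.mul hu.1).congr (Eventually.of_forall fun x => ?_)
    simp only [Pi.mul_apply, smul_eq_mul]
    rw [← mul_assoc, ← Real.rpow_add (hpos x), neg_add_cancel, Real.rpow_zero, one_mul]
  have hus : MemLp (fun x => (((1 + |x|) ^ s * u x : ℝ) : ℂ)) 2 := hu.ofReal
  have hwm : AEStronglyMeasurable fun x => (1 + |x|) ^ (s - s₁) * u x :=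
    AEStronglyMeasurable.mul (Measurable.aestronglyMeasurable (by fun_prop)) hm
  have hle : ∀ x, ‖u x‖ ≤ ‖(1 + |x|) ^ (s - s₁) * u x‖ := fun x => by
    rw [norm_mul, Real.norm_of_nonneg (Real.rpow_nonneg (hpos x).le _)]
    refine le_mul_of_one_le_left (norm_nonneg _) (Real.one_le_rpow ?_ (by linarith))
    linarith [abs_nonneg x]
  have h1 : Integrable fun x => (1 + |x|) ^ (s - s₁) * u x := by
    have := (integrable_mul_of_memLp_two (memLp_two_rpow_neg hs₁) hus).re
    refine this.congr (Eventually.of_forall fun x => ?_)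
    simp only [← Complex.ofReal_mul]
    rw [RCLike.re_to_complex, Complex.ofReal_re, ← mul_assoc, ← Real.rpow_add (hpos x)]
    congr 2; ring
  have h2 : MemLp (fun x => (((1 + |x|) ^ (s - s₁) * u x : ℝ) : ℂ)) 2 := by
    refine hus.of_le (Complex.continuous_ofReal.comp_aestronglyMeasurable hwm)
      (Eventually.of_forall fun x => ?_)
    rw [Complex.norm_real, Complex.norm_real, norm_mul, norm_mul]
    gcongr
    rw [Real.norm_of_nonneg (Real.rpow_nonneg (hpos x).le _),
      Real.norm_of_nonneg (Real.rpow_nonneg (hpos x).le _)]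
    refine Real.rpow_le_rpow_of_exponent_le ?_ (by linarith)
    linarith [abs_nonneg x]
  exact ⟨sub_pos.2 hs, h1, h2, h1.mono hm (Eventually.of_forall hle),
    h2.of_le (Complex.continuous_ofReal.comp_aestronglyMeasurable hm)
      (Eventually.of_forall fun x => by simpa only [Complex.norm_real] using hle x)⟩

theorem Admissible.comp_neg {u : ℝ → ℝ} {a : ℝ} (h : Admissible u a) :
    Admissible (fun x => u (-x)) a := by
  have hmp := Measure.measurePreserving_neg (volume : Measure ℝ)
  refine ⟨h.pos, ?_, ?_, h.int.comp_neg, h.two.comp_measurePreserving hmp⟩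
  · simpa only [abs_neg] using h.weighted.comp_neg
  · have := h.weighted_two.comp_measurePreserving hmp
    refine this.ae_eq (Eventually.of_forall fun x => ?_)
    simp

/-- The growth allowed to `m` is compensated by the weight carried by `u`. Thus even an unbounded
candidate solution gives a convolution to which the `L¹ ∩ L²` theory applies. -/
theorem Admissible.mul_memLp_two {u : ℝ → ℝ} {a : ℝ} (h : Admissible u a) {m : ℝ → ℂ}
    (hm : MemWeightedLp ∞ (-a) m) :
    Integrable (fun x => (u x : ℂ) * m x) ∧ MemLp (fun x => (u x : ℂ) * m x) 2 := by
  have e : (fun x => (u x : ℂ) * m x) = fun x => (((1 + |x|) ^ a * u x : ℝ) : ℂ) *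
      (((1 + |x|) ^ (-a) : ℝ) • m x) := by
    ext x
    have hx : 0 < 1 + |x| := by positivity
    rw [Complex.real_smul, mul_comm ((1 + |x|) ^ a), mul_comm (((1 + |x|) ^ (-a) : ℝ) : ℂ),
      Complex.ofReal_mul, mul_assoc, mul_left_comm _ (m x), ← Complex.ofReal_mul,
      ← Real.rpow_add hx, add_neg_cancel, Real.rpow_zero, Complex.ofReal_one, mul_one]
  rw [e]
  exact ⟨(integrable_coe h.weighted).mul_of_top_left hm, hm.mul h.weighted_two⟩

/-! ### Solving the integral equation -/

/-- Kernels for which the convolution with `f ∈ L¹ ∩ L²` is a bounded continuous function. -/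
structure RegularKernel (G : ℝ → ℂ) : Prop where
  measurable : AEStronglyMeasurable G
  bound : ∃ C : ℝ, 0 ≤ C ∧ ∀ x ≠ 0, ‖G x‖ ≤ C * (1 + ‖singPart x‖)
  continuous : ∀ f : ℝ → ℂ, Integrable f → MemLp f 2 → Continuous (conv G f)

theorem RegularKernel.integrable {G f : ℝ → ℂ} (hG : RegularKernel G) (hf : Integrable f)
    (hf2 : MemLp f 2) (x : ℝ) : Integrable fun y => G (x - y) * f y := by
  obtain ⟨C, hC, hb⟩ := hG.bound
  refine ((integrable_one_add_singPart_mul hf hf2 x).const_mul C).mono'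
    ((hG.measurable.comp_measurePreserving
      (Measure.measurePreserving_sub_left volume x)).mul hf.1) ?_
  have hyx : ∀ᵐ y : ℝ, y ≠ x := by simp [ae_iff]
  filter_upwards [hyx] with y hy
  rw [norm_mul, ← mul_assoc]
  exact mul_le_mul_of_nonneg_right (hb _ (sub_ne_zero.2 hy.symm)) (norm_nonneg _)

section Solve

variable {u : ℝ → ℝ} {a : ℝ} {G g : ℝ → ℂ}

theorem solution_spec (h : UniquelySolvable u a G g) : IsSolution u a G g (solution u a G g) := by
  obtain ⟨m, hm, -⟩ := h
  have hex : ∃ m, IsSolution u a G g m := ⟨m, hm⟩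
  rw [solution, dif_pos hex]
  exact hex.choose_spec

theorem solution_ae_eq (h : UniquelySolvable u a G g) {m : ℝ → ℂ} (hm : IsSolution u a G g m) :
    solution u a G g =ᵐ[volume] m := by
  have hs := solution_spec h
  obtain ⟨m', -, hm'⟩ := h
  exact (hm' _ hs).trans (hm' _ hm).symm

theorem memWeightedLp_bcf (ha : 0 < a) (m : ℝ →ᵇ ℂ) : MemWeightedLp ∞ (-a) m := by
  have hm : AEStronglyMeasurable fun x : ℝ => ((1 + |x|) ^ (-a) : ℝ) • m x :=
    AEStronglyMeasurable.smul (f := fun x : ℝ => (1 + |x|) ^ (-a))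
      (Measurable.aestronglyMeasurable (by fun_prop)) m.continuous.aestronglyMeasurable
  refine memLp_top_of_bound hm ‖m‖ (Eventually.of_forall fun x => ?_)
  have hx : 0 ≤ 1 + |x| := by positivity
  rw [norm_smul, Real.norm_of_nonneg (Real.rpow_nonneg hx _)]
  calc _ ≤ 1 * ‖m‖ := by
        gcongr
        · exact Real.rpow_le_one_of_one_le_of_nonpos (by linarith [abs_nonneg x]) (by linarith)
        · exact m.norm_coe_le_norm x
    _ = _ := one_mul _

/-- If `1 - T` is invertible, where `T m = G * (u m)` on bounded continuous functions, then the
equation is uniquely solvable, and the solution is bounded and continuous. -/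
theorem uniquelySolvable_of_isUnit (hu : Admissible u a) (hG : RegularKernel G)
    {T : (ℝ →ᵇ ℂ) →L[ℂ] (ℝ →ᵇ ℂ)} (hT : ∀ m x, T m x = conv G (fun y => (u y : ℂ) * m y) x)
    (hU : IsUnit (1 - T)) {b m₀ : ℝ →ᵇ ℂ} (hb : ∀ x, b x = g x) (hm₀ : (1 - T) m₀ = b) :
    UniquelySolvable u a G g ∧ solution u a G g =ᵐ[volume] m₀ := by
  have hsol : IsSolution u a G g m₀ := by
    refine ⟨memWeightedLp_bcf hu.pos m₀, Eventually.of_forall fun x => ?_⟩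
    have h := DFunLike.congr_fun hm₀ x
    change m₀ x - T m₀ x = b x at h
    rw [hT, hb, sub_eq_iff_eq_add] at h
    exact h
  have huniq : ∀ m', IsSolution u a G g m' → m' =ᵐ[volume] m₀ := by
    rintro m ⟨hm, hme⟩
    obtain ⟨hf, hf2⟩ := hu.mul_memLp_two hm
    obtain ⟨hf', hf2'⟩ := hu.mul_memLp_two (memWeightedLp_bcf hu.pos m₀)
    set h : ℝ → ℂ := fun y => (u y : ℂ) * m y - (u y : ℂ) * m₀ y with hh
    have hhi : Integrable h := hf.sub hf'
    have hh2 : MemLp h 2 := hf2.sub hf2'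
    obtain ⟨C, hC, hbd⟩ := hG.bound
    -- The difference of two solutions is almost everywhere a convolution, hence bounded and
    -- continuous. So invertibility on bounded continuous functions gives uniqueness in the larger
    -- weighted space.
    let d : ℝ →ᵇ ℂ := BoundedContinuousFunction.ofNormedAddCommGroup (conv G h)
      (hG.continuous h hhi hh2) _ (norm_conv_le hC hbd hhi hh2)
    have hd : ∀ x, d x = conv G h x := fun _ => rfl
    have hmd : ∀ᵐ x, m x - m₀ x = d x := by
      filter_upwards [hme, hsol.2] with x hx hx'
      rw [hx, hx', hd, conv, add_sub_add_left_eq_sub,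
        ← integral_sub (hG.integrable hf hf2 x) (hG.integrable hf' hf2' x)]
      simp only [hh, mul_sub]
    have hTd : (1 - T) d = 0 := by
      ext x
      change d x - T d x = 0
      rw [hT, hd, sub_eq_zero, conv, conv]
      refine integral_congr_ae ?_
      filter_upwards [hmd] with y hy
      rw [← hy, hh]
      ring
    have hd0 : d = 0 := by
      obtain ⟨U, hU⟩ := hU
      have h1 : (U⁻¹.val * U.val) d = 0 := by
        change U⁻¹.val (U.val d) = 0
        rw [hU, hTd, map_zero]
      rwa [Units.inv_mul] at h1
    filter_upwards [hmd] with x hx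
    rw [hd0] at hx
    exact sub_eq_zero.1 hx
  exact ⟨⟨m₀, hsol, huniq⟩, solution_ae_eq ⟨m₀, hsol, huniq⟩ hsol⟩

end Solve

/-! ### The kernels are regular -/

theorem aestronglyMeasurable_kernelG {k : ℂ} (hk : ∀ r : ℝ, 0 ≤ r → k ≠ (r : ℂ)) :
    AEStronglyMeasurable (kernelG k) := by
  refine aestronglyMeasurable_of_tendsto_ae atTop (f := fun (n : ℕ) => truncG k n)
    (fun n => (stronglyMeasurable_truncG k n.cast_nonneg).aestronglyMeasurable) ?_
  have : ∀ᵐ y : ℝ, y ≠ 0 := by simp [ae_iff]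
  filter_upwards [this] with x hx
  exact (tendsto_truncG hk hx).comp tendsto_natCast_atTop_atTop

theorem regularKernel_kernelG {k : ℂ} (hk : ∀ r : ℝ, 0 ≤ r → k ≠ (r : ℂ)) :
    RegularKernel (kernelG k) := by
  refine ⟨aestronglyMeasurable_kernelG hk, ?_, fun f hf hf2 => ?_⟩
  · obtain ⟨C, hC0, hC⟩ := exists_norm_kernelG_le hk
    exact ⟨C, hC0.le, fun x hx => (hC x hx).2.trans (by gcongr; exact rpow_abs_le x)⟩
  · rw [funext (conv_kernelG hk hf hf2)]
    exact continuous_mulOp (memLp_symbolPos hk) hf hf2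

theorem neg_ofReal_ne {l : ℝ} (hl : 0 < l) : ∀ r : ℝ, 0 ≤ r → -(l : ℂ) ≠ (r : ℂ) := by
  intro r hr h
  have : -l = r := by exact_mod_cast h
  linarith

theorem aestronglyMeasurable_kernelGTilde {l : ℝ} (hl : 0 < l) :
    AEStronglyMeasurable (kernelGTilde l) := by
  refine ((aestronglyMeasurable_kernelG (neg_ofReal_ne hl)).comp_measurePreserving
    (Measure.measurePreserving_neg (volume : Measure ℝ))).neg.congr ?_
  have : ∀ᵐ y : ℝ, y ≠ 0 := by simp [ae_iff]
  filter_upwards [this] with x hx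
  rw [kernelGTilde_eq (ofReal_ne_of_nonpos hl) hx]
  rfl

theorem exists_norm_kernelGTilde_le {l : ℝ} (hl : 0 < l) :
    ∃ C : ℝ, 0 ≤ C ∧ ∀ x ≠ 0, ‖kernelGTilde l x‖ ≤ C * (1 + ‖singPart x‖) := by
  obtain ⟨C, hC0, hC⟩ := exists_norm_kernelG_le (neg_ofReal_ne hl)
  refine ⟨C, hC0.le, fun x hx => ?_⟩
  rw [kernelGTilde_eq (ofReal_ne_of_nonpos hl) hx, norm_neg]
  refine (hC (-x) (neg_ne_zero.2 hx)).2.trans ?_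
  rw [abs_neg]
  gcongr
  exact rpow_abs_le x

theorem integrable_kernelGTilde_mul {l : ℝ} (hl : 0 < l) {f : ℝ → ℂ} (hf : Integrable f)
    (hf2 : MemLp f 2) (x : ℝ) : Integrable fun y => kernelGTilde l (x - y) * f y :=
  RegularKernel.integrable ⟨aestronglyMeasurable_kernelGTilde hl, exists_norm_kernelGTilde_le hl,
    fun f hf hf2 => by
      rw [funext (conv_kernelGTilde (ofReal_ne_of_nonpos hl) hf hf2)]
      exact continuous_mulOp (memLp_symbolNeg (ofReal_ne_of_nonpos hl)) hf hf2⟩ hf hf2 x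

theorem conv_kernelGPlus {l : ℝ} (hl : 0 < l) {f : ℝ → ℂ} (hf : Integrable f)
    (hf2 : MemLp f 2) (x : ℝ) :
    conv (kernelGPlus l) f x = Complex.I * volterra l f x - mulOp (symbolNeg l) f x := by
  have e : ∀ y, (Set.Ioi 0).indicator (fun t => Complex.I * planeWave l t) (x - y) * f y =
      (Set.Iio x).indicator
        (fun y : ℝ => Complex.I * (Complex.exp (Complex.I * l * (x - y)) * f y)) y := by
    intro y
    by_cases h : y < x
    · rw [Set.indicator_of_mem (show x - y ∈ Set.Ioi (0:ℝ) from sub_pos.2 h),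
        Set.indicator_of_mem (show y ∈ Set.Iio x from h), planeWave]
      push_cast; ring
    · rw [Set.indicator_of_notMem (show x - y ∉ Set.Ioi (0:ℝ) by simpa using h),
        Set.indicator_of_notMem (show y ∉ Set.Iio x from h), zero_mul]
  have hv := (integrableOn_volterra (k := l) (by simp) hf x).const_mul Complex.I
  have hi : Integrable fun y =>
      (Set.Ioi 0).indicator (fun t => Complex.I * planeWave l t) (x - y) * f y := by
    simp only [e]
    exact ((IntegrableOn.mono_set hv Set.Iio_subset_Iic_self).integrable_indicator measurableSet_Iio)
  rw [conv]
  simp only [kernelGPlus, sub_mul]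
  rw [integral_sub hi (integrable_kernelGTilde_mul hl hf hf2 x),
    ← conv_kernelGTilde (ofReal_ne_of_nonpos hl) hf hf2]
  congr 1
  simp only [e]
  rw [integral_indicator measurableSet_Iio, ← integral_Iic_eq_integral_Iio, integral_const_mul]
  rfl

theorem regularKernel_kernelGPlus {l : ℝ} (hl : 0 < l) : RegularKernel (kernelGPlus l) := by
  refine ⟨?_, ?_, fun f hf hf2 => ?_⟩
  · refine AEStronglyMeasurable.sub ?_ (aestronglyMeasurable_kernelGTilde hl)
    exact ((continuous_const.mul (continuous_planeWave l)).measurable.indicator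
      measurableSet_Ioi).aestronglyMeasurable
  · obtain ⟨C, hC0, hC⟩ := exists_norm_kernelGTilde_le hl
    refine ⟨1 + C, by positivity, fun x hx => ?_⟩
    refine (norm_sub_le _ _).trans ?_
    rw [add_mul]
    refine add_le_add ?_ (hC x hx)
    refine (norm_indicator_le_norm_self _ _).trans ?_
    rw [norm_mul, Complex.norm_I, norm_planeWave]
    linarith [norm_nonneg (singPart x)]
  · rw [funext (conv_kernelGPlus hl hf hf2)]
    exact (continuous_const.mul (continuous_volterra (by simp) hf)).sub
      (continuous_mulOp (memLp_symbolNeg (ofReal_ne_of_nonpos hl)) hf hf2)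

/-! ### Size of the symbols -/

/-- Comparison with the Cauchy density, whose integral is `π/κ`. -/
theorem l2_le_of_norm_sq_le {f : ℝ → ℂ} (hf : MemLp f 2) {κ : ℝ} (hκ : 0 < κ)
    (h : ∀ η, ‖f η‖ ^ 2 ≤ (η ^ 2 + κ ^ 2)⁻¹) : l2 f ≤ Real.sqrt (Real.pi / κ) := by
  have e : ∀ η : ℝ, (η ^ 2 + κ ^ 2)⁻¹ = (κ ^ 2)⁻¹ * (1 + (η / κ) ^ 2)⁻¹ := by
    intro η; field_simp; ring
  have hi : Integrable fun η : ℝ => (η ^ 2 + κ ^ 2)⁻¹ := by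
    simp only [e]
    exact (integrable_inv_one_add_sq.comp_div hκ.ne').const_mul _
  have hint : ∫ η : ℝ, (η ^ 2 + κ ^ 2)⁻¹ = Real.pi / κ := by
    simp only [e]
    rw [integral_const_mul, Measure.integral_comp_div (fun η : ℝ => (1 + η ^ 2)⁻¹),
      integral_univ_inv_one_add_sq, abs_of_pos hκ, smul_eq_mul]
    field_simp
  refine Real.le_sqrt_of_sq_le ?_
  rw [l2_sq hf, ← hint]
  exact integral_mono_of_nonneg (Eventually.of_forall fun _ => by positivity) hi
    (Eventually.of_forall h)

/-- For `η > 0` and `Re k ≤ 0` the cross term in `|2πη - k|²` is nonnegative, which leaves at least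
`η² + |k|²`. -/
theorem l2_symbolPos_le {k : ℂ} (hk0 : k ≠ 0) (hre : k.re ≤ 0)
    (hk : ∀ r : ℝ, 0 ≤ r → k ≠ (r : ℂ)) :
    l2 (symbolPos k) ≤ Real.sqrt (Real.pi / ‖k‖) := by
  refine l2_le_of_norm_sq_le (memLp_symbolPos hk) (norm_pos_iff.2 hk0) fun η => ?_
  have hκ : 0 < ‖k‖ := norm_pos_iff.2 hk0
  by_cases h : η ∈ Set.Ioi (0:ℝ)
  · have hη : 0 < η := h
    rw [symbolPos, Set.indicator_of_mem h, norm_inv, inv_pow]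
    refine inv_anti₀ (by positivity) ?_
    rw [← Complex.normSq_eq_norm_sq, ← Complex.normSq_eq_norm_sq, Complex.normSq_apply,
      Complex.normSq_apply]
    simp only [Complex.sub_re, Complex.ofReal_re, Complex.sub_im, Complex.ofReal_im]
    have h1 : η ≤ 2 * Real.pi * η := by nlinarith [Real.pi_gt_three]
    nlinarith [mul_nonneg (neg_nonneg.2 hre) (hη.le.trans h1)]
  · rw [symbolPos, Set.indicator_of_notMem h, norm_zero, zero_pow two_ne_zero]
    exact inv_nonneg.2 (by positivity)

theorem l2_symbolNeg_le {k : ℂ} (hk0 : k ≠ 0) (hre : 0 ≤ k.re)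
    (hk : ∀ r : ℝ, r ≤ 0 → k ≠ (r : ℂ)) :
    l2 (symbolNeg k) ≤ Real.sqrt (Real.pi / ‖k‖) := by
  refine l2_le_of_norm_sq_le (memLp_symbolNeg hk) (norm_pos_iff.2 hk0) fun η => ?_
  have hκ : 0 < ‖k‖ := norm_pos_iff.2 hk0
  by_cases h : η ∈ Set.Iio (0:ℝ)
  · have hη : η < 0 := h
    rw [symbolNeg, Set.indicator_of_mem h, norm_inv, inv_pow]
    refine inv_anti₀ (by positivity) ?_
    rw [← Complex.normSq_eq_norm_sq, ← Complex.normSq_eq_norm_sq, Complex.normSq_apply,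
      Complex.normSq_apply]
    simp only [Complex.sub_re, Complex.ofReal_re, Complex.sub_im, Complex.ofReal_im]
    have h1 : 2 * Real.pi * η ≤ η := by nlinarith [Real.pi_gt_three]
    nlinarith [mul_nonneg hre (neg_nonneg.2 (h1.trans hη.le))]
  · rw [symbolNeg, Set.indicator_of_notMem h, norm_zero, zero_pow two_ne_zero]
    exact inv_nonneg.2 (by positivity)

theorem l2_gaugeSymbol_le {l : ℝ} (hl : 0 < l) :
    l2 (gaugeSymbol l) ≤ Real.sqrt (Real.pi / l) := by
  have h := l2_symbolNeg_le (k := l) (by exact_mod_cast hl.ne') (by simpa using hl.le)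
    (ofReal_ne_of_nonpos hl)
  rw [Complex.norm_real, Real.norm_of_nonneg hl.le] at h
  have := eLpNorm_comp_measurePreserving (p := 2)
    (memLp_symbolNeg (ofReal_ne_of_nonpos hl)).1
    (measurePreserving_add_right volume (l / (2 * Real.pi)))
  rw [l2, ← this] at h
  exact h

theorem norm_gaugeSymbol_le {l : ℝ} (hl : 0 < l) (η : ℝ) : ‖gaugeSymbol l η‖ ≤ 1 / l := by
  by_cases h : η < -(l / (2 * Real.pi))
  · rw [gaugeSymbol_of_lt h, Complex.norm_real, norm_inv, one_div]
    refine inv_anti₀ hl ?_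
    have h1 : l < 2 * Real.pi * -η := by
      rw [← div_lt_iff₀' (by positivity)]; linarith
    rw [Real.norm_eq_abs, abs_of_neg (by nlinarith)]
    linarith
  · rw [gaugeSymbol_of_not_lt h, norm_zero]
    positivity

/-! ### Solutions close to one -/

/-- The equation with inhomogeneity `1` is uniquely solvable and its solution is `ε`-close
to `1`. -/
def NearOne (u : ℝ → ℝ) (a : ℝ) (G : ℝ → ℂ) (ε : ℝ) : Prop :=
  UniquelySolvable u a G (fun _ => 1) ∧
    ∀ᵐ x ∂(volume : Measure ℝ), ‖solution u a G (fun _ => 1) x - 1‖ ≤ ε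

theorem isUnit_one_add_of_norm_le {S : (ℝ →ᵇ ℂ) →L[ℂ] (ℝ →ᵇ ℂ)} {δ : ℝ} (hS : ‖S‖ ≤ δ)
    (hδ : δ ≤ 1 / 2) : IsUnit (1 + S) := by
  have h : ‖-S‖ < 1 := by rw [norm_neg]; linarith
  have := (Units.oneSub (-S) h).isUnit
  simpa using this

/-- From `m - 1 = (b - 1) - S(m - 1) - S 1`: the middle term is absorbed on the left since `δ ≤
1/2`, which costs the factor `2`. -/
theorem norm_sub_one_le {S : (ℝ →ᵇ ℂ) →L[ℂ] (ℝ →ᵇ ℂ)} {δ ε : ℝ} (hS : ‖S‖ ≤ δ)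
    (hδ : δ ≤ 1 / 2) {m b : ℝ →ᵇ ℂ} (hb : ‖b - 1‖ ≤ ε) (hm : (1 + S) m = b) :
    ‖m - 1‖ ≤ 2 * (ε + δ) := by
  have e : m - 1 = (b - 1) - S (m - 1) - S 1 := by
    rw [← hm, map_sub]
    change m - 1 = m + S m - 1 - (S m - S 1) - S 1
    abel
  have h1 : ‖m - 1‖ ≤ ε + δ * ‖m - 1‖ + δ * 1 := by
    calc ‖m - 1‖ = ‖(b - 1) - S (m - 1) - S 1‖ := by rw [← e]
      _ ≤ ‖b - 1‖ + ‖S (m - 1)‖ + ‖S 1‖ :=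
          (norm_sub_le _ _).trans (add_le_add_left (norm_sub_le _ _) _)
      _ ≤ _ := by
          gcongr
          · exact S.le_of_opNorm_le hS _
          · refine S.le_of_opNorm_le_of_le hS ?_
            exact BoundedContinuousFunction.norm_le_of_nonempty.2 fun x => by simp
  have h2 : δ * ‖m - 1‖ ≤ 1 / 2 * ‖m - 1‖ := by gcongr
  linarith

section Upper

variable {u : ℝ → ℝ} {a : ℝ} {G : ℝ → ℂ}

/-- `R` acts as a preconditioner: `R(1 - T)` is a small perturbation of the identity, so `1 - T` is
invertible and its solution is as close to `1` as `R 1` is, up to the size of the perturbation. -/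
theorem nearOne_of_norm_le (hu : Admissible u a) (hG : RegularKernel G)
    {T : (ℝ →ᵇ ℂ) →L[ℂ] (ℝ →ᵇ ℂ)} (hT : ∀ m x, T m x = conv G (fun y => (u y : ℂ) * m y) x)
    {R S : (ℝ →ᵇ ℂ) →L[ℂ] (ℝ →ᵇ ℂ)} (hR : IsUnit R) (hRS : R * (1 - T) = 1 + S)
    {δ ε : ℝ} (hS : ‖S‖ ≤ δ) (hδ : δ ≤ 1 / 2) (hR1 : ‖R 1 - 1‖ ≤ ε) :
    NearOne u a G (2 * (ε + δ)) := by
  have hU : IsUnit (1 - T) := by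
    have := isUnit_one_add_of_norm_le hS hδ
    rw [← hRS] at this
    exact (hR.mul_left_iff).1 this
  obtain ⟨U, hU'⟩ := hU
  have hm : (1 - T) (U⁻¹.val 1) = 1 := by
    rw [← hU']
    change (U.val * U⁻¹.val) 1 = 1
    rw [Units.mul_inv]; rfl
  obtain ⟨h1, h2⟩ := uniquelySolvable_of_isUnit (g := fun _ => 1) hu hG hT ⟨U, hU'⟩
    (b := 1) (fun _ => rfl) hm
  refine ⟨h1, ?_⟩
  have h3 : ‖U⁻¹.val 1 - 1‖ ≤ 2 * (ε + δ) := by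
    refine norm_sub_one_le hS hδ hR1 ?_
    rw [← hRS]
    change R ((1 - T) (U⁻¹.val 1)) = R 1
    rw [hm]
  filter_upwards [h2] with x hx
  rw [hx]
  exact ((U⁻¹.val 1 - 1).norm_coe_le_norm x).trans h3

theorem isUnit_rOp (k : ℂ) (hk : 0 ≤ k.im) (hu : Integrable u) : IsUnit (rOp k hk u hu) :=
  ⟨⟨rOp k hk u hu, 1 - vOp k hk _ (integrable_coe hu), rOp_mul_one_sub_vOp k hk hu,
    one_sub_vOp_mul_rOp k hk hu⟩, rfl⟩

/-- Here `T = V - P` and `R = (1 - V)⁻¹`, so `R(1 - T) = 1 + RP`. The explicit formula for `R` makes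
`R 1 - 1` a unimodular factor times the oscillatory integral controlled by `ε`. -/
theorem nearOne_of_volterra (hu : Admissible u a) (hG : RegularKernel G) {k : ℂ} (hk : 0 ≤ k.im)
    {q : ℝ → ℂ} (hq : MemLp q 2)
    (hGc : ∀ f, Integrable f → MemLp f 2 → ∀ x, conv G f x = Complex.I * volterra k f x - mulOp q f x)
    {δ ε : ℝ} (hδ : (1 + ∫ y, ‖u y‖) * (l2 q * l2 (fun x => (u x : ℂ))) ≤ δ) (hδ2 : δ ≤ 1 / 2)
    (hε : ∀ x, ‖volterra k (fun y => (u y : ℂ) * phase (fun t => -u t) y) x‖ ≤ ε) :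
    NearOne u a G (2 * (ε + δ)) := by
  set V := vOp k hk _ (integrable_coe hu.int)
  set P := pOp q hq _ (integrable_coe hu.int) hu.two
  refine nearOne_of_norm_le hu hG (T := V - P) (fun m x => ?_) (isUnit_rOp k hk hu.int)
    (S := rOp k hk u hu.int * P) ?_ ?_ hδ2 ?_
  · rw [hGc _ (integrable_mul_bcf (integrable_coe hu.int) m) (memLp_mul_bcf hu.two m)]
    rfl
  · rw [sub_sub_eq_add_sub, add_sub_right_comm, mul_add, rOp_mul_one_sub_vOp]
  · refine (norm_mul_le _ _).trans (le_trans ?_ hδ)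
    exact mul_le_mul (norm_rOp_le k hk hu.int) (norm_pOp_le hq _ hu.two) (norm_nonneg _)
      (add_nonneg zero_le_one (integral_nonneg fun _ => norm_nonneg _))
  · refine BoundedContinuousFunction.norm_le_of_nonempty.2 fun x => ?_
    have : (rOp k hk u hu.int 1 - 1 : ℝ →ᵇ ℂ) x = phase u x * (Complex.I *
        volterra k (fun y => (u y : ℂ) * (phase (fun t => -u t) y * 1)) x) := by
      change (1 + phase u x * _) - 1 = _
      rw [add_sub_cancel_left]
      rfl
    rw [this, norm_mul, norm_mul, norm_phase, Complex.norm_I, one_mul, one_mul]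
    simpa only [mul_one] using hε x

theorem nearOne_of_symbolPos (hu : Admissible u a) {k : ℂ} (hk : ∀ r : ℝ, 0 ≤ r → k ≠ (r : ℂ))
    {δ : ℝ} (hδ : l2 (symbolPos k) * l2 (fun x => (u x : ℂ)) ≤ δ) (hδ2 : δ ≤ 1 / 2) :
    NearOne u a (kernelG k) (2 * (0 + δ)) := by
  set P := pOp (symbolPos k) (memLp_symbolPos hk) _ (integrable_coe hu.int) hu.two
  refine nearOne_of_norm_le hu (regularKernel_kernelG hk) (T := P) (fun m x => ?_) isUnit_one
    (S := -P) ?_ ?_ hδ2 ?_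
  · rw [conv_kernelG hk (integrable_mul_bcf (integrable_coe hu.int) m) (memLp_mul_bcf hu.two m)]
    rfl
  · rw [one_mul, sub_eq_add_neg]
  · rw [norm_neg]
    exact (norm_pOp_le _ _ hu.two).trans hδ
  · change ‖(1 : ℝ →ᵇ ℂ) - 1‖ ≤ 0
    rw [sub_self, norm_zero]

theorem integrable_mul_phase_neg (hu : Integrable u) :
    Integrable fun y => (u y : ℂ) * phase (fun t => -u t) y :=
  integrable_mul_bcf (integrable_coe hu) (phaseB (fun t => -u t) hu.neg)

theorem tendsto_sqrt_pi_div : Tendsto (fun κ : ℝ => Real.sqrt (Real.pi / κ)) atTop (𝓝 0) := by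
  have := (tendsto_const_nhds (x := Real.pi)).div_atTop tendsto_id
  simpa using this.sqrt

theorem exists_forall_nearOne (hu : Admissible u a) {ε : ℝ} (hε : 0 < ε) :
    ∃ K : ℝ, 0 < K ∧
      (∀ k : ℂ, (∀ r : ℝ, 0 ≤ r → k ≠ (r : ℂ)) → K ≤ ‖k‖ → (k.re ≤ 0 ∨ 0 < k.im) →
        NearOne u a (kernelG k) ε) ∧
      ∀ l : ℝ, 0 < l → K ≤ l → NearOne u a (kernelGPlus l) ε := by
  -- The final bound is `2 (ε/4 + δ)`, and `1/2` is the threshold for the absorption argument.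
  set δ := min (ε / 4) (1 / 2) with hδ
  have hδ0 : 0 < δ := by positivity
  have hδ2 : δ ≤ 1 / 2 := min_le_right _ _
  have hδε : δ ≤ ε / 4 := min_le_left _ _
  set M := (1 + ∫ y, ‖u y‖) * l2 (fun x => (u x : ℂ)) with hM
  have hN : 0 ≤ ∫ y, ‖u y‖ := integral_nonneg fun _ => norm_nonneg _
  have hL := l2_nonneg (fun x => (u x : ℂ))
  obtain ⟨K1, hK1, hv⟩ := exists_norm_volterra_le (integrable_mul_phase_neg hu.int)
    (show 0 < ε / 4 by positivity)
  have ht : Tendsto (fun κ => M * Real.sqrt (Real.pi / κ)) atTop (𝓝 0) := by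
    simpa using tendsto_sqrt_pi_div.const_mul M
  obtain ⟨K2, hK2⟩ := eventually_atTop.1 (ht.eventually (ge_mem_nhds hδ0))
  have key : ∀ {q : ℝ → ℂ} {κ : ℝ}, K2 ≤ κ → l2 q ≤ Real.sqrt (Real.pi / κ) →
      (1 + ∫ y, ‖u y‖) * (l2 q * l2 (fun x => (u x : ℂ))) ≤ δ := by
    intro q κ hκ hq
    refine le_trans ?_ (hK2 κ hκ)
    rw [hM, mul_comm (l2 q), ← mul_assoc]
    gcongr
  refine ⟨max K1 K2, lt_max_of_lt_left hK1, fun k hk hkK hor => ?_, fun l hl hlK => ?_⟩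
  · have hk0 : k ≠ 0 := by simpa using hk 0 le_rfl
    have hkK1 := (le_max_left _ _).trans hkK
    have hkK2 := (le_max_right _ _).trans hkK
    -- In the left half plane, below the real axis as well as above it, `G_k` has a small symbol. In
    -- the open first quadrant it is `G̃_k` that has one, and the Volterra form is used.
    rcases le_or_gt k.re 0 with hre | hre
    · refine (nearOne_of_symbolPos hu hk (δ := δ) (le_trans ?_
        (key hkK2 (l2_symbolPos_le hk0 hre hk))) hδ2).imp_right
        fun h => h.mono fun x hx => hx.trans (by linarith)
      exact le_mul_of_one_le_left (mul_nonneg (l2_nonneg _) hL) (by linarith)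
    · have him : 0 < k.im := hor.resolve_left (not_le.2 hre)
      have hk' : ∀ r : ℝ, r ≤ 0 → k ≠ (r : ℂ) := by rintro r - rfl; simp at him
      refine (nearOne_of_volterra hu (regularKernel_kernelG hk) him.le (memLp_symbolNeg hk')
        (fun f hf hf2 x => ?_) (key hkK2 (l2_symbolNeg_le hk0 hre.le hk')) hδ2
        (hv k him.le hkK1)).imp_right fun h => h.mono fun x hx => hx.trans (by linarith)
      rw [conv_kernelG hk hf hf2, ← mulOp_symbol_add_eq_volterra him hf hf2, add_sub_cancel_right]
  · have hln : ‖(l : ℂ)‖ = l := by rw [Complex.norm_real, Real.norm_of_nonneg hl.le]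
    have hs := l2_symbolNeg_le (k := l) (by exact_mod_cast hl.ne') (by simpa using hl.le)
      (ofReal_ne_of_nonpos hl)
    rw [hln] at hs
    refine (nearOne_of_volterra hu (regularKernel_kernelGPlus hl) (k := l) (by simp)
      (memLp_symbolNeg (ofReal_ne_of_nonpos hl)) (fun f hf hf2 x => conv_kernelGPlus hl hf hf2 x)
      (key ((le_max_right _ _).trans hlK) hs) hδ2
      (hv l (by simp) (by rw [hln]; exact (le_max_left _ _).trans hlK))).imp_right
      fun h => h.mono fun x hx => hx.trans (by linarith)

end Upper

/-! ### Reflection -/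

theorem kernelG_conj {k : ℂ} (hk : ∀ r : ℝ, 0 ≤ r → k ≠ (r : ℂ)) {x : ℝ} (hx : x ≠ 0) :
    kernelG (conj k) x = conj (kernelG k (-x)) := by
  refine Tendsto.limUnder_eq ?_
  refine ((Complex.continuous_conj.tendsto _).comp
    (tendsto_truncG hk (neg_ne_zero.2 hx))).congr' ?_
  filter_upwards [eventually_ge_atTop 0] with R hR
  simp only [Function.comp_apply, truncG, map_mul, intervalIntegral.integral_of_le hR]
  rw [← integral_conj]
  congr 1
  · simp [Complex.conj_ofNat]
  · congr 1; ext ξ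
    rw [map_div₀, map_sub, conj_planeWave, Complex.conj_ofReal]
    congr 1
    simp [planeWave]

theorem kernelGPlus_eq_conj {l : ℝ} (hl : 0 < l) {x : ℝ} (hx : x ≠ 0) :
    kernelGPlus l x = conj (kernelGMinus l (-x)) := by
  have h := kernelG_conj (neg_ofReal_ne hl) (x := -x) (neg_ne_zero.2 hx)
  rw [map_neg, Complex.conj_ofReal, neg_neg] at h
  rw [kernelGPlus, kernelGMinus, kernelGTilde_eq (ofReal_ne_of_nonpos hl) hx,
    kernelGTilde_eq (ofReal_ne_of_nonpos hl) (neg_ne_zero.2 hx), map_sub, map_neg, h, neg_neg]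
  congr 1
  by_cases h0 : 0 < x
  · rw [Set.indicator_of_mem (show x ∈ Set.Ioi (0:ℝ) from h0),
      Set.indicator_of_mem (show -x ∈ Set.Iio (0:ℝ) from neg_lt_zero.2 h0), map_mul, map_neg,
      Complex.conj_I, conj_planeWave, neg_neg]
    simp [planeWave]
  · rw [Set.indicator_of_notMem (show x ∉ Set.Ioi (0:ℝ) from h0),
      Set.indicator_of_notMem (show -x ∉ Set.Iio (0:ℝ) by simpa using h0), map_zero]

section Reflect

variable {u : ℝ → ℝ} {a : ℝ} {G G' m : ℝ → ℂ}

theorem IsSolution.reflect (hG : ∀ x ≠ 0, G' x = conj (G (-x)))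
    (hm : IsSolution u a G (fun _ => 1) m) :
    IsSolution (fun x => u (-x)) a G' (fun _ => 1) (fun x => conj (m (-x))) := by
  have hmp := Measure.measurePreserving_neg (volume : Measure ℝ)
  refine ⟨?_, ?_⟩
  · have h := (hm.1.comp_measurePreserving hmp).star
    refine h.ae_eq (Eventually.of_forall fun x => ?_)
    simp
  · filter_upwards [hmp.quasiMeasurePreserving.ae hm.2] with x hx
    rw [hx, map_add, map_one, ← integral_conj, ← integral_neg_eq_self]
    congr 1
    have hne : ∀ᵐ y : ℝ, y ≠ x := by simp [ae_iff]
    refine integral_congr_ae ?_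
    filter_upwards [hne] with y hy
    rw [hG _ (sub_ne_zero.2 hy.symm), map_mul, map_mul, Complex.conj_ofReal]
    congr 3
    ring

/-- Conjugation combined with `x ↦ -x` is an involution that exchanges the equations for `u` with
kernel `G` and for `u(-·)` with kernel `G'`. It preserves distance to `1` since `u` is real and `1`
is fixed. -/
theorem NearOne.reflect {ε : ℝ} (hG : ∀ x ≠ 0, G' x = conj (G (-x)))
    (h : NearOne (fun x => u (-x)) a G' ε) : NearOne u a G ε := by
  have hG' : ∀ x ≠ 0, G x = conj (G' (-x)) := fun x hx => by
    rw [hG _ (neg_ne_zero.2 hx), neg_neg, Complex.conj_conj]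
  have hmp := Measure.measurePreserving_neg (volume : Measure ℝ)
  obtain ⟨h1, h2⟩ := h
  have hs := (solution_spec h1).reflect hG'
  simp only [neg_neg] at hs
  have huniq : UniquelySolvable u a G (fun _ => 1) := by
    refine ⟨_, hs, fun m' hm' => ?_⟩
    have h3 := solution_ae_eq h1 (hm'.reflect hG)
    filter_upwards [hmp.quasiMeasurePreserving.ae h3] with x hx
    rw [hx, neg_neg, Complex.conj_conj]
  refine ⟨huniq, ?_⟩
  filter_upwards [solution_ae_eq huniq hs, hmp.quasiMeasurePreserving.ae h2] with x hx hx'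
  rw [hx, ← RCLike.norm_conj, map_sub, Complex.conj_conj, map_one]
  exact hx'

end Reflect

theorem eventually_nearOne {u : ℝ → ℝ} {a : ℝ} (hu : Admissible u a) {ε : ℝ} (hε : 0 < ε) :
    ∀ᶠ k in CutPlane.atInfinity, NearOne u a k.kernel ε := by
  obtain ⟨K1, -, h1, h1'⟩ := exists_forall_nearOne hu hε
  obtain ⟨K2, -, h2, h2'⟩ := exists_forall_nearOne hu.comp_neg hε
  refine ((eventually_ge_atTop (max K1 K2)).comap CutPlane.modulus).mono fun k hk => ?_
  have hk1 := (le_max_left _ _).trans hk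
  have hk2 := (le_max_right _ _).trans hk
  match k with
  | .inner k hk0 =>
    by_cases h : k.re ≤ 0 ∨ 0 < k.im
    · exact h1 k hk0 hk1 h
    · rw [not_or, not_le, not_lt] at h
      -- What remains has `Re k > 0` and `Im k ≤ 0`; equality in the latter is excluded because `k`
      -- is off `[0, ∞)`.
      have him : 0 < (conj k).im := by
        rw [Complex.conj_im, neg_pos]
        refine lt_of_le_of_ne h.2 fun h0 => hk0 k.re h.1.le ?_
        exact Complex.ext rfl (by simpa using h0)
      refine NearOne.reflect (G' := kernelG (conj k)) (fun x hx => kernelG_conj hk0 hx)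
        (h2 _ (fun r _ h' => ?_) ?_ (Or.inr him))
      · rw [h'] at him; simp at him
      · rw [RCLike.norm_conj]; exact hk2
  | .upper l hl => exact h1' l hl hk1
  | .lower l hl =>
    exact NearOne.reflect (fun x hx => kernelGPlus_eq_conj hl hx) (h2' l hl hk2)

theorem tendsto_jostOne {u : ℝ → ℝ} {a : ℝ} (hu : Admissible u a) :
    Tendsto (fun k : CutPlane => eLpNorm (fun x => jostOne u a k x - 1) ∞ volume)
      CutPlane.atInfinity (𝓝 0) := by
  rw [ENNReal.tendsto_nhds_zero]
  intro ε hε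
  obtain ⟨r, hr0, hrε⟩ := ENNReal.lt_iff_exists_nnreal_btwn.1 hε
  filter_upwards [eventually_nearOne hu (ε := r) (by exact_mod_cast hr0)] with k hk
  rw [eLpNorm_exponent_top]
  refine (eLpNormEssSup_le_of_ae_bound hk.2).trans ?_
  rw [ENNReal.ofReal_coe_nnreal]
  exact hrε.le

/-! ### Solutions on the upper edge of the cut -/

theorem volterra_planeWave_mul (l : ℝ) (f : ℝ → ℂ) (x : ℝ) :
    volterra l (fun y => planeWave l y * f y) x = planeWave l x * volterra 0 f x := by
  rw [volterra, volterra, ← integral_const_mul]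
  congr 1; ext y
  rw [mul_zero, zero_mul, Complex.exp_zero, one_mul, ← mul_assoc]
  congr 1
  rw [planeWave, planeWave, ← Complex.exp_add]
  ring_nf

/-- The plane wave as a bounded continuous function. -/
noncomputable def planeWaveB (l : ℝ) : ℝ →ᵇ ℂ :=
  BoundedContinuousFunction.ofNormedAddCommGroup (planeWave l) (continuous_planeWave l) 1
    (fun x => (norm_planeWave l x).le)

theorem planeWaveB_apply (l x : ℝ) : planeWaveB l x = planeWave l x := rfl

theorem norm_planeWaveB_le (l : ℝ) : ‖planeWaveB l‖ ≤ 1 :=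
  BoundedContinuousFunction.norm_ofNormedAddCommGroup_le _ zero_le_one _

theorem mOp_planeWave_mul_neg (l : ℝ) : mOp (planeWaveB l) * mOp (planeWaveB (-l)) = 1 := by
  ext m x
  change planeWave l x * (planeWave (-l) x * m x) = m x
  rw [← mul_assoc, mul_comm (planeWave l x), planeWave_neg_mul, one_mul]

theorem mOp_planeWave_neg_mul (l : ℝ) : mOp (planeWaveB (-l)) * mOp (planeWaveB l) = 1 := by
  simpa using mOp_planeWave_mul_neg (-l)

theorem isUnit_mOp_planeWaveB (l : ℝ) : IsUnit (mOp (planeWaveB l)) :=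
  ⟨⟨_, _, mOp_planeWave_mul_neg l, mOp_planeWave_neg_mul l⟩, rfl⟩

section Gauge

variable {u : ℝ → ℝ} {a : ℝ}

/-- The Volterra operator in the gauge `m = e^{iλx} n`. -/
noncomputable def vGauge (hu : Admissible u a) : (ℝ →ᵇ ℂ) →L[ℂ] (ℝ →ᵇ ℂ) :=
  vOp 0 le_rfl _ (integrable_coe hu.int)

/-- The inverse of `1 - vGauge`. -/
noncomputable def rGauge (hu : Admissible u a) : (ℝ →ᵇ ℂ) →L[ℂ] (ℝ →ᵇ ℂ) :=
  rOp 0 le_rfl u hu.int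

open Classical in
/-- The operator with kernel `e^{-iλ(x-y)} G̃_λ(x-y) u(y)`, for `λ > 0`. -/
noncomputable def pGauge (hu : Admissible u a) (l : ℝ) : (ℝ →ᵇ ℂ) →L[ℂ] (ℝ →ᵇ ℂ) :=
  if h : 0 < l then pOp (gaugeSymbol l) (memLp_gaugeSymbol h) _ (integrable_coe hu.int) hu.two
  else 0

theorem pGauge_of_pos (hu : Admissible u a) {l : ℝ} (hl : 0 < l) :
    pGauge hu l =
      pOp (gaugeSymbol l) (memLp_gaugeSymbol hl) _ (integrable_coe hu.int) hu.two := dif_pos hl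

theorem pGauge_apply (hu : Admissible u a) {l : ℝ} (hl : 0 < l) (n : ℝ →ᵇ ℂ) (x : ℝ) :
    pGauge hu l n x = mulOp (gaugeSymbol l) (fun y => (u y : ℂ) * n y) x := by
  rw [pGauge_of_pos hu hl, pOp_apply]

theorem one_sub_vGauge_mul_rGauge (hu : Admissible u a) : (1 - vGauge hu) * rGauge hu = 1 :=
  one_sub_vOp_mul_rOp 0 le_rfl hu.int

theorem rGauge_mul_one_sub_vGauge (hu : Admissible u a) : rGauge hu * (1 - vGauge hu) = 1 :=
  rOp_mul_one_sub_vOp 0 le_rfl hu.int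

theorem vGauge_apply (hu : Admissible u a) (n : ℝ →ᵇ ℂ) (x : ℝ) :
    vGauge hu n x = Complex.I * ∫ y in Set.Iic x, (u y : ℂ) * n y := by
  rw [vGauge, vOp_apply, volterra_zero]

/-- `RP` is compact, so injectivity is enough. Applying `1 - V` to a null vector turns it into a
solution of the homogeneous gauged equation. -/
theorem isUnit_one_add_rGauge_mul_pGauge (hu : Admissible u a) {l : ℝ} (hl : 0 < l) :
    IsUnit (1 + rGauge hu * pGauge hu l) := by
  refine isUnit_one_add_of_isCompactOperator ?_ fun n hn => ?_
  · rw [pGauge_of_pos hu hl]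
    exact (isCompactOperator_pOp _ _ _).clm_comp (rGauge hu)
  · refine eq_zero_of_homogeneous hl hu.pos hu.weighted hu.weighted_two hu.int hu.two fun x => ?_
    have h : (1 - vGauge hu) n + pGauge hu l n = 0 := by
      have h1 := congrArg (⇑(1 - vGauge hu)) hn
      rw [map_add, map_zero] at h1
      rw [← h1]
      congr 1
      change _ = ((1 - vGauge hu) * rGauge hu) (pGauge hu l n)
      rw [one_sub_vGauge_mul_rGauge]; rfl
    have h2 := DFunLike.congr_fun h x
    change n x - vGauge hu n x + pGauge hu l n x = 0 at h2
    rw [vGauge_apply, pGauge_apply hu hl] at h2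
    linear_combination h2

/-- The solution in the gauge `m = e^{iλx} n`, for the gauged inhomogeneity `b`. -/
noncomputable def gaugeSol (hu : Admissible u a) (l : ℝ) (b : ℝ →ᵇ ℂ) : ℝ →ᵇ ℂ :=
  Ring.inverse (1 + rGauge hu * pGauge hu l) (rGauge hu b)

theorem gaugeSol_spec (hu : Admissible u a) {l : ℝ} (hl : 0 < l) (b : ℝ →ᵇ ℂ) :
    (1 + rGauge hu * pGauge hu l) (gaugeSol hu l b) = rGauge hu b := by
  change ((1 + rGauge hu * pGauge hu l) * Ring.inverse (1 + rGauge hu * pGauge hu l))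
    (rGauge hu b) = _
  rw [Ring.mul_inverse_cancel _ (isUnit_one_add_rGauge_mul_pGauge hu hl)]
  rfl

theorem gaugeSol_eq (hu : Admissible u a) {l : ℝ} (hl : 0 < l) (b : ℝ →ᵇ ℂ) :
    gaugeSol hu l b = rGauge hu (b - pGauge hu l (gaugeSol hu l b)) := by
  rw [map_sub, ← gaugeSol_spec hu hl b]
  change _ = gaugeSol hu l b + rGauge hu (pGauge hu l (gaugeSol hu l b)) - _
  rw [add_sub_cancel_right]

/-- Multiplication by `e^{iλx}` intertwines `1 - T` with `1 - V + P = (1 - V)(1 + RP)`, a product of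
two invertible operators. -/
theorem uniquelySolvable_kernelGPlus (hu : Admissible u a) {l : ℝ} (hl : 0 < l) {g : ℝ → ℂ}
    {b : ℝ →ᵇ ℂ} (hb : ∀ x, g x = planeWave l x * b x) :
    UniquelySolvable u a (kernelGPlus l) g ∧ solution u a (kernelGPlus l) g =ᵐ[volume]
      fun x => planeWave l x * gaugeSol hu l b x := by
  have hq := memLp_symbolNeg (ofReal_ne_of_nonpos hl)
  have hlim : 0 ≤ (l : ℂ).im := by simp
  set T := vOp l hlim _ (integrable_coe hu.int) - pOp (symbolNeg l) hq _ (integrable_coe hu.int) hu.two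
    with hTdef
  have hT : ∀ (m : ℝ →ᵇ ℂ) x, T m x = conv (kernelGPlus l) (fun y => (u y : ℂ) * m y) x := by
    intro m x
    rw [conv_kernelGPlus hl (integrable_mul_bcf (integrable_coe hu.int) m)
      (memLp_mul_bcf hu.two m)]
    rfl
  have hE := mOp_planeWave_mul_neg l
  have hconj : (1 - T) * mOp (planeWaveB l) =
      mOp (planeWaveB l) * ((1 - vGauge hu) * (1 + rGauge hu * pGauge hu l)) := by
    have e1 : (1 - vGauge hu) * (1 + rGauge hu * pGauge hu l) =
        1 - vGauge hu + pGauge hu l := by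
      rw [mul_add, mul_one, ← mul_assoc, one_sub_vGauge_mul_rGauge, one_mul]
    rw [e1]
    ext n x
    have e2 : (fun y => (u y : ℂ) * (planeWave l y * n y)) =
        fun y => planeWave l y * ((u y : ℂ) * n y) := by ext y; ring
    change planeWave l x * n x - (Complex.I * volterra l (fun y => (u y : ℂ) * (planeWave l y * n y)) x
      - mulOp (symbolNeg l) (fun y => (u y : ℂ) * (planeWave l y * n y)) x) =
      planeWave l x * (n x - Complex.I * volterra 0 (fun y => (u y : ℂ) * n y) x + pGauge hu l n x)
    rw [e2, volterra_planeWave_mul, mulOp_planeWave_mul, pGauge_apply hu hl]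
    change _ - (_ - planeWave l x * mulOp (gaugeSymbol l) _ x) = _
    ring
  have hUG : IsUnit ((1 - vGauge hu) * (1 + rGauge hu * pGauge hu l)) :=
    IsUnit.mul ⟨⟨_, _, one_sub_vGauge_mul_rGauge hu, rGauge_mul_one_sub_vGauge hu⟩, rfl⟩
      (isUnit_one_add_rGauge_mul_pGauge hu hl)
  have hU : IsUnit (1 - T) := by
    have := (isUnit_mOp_planeWaveB l).mul hUG
    rw [← hconj] at this
    exact ((isUnit_mOp_planeWaveB l).mul_right_iff).1 this
  refine uniquelySolvable_of_isUnit hu (regularKernel_kernelGPlus hl) hT hU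
    (b := mOp (planeWaveB l) b) (fun x => (hb x).symm) (m₀ := mOp (planeWaveB l) (gaugeSol hu l b)) ?_
  change ((1 - T) * mOp (planeWaveB l)) (gaugeSol hu l b) = _
  rw [hconj]
  change mOp (planeWaveB l) ((1 - vGauge hu) ((1 + rGauge hu * pGauge hu l) (gaugeSol hu l b))) = _
  rw [gaugeSol_spec hu hl]
  change mOp (planeWaveB l) (((1 - vGauge hu) * rGauge hu) b) = _
  rw [one_sub_vGauge_mul_rGauge]
  rfl

theorem jostExpPlus_spec (hu : Admissible u a) {l : ℝ} (hl : 0 < l) :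
    UniquelySolvable u a (kernelGPlus l) (planeWave l) ∧ jostExpPlus u a l =ᵐ[volume]
      fun x => planeWave l x * gaugeSol hu l 1 x :=
  uniquelySolvable_kernelGPlus hu hl fun x => by simp

theorem jostOnePlus_spec (hu : Admissible u a) {l : ℝ} (hl : 0 < l) :
    UniquelySolvable u a (kernelGPlus l) (fun _ => 1) ∧ jostOnePlus u a l =ᵐ[volume]
      fun x => planeWave l x * gaugeSol hu l (planeWaveB (-l)) x :=
  uniquelySolvable_kernelGPlus hu hl fun x => by
    rw [planeWaveB_apply, mul_comm, planeWave_neg_mul]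

/-! ### Large `λ` -/

theorem norm_rGauge_le (hu : Admissible u a) : ‖rGauge hu‖ ≤ 1 + ∫ y, ‖u y‖ :=
  norm_rOp_le 0 le_rfl hu.int

theorem norm_pGauge_le (hu : Admissible u a) {l : ℝ} (hl : 0 < l) :
    ‖pGauge hu l‖ ≤ Real.sqrt (Real.pi / l) * l2 (fun x => (u x : ℂ)) := by
  rw [pGauge_of_pos hu hl]
  exact (norm_pOp_le _ _ _).trans
    (mul_le_mul_of_nonneg_right (l2_gaugeSymbol_le hl) (l2_nonneg _))

theorem tendsto_norm_pGauge (hu : Admissible u a) :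
    Tendsto (fun l => ‖pGauge hu l‖) atTop (𝓝 0) := by
  have h : Tendsto (fun l => Real.sqrt (Real.pi / l) * l2 (fun x => (u x : ℂ))) atTop (𝓝 0) := by
    simpa using tendsto_sqrt_pi_div.mul_const (l2 (fun x => (u x : ℂ)))
  refine squeeze_zero' (Eventually.of_forall fun _ => norm_nonneg _) ?_ h
  filter_upwards [eventually_gt_atTop 0] with l hl using norm_pGauge_le hu hl

theorem eventually_norm_gaugeSol_le (hu : Admissible u a) :
    ∀ᶠ l in atTop, 0 < l ∧ ∀ b, ‖gaugeSol hu l b‖ ≤ 2 * ((1 + ∫ y, ‖u y‖) * ‖b‖) := by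
  have ht : Tendsto (fun l => ‖rGauge hu‖ * ‖pGauge hu l‖) atTop (𝓝 0) := by
    simpa using (tendsto_norm_pGauge hu).const_mul ‖rGauge hu‖
  filter_upwards [ht.eventually (ge_mem_nhds (show (0:ℝ) < 1 / 2 by norm_num)),
    eventually_gt_atTop 0] with l h1 hl
  refine ⟨hl, fun b => ?_⟩
  have h2 := gaugeSol_eq hu hl b
  set n := gaugeSol hu l b
  have h3 : ‖n‖ ≤ (1 + ∫ y, ‖u y‖) * ‖b‖ + 1 / 2 * ‖n‖ := by
    calc ‖n‖ = ‖rGauge hu (b - pGauge hu l n)‖ := by rw [← h2]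
      _ ≤ ‖rGauge hu b‖ + ‖rGauge hu (pGauge hu l n)‖ := by rw [map_sub]; exact norm_sub_le _ _
      _ ≤ _ := by
          refine add_le_add ((rGauge hu).le_of_opNorm_le (norm_rGauge_le hu) b) ?_
          calc _ ≤ ‖rGauge hu‖ * (‖pGauge hu l‖ * ‖n‖) :=
                (rGauge hu).le_opNorm_of_le ((pGauge hu l).le_opNorm n)
            _ ≤ _ := by rw [← mul_assoc]; gcongr
  linarith

/-- The phase solves the pure Volterra equation with inhomogeneity `1`; this is where `e^{i∫u}`
enters the asymptotics. -/
theorem rGauge_one (hu : Admissible u a) : rGauge hu 1 = phaseB u hu.int := by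
  have h : (1 - vGauge hu) (phaseB u hu.int) = 1 := by
    ext x
    change phase u x - vGauge hu (phaseB u hu.int) x = 1
    rw [vGauge_apply, sub_eq_iff_eq_add]
    exact phase_eq hu.int x
  rw [← h]
  change (rGauge hu * (1 - vGauge hu)) _ = _
  rw [rGauge_mul_one_sub_vGauge]; rfl

theorem tendsto_jostExpPlus (hu : Admissible u a) :
    Tendsto (fun l : ℝ => eLpNorm (fun x => jostExpPlus u a l x -
        planeWave l x * Complex.exp (Complex.I * ((∫ t in Set.Iic x, u t : ℝ) : ℂ))) ∞ volume)
      atTop (𝓝 0) := by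
  set M := ‖rGauge hu‖ * (2 * ((1 + ∫ y, ‖u y‖) * ‖(1 : ℝ →ᵇ ℂ)‖)) with hM
  have ht : Tendsto (fun l => M * ‖pGauge hu l‖) atTop (𝓝 0) := by
    simpa using (tendsto_norm_pGauge hu).const_mul M
  have ht2 := ENNReal.tendsto_ofReal ht
  rw [ENNReal.ofReal_zero] at ht2
  refine tendsto_of_tendsto_of_tendsto_of_le_of_le' tendsto_const_nhds ht2
    (Eventually.of_forall fun _ => zero_le) ?_
  filter_upwards [eventually_norm_gaugeSol_le hu] with l ⟨hl, hb⟩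
  rw [eLpNorm_exponent_top]
  refine eLpNormEssSup_le_of_ae_bound ?_
  filter_upwards [(jostExpPlus_spec hu hl).2] with x hx
  have h1 := gaugeSol_eq hu hl 1
  set n := gaugeSol hu l 1
  have h2 : n x - phase u x = -(rGauge hu (pGauge hu l n)) x := by
    have := DFunLike.congr_fun h1 x
    rw [map_sub, rGauge_one] at this
    rw [this]
    change phase u x - rGauge hu (pGauge hu l n) x - phase u x = _
    ring
  rw [hx]
  change ‖planeWave l x * n x - planeWave l x * phase u x‖ ≤ _
  rw [← mul_sub, norm_mul, norm_planeWave, one_mul, h2, norm_neg]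
  refine ((rGauge hu (pGauge hu l n)).norm_coe_le_norm x).trans ?_
  calc _ ≤ ‖rGauge hu‖ * (‖pGauge hu l‖ * (2 * ((1 + ∫ y, ‖u y‖) * ‖(1 : ℝ →ᵇ ℂ)‖))) :=
        (rGauge hu).le_opNorm_of_le ((pGauge hu l).le_opNorm_of_le (hb 1))
    _ = _ := by rw [hM]; ring

/-! ### The scattering coefficients -/

theorem tendsto_setIntegral_Iic {E : Type*} [NormedAddCommGroup E] [NormedSpace ℝ E]
    {f : ℝ → E} (hf : Integrable f) :
    Tendsto (fun x => ∫ y in Set.Iic x, f y) atTop (𝓝 (∫ y, f y)) :=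
  (aecover_Iic tendsto_id).integral_tendsto_of_countably_generated hf

/-- The limit of `phase u` at infinity. -/
noncomputable def totalPhase (u : ℝ → ℝ) : ℂ := Complex.exp (Complex.I * ((∫ t, u t : ℝ) : ℂ))

theorem tendsto_phase (hu : Integrable u) : Tendsto (phase u) atTop (𝓝 (totalPhase u)) := by
  have h := (Complex.continuous_ofReal.tendsto _).comp (tendsto_setIntegral_Iic hu)
  exact (Complex.continuous_exp.tendsto _).comp (h.const_mul Complex.I)

theorem norm_totalPhase (u : ℝ → ℝ) : ‖totalPhase u‖ = 1 := by
  rw [totalPhase, mul_comm, Complex.norm_exp_ofReal_mul_I]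

/-- `R h - h` can be written in two ways at each `x`: as `V R h` from the Volterra equation, and as
`E V E⁻¹ h` from the explicit inverse. Letting `x → ∞` in the equality of the two gives the formula.
-/
theorem integral_mul_rGauge (hu : Admissible u a) (h : ℝ →ᵇ ℂ) :
    Complex.I * ∫ y, (u y : ℂ) * rGauge hu h y =
      Complex.I * totalPhase u * ∫ y, conj ((u y : ℂ) * phase u y) * h y := by
  have hi1 := integrable_mul_bcf (integrable_coe hu.int) (rGauge hu h)
  have hi2 : Integrable fun y => conj ((u y : ℂ) * phase u y) * h y :=
    integrable_mul_bcf ((Complex.conjLIE.integrable_comp_iff).2 (integrable_mul_phase hu.int)) h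
  have key : ∀ x, Complex.I * ∫ y in Set.Iic x, (u y : ℂ) * rGauge hu h y =
      Complex.I * phase u x * ∫ y in Set.Iic x, conj ((u y : ℂ) * phase u y) * h y := by
    intro x
    have h1 : ((1 - vGauge hu) * rGauge hu) h x = h x := by
      rw [one_sub_vGauge_mul_rGauge]; rfl
    change rGauge hu h x - vGauge hu (rGauge hu h) x = h x at h1
    have h2 : rGauge hu h x = h x + phase u x * (Complex.I *
        volterra 0 (fun y => (u y : ℂ) * (phase (fun t => -u t) y * h y)) x) := rfl
    rw [volterra_zero] at h2
    rw [vGauge_apply] at h1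
    have h3 : ∀ y, (u y : ℂ) * (phase (fun t => -u t) y * h y) =
        conj ((u y : ℂ) * phase u y) * h y := by
      intro y
      rw [phase_neg, map_mul, Complex.conj_ofReal, mul_assoc]
    simp only [h3] at h2
    linear_combination h2 - h1
  have l1 := (tendsto_setIntegral_Iic hi1).const_mul Complex.I
  have l2 := ((tendsto_phase hu.int).const_mul Complex.I).mul (tendsto_setIntegral_Iic hi2)
  exact tendsto_nhds_unique (l1.congr key) l2

theorem one_add_integral_phase (hu : Admissible u a) :
    1 + Complex.I * totalPhase u * ∫ y, conj ((u y : ℂ) * phase u y) = totalPhase u := by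
  have h := integral_mul_rGauge hu 1
  simp only [BoundedContinuousFunction.coe_one, Pi.one_apply, mul_one] at h
  rw [← h, rGauge_one]
  have h1 : Tendsto (phase u) atTop (𝓝 (1 + Complex.I * ∫ y, (u y : ℂ) * phase u y)) := by
    have := ((tendsto_setIntegral_Iic (integrable_mul_phase hu.int)).const_mul
      Complex.I).const_add 1
    exact this.congr fun x => (phase_eq hu.int x).symm
  exact tendsto_nhds_unique h1 (tendsto_phase hu.int)

/-- The contribution of `pGauge` to the scattering coefficients. -/
noncomputable def remainder (hu : Admissible u a) (l : ℝ) (b : ℝ →ᵇ ℂ) : ℂ :=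
  ∫ y, conj ((u y : ℂ) * phase u y) * pGauge hu l (gaugeSol hu l b) y

theorem integral_mul_gaugeSol (hu : Admissible u a) {l : ℝ} (hl : 0 < l) (b : ℝ →ᵇ ℂ) :
    Complex.I * ∫ y, (u y : ℂ) * gaugeSol hu l b y = Complex.I * totalPhase u *
      ((∫ y, conj ((u y : ℂ) * phase u y) * b y) - remainder hu l b) := by
  have hi : ∀ h : ℝ →ᵇ ℂ, Integrable fun y => conj ((u y : ℂ) * phase u y) * h y := fun h =>
    integrable_mul_bcf ((Complex.conjLIE.integrable_comp_iff).2 (integrable_mul_phase hu.int)) h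
  rw [remainder, ← integral_sub (hi _) (hi _)]
  conv_lhs => rw [gaugeSol_eq hu hl b]
  rw [integral_mul_rGauge]
  congr 2; ext y
  rw [← mul_sub]; rfl

theorem integral_mul_planeWave_neg {m : ℝ → ℂ} {l : ℝ} {n : ℝ →ᵇ ℂ}
    (h : m =ᵐ[volume] fun x => planeWave l x * n x) :
    ∫ x, (u x : ℂ) * m x * planeWave (-l) x = ∫ x, (u x : ℂ) * n x := by
  refine integral_congr_ae ?_
  filter_upwards [h] with x hx
  rw [hx]
  linear_combination (u x * n x) * planeWave_neg_mul l x

/-- Plancherel is applied to the pairing as a whole, so the symbol enters through its supremum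
`1/λ`. Bounding `P n` in sup norm first would give only `λ^{-1/2}`, too weak for the rate of `Γ`. -/
theorem norm_remainder_le (hu : Admissible u a) {l : ℝ} (hl : 0 < l) (b : ℝ →ᵇ ℂ) :
    ‖remainder hu l b‖ ≤
      1 / l * (l2 (fun x => (u x : ℂ)) ^ 2 * ‖gaugeSol hu l b‖) := by
  set n := gaugeSol hu l b with hn
  have hg2 : MemLp (fun y => (u y : ℂ) * phase u y) 2 := memLp_mul_bcf hu.two (phaseB u hu.int)
  have h := norm_integral_conj_mul_mulOp_le (memLp_gaugeSymbol hl) (by positivity : 0 ≤ 1 / l)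
    (norm_gaugeSymbol_le hl) (integrable_mul_bcf (integrable_coe hu.int) n)
    (memLp_mul_bcf hu.two n) (integrable_mul_phase hu.int) hg2
  have e : remainder hu l b = ∫ x, conj ((u x : ℂ) * phase u x) *
      mulOp (gaugeSymbol l) (fun y => (u y : ℂ) * n y) x := by
    simp only [remainder, pGauge_apply hu hl, hn]
  rw [e]
  refine h.trans ?_
  have hb1 : l2 (fun y => (u y : ℂ) * phase u y) ≤ l2 (fun x => (u x : ℂ)) := by
    have := l2_mul_le (g := fun y => (u y : ℂ) * phase u y) hu.two zero_le_one
      (fun x => by rw [norm_mul, norm_phase, mul_one, one_mul])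
    rwa [one_mul] at this
  have hb2 : l2 (fun y => (u y : ℂ) * n y) ≤ l2 (fun x => (u x : ℂ)) * ‖n‖ :=
    l2_mul_bcf_le hu.two n
  rw [sq, mul_assoc]
  gcongr
  · exact l2_nonneg _
  · exact l2_nonneg _

theorem scatteringGamma_sub (hu : Admissible u a) {l : ℝ} (hl : 0 < l) :
    scatteringGamma u a l - totalPhase u = -(Complex.I * totalPhase u * remainder hu l 1) := by
  have h := integral_mul_gaugeSol hu hl 1
  simp only [BoundedContinuousFunction.coe_one, Pi.one_apply, mul_one] at h
  rw [scatteringGamma, integral_mul_planeWave_neg (jostExpPlus_spec hu hl).2, h]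
  linear_combination one_add_integral_phase hu

/-- In the gauge the inhomogeneity `1` becomes `e^{-iλx}`, so the main term is a Fourier transform
at frequency `λ/2π`. -/
theorem scatteringBeta_eq (hu : Admissible u a) {l : ℝ} (hl : 0 < l) :
    scatteringBeta u a l = Complex.I * totalPhase u *
      (𝓕 (fun y => conj ((u y : ℂ) * phase u y)) (l / (2 * Real.pi)) -
        remainder hu l (planeWaveB (-l))) := by
  rw [scatteringBeta, integral_mul_planeWave_neg (jostOnePlus_spec hu hl).2,
    integral_mul_gaugeSol hu hl, fourier_eq_integral_planeWave]
  congr 3; ext y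
  rw [planeWaveB_apply, mul_comm]
  congr 1
  simp [planeWave]

theorem eventually_norm_remainder_le (hu : Admissible u a) :
    ∃ C : ℝ, 0 ≤ C ∧ ∀ᶠ l in atTop, 0 < l ∧ ∀ b, ‖b‖ ≤ 1 → ‖remainder hu l b‖ ≤ C * (1 / l) := by
  have hN : 0 ≤ ∫ y, ‖u y‖ := integral_nonneg fun _ => norm_nonneg _
  refine ⟨l2 (fun x => (u x : ℂ)) ^ 2 * (2 * ((1 + ∫ y, ‖u y‖) * 1)), by positivity, ?_⟩
  filter_upwards [eventually_norm_gaugeSol_le hu] with l ⟨hl, h⟩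
  refine ⟨hl, fun b hb => (norm_remainder_le hu hl b).trans ?_⟩
  rw [mul_comm]
  gcongr
  exact (h b).trans (by gcongr)

theorem isBigO_scatteringGamma (hu : Admissible u a) :
    (fun l : ℝ => scatteringGamma u a l -
        Complex.exp (Complex.I * ((∫ t, u t : ℝ) : ℂ))) =O[atTop] (fun l : ℝ => 1 / l) := by
  obtain ⟨C, hC, h⟩ := eventually_norm_remainder_le hu
  refine IsBigO.of_bound C ?_
  filter_upwards [h] with l ⟨hl, hr⟩
  change ‖scatteringGamma u a l - totalPhase u‖ ≤ _
  rw [scatteringGamma_sub hu hl, norm_neg, norm_mul, norm_mul, norm_totalPhase, Complex.norm_I,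
    one_mul, one_mul, Real.norm_of_nonneg (by positivity)]
  exact hr 1 (BoundedContinuousFunction.norm_le_of_nonempty.2 fun x => by simp)

theorem tendsto_scatteringBeta (hu : Admissible u a) :
    Tendsto (scatteringBeta u a) atTop (𝓝 0) := by
  obtain ⟨C, hC, h⟩ := eventually_norm_remainder_le hu
  have hpi := Real.pi_pos
  have hcoc : (atTop : Filter ℝ) ≤ cocompact ℝ := by
    rw [cocompact_eq_atBot_atTop]; exact le_sup_right
  have h1 := ((Real.zero_at_infty_fourier (fun y => conj ((u y : ℂ) * phase u y))).mono_left
    hcoc).comp (tendsto_id.atTop_div_const (show 0 < 2 * Real.pi by positivity))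
  have h2 : Tendsto (fun l => remainder hu l (planeWaveB (-l))) atTop (𝓝 0) := by
    rw [tendsto_zero_iff_norm_tendsto_zero]
    have h3 : Tendsto (fun l : ℝ => C * (1 / l)) atTop (𝓝 0) := by
      simpa using (tendsto_inv_atTop_zero (𝕜 := ℝ)).const_mul C
    refine squeeze_zero' (Eventually.of_forall fun _ => norm_nonneg _) ?_ h3
    filter_upwards [h] with l hl using hl.2 _ (norm_planeWaveB_le _)
  have h4 := (h1.sub h2).const_mul (Complex.I * totalPhase u)
  rw [sub_zero, mul_zero] at h4
  refine h4.congr' ?_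
  filter_upwards [eventually_gt_atTop 0] with l hl
  rw [scatteringBeta_eq hu hl]
  rfl

end Gauge

/-! ### Continuity in `λ` -/

section Continuity

variable {u : ℝ → ℝ} {a : ℝ}

/-- In the gauge `λ` enters the symbol only through its cutoff, so two symbols differ only between
the two cutoffs. -/
theorem norm_gaugeSymbol_sub_sq_le {l l' : ℝ} (hl : 0 < l) (hll : l ≤ l') (η : ℝ) :
    ‖gaugeSymbol l η - gaugeSymbol l' η‖ ^ 2 ≤
      (Set.Ico (-(l' / (2 * Real.pi))) (-(l / (2 * Real.pi)))).indicator (fun _ => (1 / l) ^ 2) η := by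
  have hpi := Real.pi_pos
  have hle : -(l' / (2 * Real.pi)) ≤ -(l / (2 * Real.pi)) := by gcongr
  by_cases h1 : η < -(l' / (2 * Real.pi))
  · rw [gaugeSymbol_of_lt h1, gaugeSymbol_of_lt (h1.trans_le hle), sub_self, norm_zero,
      zero_pow two_ne_zero]
    exact Set.indicator_nonneg (fun _ _ => by positivity) _
  · rw [gaugeSymbol_of_not_lt h1, sub_zero]
    by_cases h2 : η < -(l / (2 * Real.pi))
    · rw [Set.indicator_of_mem (Set.mem_Ico.2 ⟨not_lt.1 h1, h2⟩)]
      have := norm_gaugeSymbol_le hl η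
      gcongr
    · rw [gaugeSymbol_of_not_lt h2, norm_zero, zero_pow two_ne_zero]
      exact Set.indicator_nonneg (fun _ _ => by positivity) _

theorem l2_gaugeSymbol_sub_le {l l' : ℝ} (hl : 0 < l) (hll : l ≤ l') :
    l2 (gaugeSymbol l - gaugeSymbol l') ≤ 1 / l * Real.sqrt (l' - l) := by
  have hpi := Real.pi_pos
  have hm := (memLp_gaugeSymbol hl).sub (memLp_gaugeSymbol (hl.trans_le hll))
  refine (sq_le_sq₀ (l2_nonneg _) (by positivity)).1 ?_
  rw [l2_sq hm, mul_pow, Real.sq_sqrt (sub_nonneg.2 hll)]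
  have hi : Integrable ((Set.Ico (-(l' / (2 * Real.pi))) (-(l / (2 * Real.pi)))).indicator
      (fun _ : ℝ => (1 / l) ^ 2)) := by
    rw [integrable_indicator_iff measurableSet_Ico]
    exact integrableOn_const (by simp)
  refine (integral_mono_of_nonneg (Eventually.of_forall fun _ => by positivity) hi
    (Eventually.of_forall (norm_gaugeSymbol_sub_sq_le hl hll))).trans ?_
  rw [integral_indicator measurableSet_Ico, setIntegral_const, measureReal_def, Real.volume_Ico,
    ENNReal.toReal_ofReal, smul_eq_mul, mul_comm]
  · refine mul_le_mul_of_nonneg_left ?_ (by positivity)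
    have : -(l / (2 * Real.pi)) - -(l' / (2 * Real.pi)) = (l' - l) / (2 * Real.pi) := by ring
    rw [this]
    exact div_le_self (sub_nonneg.2 hll) (by nlinarith [Real.pi_gt_three])
  · have : l / (2 * Real.pi) ≤ l' / (2 * Real.pi) := by gcongr
    linarith

theorem norm_pGauge_sub_le (hu : Admissible u a) {l l' r : ℝ} (hr : 0 < r) (hl : r ≤ l)
    (hl' : r ≤ l') :
    ‖pGauge hu l - pGauge hu l'‖ ≤
      1 / r * Real.sqrt |l' - l| * l2 (fun x => (u x : ℂ)) := by
  wlog hll : l ≤ l' generalizing l l'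
  · rw [norm_sub_rev, abs_sub_comm]
    exact this hl' hl (le_of_not_ge hll)
  have h0 : 0 < l := hr.trans_le hl
  rw [pGauge_of_pos hu h0, pGauge_of_pos hu (h0.trans_le hll), pOp_sub,
    abs_of_nonneg (sub_nonneg.2 hll)]
  refine (norm_pOp_le _ _ _).trans (mul_le_mul_of_nonneg_right ?_ (l2_nonneg _))
  refine (l2_gaugeSymbol_sub_le h0 hll).trans ?_
  gcongr

theorem continuousAt_pGauge (hu : Admissible u a) {l : ℝ} (hl : 0 < l) :
    ContinuousAt (pGauge hu) l := by
  rw [ContinuousAt, tendsto_iff_norm_sub_tendsto_zero]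
  have ht : Tendsto (fun l' : ℝ => 1 / (l / 2) * Real.sqrt |l - l'| * l2 (fun x => (u x : ℂ)))
      (𝓝 l) (𝓝 0) := by
    have hc : Continuous fun l' : ℝ =>
        1 / (l / 2) * Real.sqrt |l - l'| * l2 (fun x => (u x : ℂ)) := by fun_prop
    simpa using hc.tendsto l
  refine squeeze_zero' (Eventually.of_forall fun _ => norm_nonneg _) ?_ ht
  filter_upwards [eventually_ge_nhds (show l / 2 < l by linarith)] with l' hl'
  exact norm_pGauge_sub_le hu (by positivity) hl' (by linarith)

theorem tendsto_integral_norm_mul {l₀ : ℝ} {w : ℝ → ℂ} (hw : Integrable w) :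
    Tendsto (fun l => ∫ y, ‖w y‖ * ‖planeWave (-l) y - planeWave (-l₀) y‖) (𝓝 l₀) (𝓝 0) := by
  have h := tendsto_integral_filter_of_dominated_convergence (μ := volume) (l := 𝓝 l₀)
    (F := fun l y => ‖w y‖ * ‖planeWave (-l) y - planeWave (-l₀) y‖) (f := fun _ => 0)
    (fun y => ‖w y‖ * 2) ?_ ?_ (hw.norm.mul_const 2) ?_
  · simpa using h
  · exact Eventually.of_forall fun l => hw.1.norm.mul
      ((continuous_planeWave _).sub (continuous_planeWave _)).norm.aestronglyMeasurable
  · refine Eventually.of_forall fun l => Eventually.of_forall fun y => ?_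
    rw [norm_mul, norm_norm, norm_norm]
    gcongr
    refine (norm_sub_le _ _).trans ?_
    rw [norm_planeWave, norm_planeWave]
    norm_num
  · refine Eventually.of_forall fun y => ?_
    have hc : Continuous fun l => ‖w y‖ * ‖planeWave (-l) y - planeWave (-l₀) y‖ := by
      unfold planeWave; fun_prop
    simpa using hc.tendsto l₀

theorem l2_add_le {f g : ℝ → ℂ} (hf : MemLp f 2) (hg : MemLp g 2) :
    l2 (fun x => f x + g x) ≤ l2 f + l2 g := by
  rw [l2, l2, l2, ← ENNReal.toReal_add hf.2.ne hg.2.ne]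
  exact ENNReal.toReal_mono (ENNReal.add_ne_top.2 ⟨hf.2.ne, hg.2.ne⟩)
    (eLpNorm_add_le hf.1 hg.1 (by norm_num))

/-- `R d - d` is bounded by the `L¹` norm of `u d`, so `u R d` is controlled by `u d` in `L¹ ∩ L²`
without the sup norm of `d`. This matters because plane waves do not depend continuously on `λ` in
sup norm. -/
theorem l2_mul_rGauge_le (hu : Admissible u a) (d : ℝ →ᵇ ℂ) :
    l2 (fun y => (u y : ℂ) * rGauge hu d y) ≤ l2 (fun y => (u y : ℂ) * d y) +
      (∫ y, ‖(u y : ℂ)‖ * ‖d y‖) * l2 (fun y => (u y : ℂ)) := by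
  set e : ℝ →ᵇ ℂ := rGauge hu d - d
  have he : ∀ x, ‖e x‖ ≤ ∫ y, ‖(u y : ℂ)‖ * ‖d y‖ := by
    intro x
    have h1 : e x = phase u x * (Complex.I *
        volterra 0 (fun y => (u y : ℂ) * (phase (fun t => -u t) y * d y)) x) := by
      change d x + _ - d x = _
      rw [add_sub_cancel_left]; rfl
    rw [h1, norm_mul, norm_phase, one_mul, norm_mul, Complex.norm_I, one_mul]
    refine (norm_volterra_le le_rfl (integrable_mul_bcf (integrable_coe hu.int)
      (phaseB (fun t => -u t) hu.int.neg * d)) x).trans (le_of_eq ?_)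
    congr 1; ext y
    rw [norm_mul, BoundedContinuousFunction.coe_mul, Pi.mul_apply, norm_mul, phaseB_apply,
      norm_phase, one_mul]
  have h2 : (fun y => (u y : ℂ) * rGauge hu d y) = fun y => (u y : ℂ) * d y + (u y : ℂ) * e y := by
    ext y
    rw [← mul_add]
    congr 1
    exact (add_sub_cancel (d y) (rGauge hu d y)).symm
  rw [h2]
  refine (l2_add_le (memLp_mul_bcf hu.two d) (memLp_mul_bcf hu.two e)).trans
    (add_le_add_right (l2_mul_le hu.two (integral_nonneg fun _ => by positivity) fun x => ?_) _)
  rw [norm_mul, mul_comm]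
  exact mul_le_mul_of_nonneg_right (he x) (norm_nonneg _)

/-- A difference of unimodular functions has modulus at most `2`, so its square is at most twice its
modulus. The claim reduces to the `L¹` statement with weight `u²`. -/
theorem tendsto_l2_mul_planeWave_sub (hu : Admissible u a) (l₀ : ℝ) :
    Tendsto (fun l => l2 (fun y => (u y : ℂ) * (planeWaveB (-l) - planeWaveB (-l₀)) y))
      (𝓝 l₀) (𝓝 0) := by
  have hi : Integrable fun y => (u y : ℂ) * (u y : ℂ) := integrable_mul_of_memLp_two hu.two hu.two
  have h := ((tendsto_integral_norm_mul (l₀ := l₀) hi).const_mul 2).sqrt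
  rw [mul_zero, Real.sqrt_zero] at h
  refine squeeze_zero (fun _ => l2_nonneg _) (fun l => ?_) h
  refine Real.le_sqrt_of_sq_le ?_
  rw [l2_sq (memLp_mul_bcf hu.two _), ← integral_const_mul]
  have hb : ∀ y, ‖planeWave (-l) y - planeWave (-l₀) y‖ ≤ 2 := fun y => by
    refine (norm_sub_le _ _).trans ?_
    rw [norm_planeWave, norm_planeWave]; norm_num
  refine integral_mono_of_nonneg (Eventually.of_forall fun _ => by positivity)
    (Integrable.const_mul (hi.norm.mul_bdd (c := 2)
      ((continuous_planeWave _).sub (continuous_planeWave _)).norm.aestronglyMeasurable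
      (Eventually.of_forall fun y => by rw [norm_norm]; exact hb y)) 2)
    (Eventually.of_forall fun y => ?_)
  change ‖(u y : ℂ) * (planeWave (-l) y - planeWave (-l₀) y)‖ ^ 2 ≤ _
  simp only [norm_mul, mul_pow]
  have h1 := hb y
  have h2 := norm_nonneg (planeWave (-l) y - planeWave (-l₀) y)
  calc ‖(u y : ℂ)‖ ^ 2 * ‖planeWave (-l) y - planeWave (-l₀) y‖ ^ 2
      ≤ ‖(u y : ℂ)‖ ^ 2 * (2 * ‖planeWave (-l) y - planeWave (-l₀) y‖) := by
        gcongr; nlinarith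
    _ = _ := by ring

/-- `P R` sees the plane wave only after multiplication by `u`, where its dependence on `λ` is
continuous in `L¹` and in `L²`. -/
theorem continuousAt_pGauge_rGauge_planeWave (hu : Admissible u a) {l₀ : ℝ} (hl₀ : 0 < l₀) :
    ContinuousAt (fun l => pGauge hu l (rGauge hu (planeWaveB (-l)))) l₀ := by
  rw [ContinuousAt, tendsto_iff_norm_sub_tendsto_zero]
  set d : ℝ → ℝ →ᵇ ℂ := fun l => planeWaveB (-l) - planeWaveB (-l₀) with hd
  have h1 : Tendsto (fun l => ‖pGauge hu l - pGauge hu l₀‖ * (‖rGauge hu‖ * 1) +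
      l2 (gaugeSymbol l₀) * (l2 (fun y => (u y : ℂ) * d l y) +
      (∫ y, ‖(u y : ℂ)‖ * ‖d l y‖) * l2 (fun y => (u y : ℂ)))) (𝓝 l₀) (𝓝 0) := by
    have e1 := ((tendsto_iff_norm_sub_tendsto_zero.1 (continuousAt_pGauge hu hl₀)).mul_const
      (‖rGauge hu‖ * 1))
    have e2 := tendsto_l2_mul_planeWave_sub hu l₀
    have e3 := (tendsto_integral_norm_mul (l₀ := l₀) (integrable_coe hu.int)).mul_const
      (l2 (fun y => (u y : ℂ)))
    have := e1.add ((e2.add e3).const_mul (l2 (gaugeSymbol l₀)))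
    rwa [zero_mul, zero_mul, add_zero, mul_zero, add_zero] at this
  refine squeeze_zero (fun _ => norm_nonneg _) (fun l => ?_) h1
  have e : pGauge hu l (rGauge hu (planeWaveB (-l))) -
      pGauge hu l₀ (rGauge hu (planeWaveB (-l₀))) =
      (pGauge hu l - pGauge hu l₀) (rGauge hu (planeWaveB (-l))) +
        pGauge hu l₀ (rGauge hu (d l)) := by
    rw [hd, map_sub, map_sub]
    change _ = (pGauge hu l _ - pGauge hu l₀ _) + _
    abel
  rw [e]
  refine (norm_add_le _ _).trans (add_le_add ?_ ?_)
  · exact ContinuousLinearMap.le_opNorm_of_le _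
      ((rGauge hu).le_opNorm_of_le (norm_planeWaveB_le _))
  · refine BoundedContinuousFunction.norm_le_of_nonempty.2 fun x => ?_
    rw [pGauge_apply hu hl₀]
    refine (norm_mulOp_le (memLp_gaugeSymbol hl₀) (integrable_mul_bcf (integrable_coe hu.int) _)
      (memLp_mul_bcf hu.two _) x).trans ?_
    exact mul_le_mul_of_nonneg_left (l2_mul_rGauge_le hu (d l)) (l2_nonneg _)

theorem isUnit_one_add_pGauge_mul_rGauge (hu : Admissible u a) {l : ℝ} (hl : 0 < l) :
    IsUnit (1 + pGauge hu l * rGauge hu) := by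
  have hR : IsUnit (rGauge hu) :=
    ⟨⟨_, _, rGauge_mul_one_sub_vGauge hu, one_sub_vGauge_mul_rGauge hu⟩, rfl⟩
  have h := (isUnit_one_add_rGauge_mul_pGauge hu hl).mul hR
  rw [show (1 + rGauge hu * pGauge hu l) * rGauge hu =
    rGauge hu * (1 + pGauge hu l * rGauge hu) by rw [add_mul, mul_add, one_mul, mul_one, mul_assoc]]
    at h
  exact (hR.mul_left_iff).1 h

/-- Applying `P` to `n = R(b - P n)` gives a closed equation for `P n` in which `b` occurs only as
`P R b`, a quantity continuous in `λ`. -/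
theorem pGauge_gaugeSol (hu : Admissible u a) {l : ℝ} (hl : 0 < l) (b : ℝ →ᵇ ℂ) :
    pGauge hu l (gaugeSol hu l b) =
      Ring.inverse (1 + pGauge hu l * rGauge hu) (pGauge hu l (rGauge hu b)) := by
  set p := pGauge hu l (gaugeSol hu l b) with hp
  have h : (1 + pGauge hu l * rGauge hu) p = pGauge hu l (rGauge hu b) := by
    have h1 := congrArg (pGauge hu l) (gaugeSol_eq hu hl b)
    rw [map_sub, map_sub, ← hp] at h1
    change p + pGauge hu l (rGauge hu p) = _
    exact eq_sub_iff_add_eq.1 h1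
  rw [← h]
  change _ = (Ring.inverse (1 + pGauge hu l * rGauge hu) * (1 + pGauge hu l * rGauge hu)) p
  rw [Ring.inverse_mul_cancel _ (isUnit_one_add_pGauge_mul_rGauge hu hl)]
  rfl

theorem continuousOn_remainder (hu : Admissible u a) :
    ContinuousOn (fun l => remainder hu l (planeWaveB (-l))) (Set.Ioi 0) := by
  intro l₀ hl₀
  refine ContinuousAt.continuousWithinAt ?_
  have hw : Integrable fun y => conj ((u y : ℂ) * phase u y) :=
    (Complex.conjLIE.integrable_comp_iff).2 (integrable_mul_phase hu.int)
  have h1 : ContinuousAt (fun l => Ring.inverse (1 + pGauge hu l * rGauge hu)) l₀ := by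
    obtain ⟨U, hU⟩ := isUnit_one_add_pGauge_mul_rGauge hu hl₀
    have := NormedRing.inverse_continuousAt (R := (ℝ →ᵇ ℂ) →L[ℂ] (ℝ →ᵇ ℂ)) U
    rw [hU] at this
    exact ContinuousAt.comp (f := fun l => 1 + pGauge hu l * rGauge hu) this
      (continuousAt_const.add ((continuousAt_pGauge hu hl₀).mul continuousAt_const))
  have h2 := h1.clm_apply (continuousAt_pGauge_rGauge_planeWave hu hl₀)
  have h3 := (pairing _ hw).continuous.continuousAt.comp h2
  refine h3.congr ?_
  filter_upwards [lt_mem_nhds hl₀] with l hl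
  rw [Function.comp_apply, ← pGauge_gaugeSol hu hl, pairing_apply]
  rfl

/-- Continuity gives measurability and boundedness on compact intervals, and the rate `1/λ` gives
square integrability at infinity. -/
theorem memLp_remainder (hu : Admissible u a) {r : ℝ} (hr : 0 < r) :
    MemLp (fun l => remainder hu l (planeWaveB (-l))) 2 (volume.restrict (Set.Ioi r)) := by
  have hc := continuousOn_remainder hu
  obtain ⟨C, hC, h⟩ := eventually_norm_remainder_le hu
  obtain ⟨L, hL⟩ := eventually_atTop.1 h
  set L' := max L 1
  obtain ⟨B, hB⟩ := (isCompact_Icc (a := r) (b := L')).exists_bound_of_continuousOn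
    (hc.mono fun x hx => hr.trans_le hx.1)
  have hB0 : 0 ≤ max B 0 := le_max_right _ _
  have hL1 : 1 ≤ L' := le_max_right _ _
  -- Comparison with `1/(1+λ)`. The first summand of the constant covers `λ ≤ L'`; the second covers
  -- `λ ≥ L'`, where `L' ≥ 1` gives `1 + λ ≤ 2λ`.
  refine ((memLp_two_rpow_neg (r := 1) (by norm_num)).restrict (Set.Ioi r)).of_le_mul
    (c := max B 0 * (1 + L') + 2 * C)
    ((hc.mono (Set.Ioi_subset_Ioi hr.le)).aestronglyMeasurable measurableSet_Ioi) ?_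
  filter_upwards [ae_restrict_mem measurableSet_Ioi] with l hl
  have hl0 : 0 < l := hr.trans hl
  rw [Complex.norm_real, Real.rpow_neg_one, abs_of_pos hl0, norm_inv,
    Real.norm_of_nonneg (by positivity : 0 ≤ 1 + l), ← div_eq_mul_inv, le_div_iff₀ (by positivity)]
  rcases le_total l L' with h1 | h1
  · have h2 := (hB l ⟨le_of_lt hl, h1⟩).trans (le_max_left B 0)
    have h3 : ‖remainder hu l (planeWaveB (-l))‖ * (1 + l) ≤ max B 0 * (1 + L') := by gcongr
    linarith
  · have h2 := (hL l ((le_max_left _ _).trans h1)).2 _ (norm_planeWaveB_le (-l))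
    have h3 : ‖remainder hu l (planeWaveB (-l))‖ * (1 + l) ≤ C * (1 / l) * (l + l) := by
      gcongr
      exact hL1.trans h1
    have h4 : C * (1 / l) * (l + l) = 2 * C := by field_simp; ring
    have h5 : 0 ≤ max B 0 * (1 + L') := by positivity
    linarith

theorem memLp_comp_div {f : ℝ → ℂ} (hf : MemLp f 2) (hc : Continuous f) {c : ℝ} (h : c ≠ 0) :
    MemLp (fun x => f (x / c)) 2 := by
  have hm : AEStronglyMeasurable fun x => f (x / c) := by
    refine Continuous.aestronglyMeasurable ?_
    fun_prop
  rw [memLp_two_iff_integrable_sq_norm hm]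
  exact ((memLp_two_iff_integrable_sq_norm hf.1).1 hf).comp_div h

theorem memLp_scatteringBeta (hu : Admissible u a) {r : ℝ} (hr : 0 < r) :
    MemLp (scatteringBeta u a) 2 (volume.restrict (Set.Ioi r)) := by
  have hg2 : MemLp (fun y => (u y : ℂ) * phase u y) 2 := memLp_mul_bcf hu.two (phaseB u hu.int)
  have hw : Integrable fun y => conj ((u y : ℂ) * phase u y) :=
    (Complex.conjLIE.integrable_comp_iff).2 (integrable_mul_phase hu.int)
  have hw2 : MemLp (fun y => conj ((u y : ℂ) * phase u y)) 2 := hg2.star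
  have h1 := memLp_comp_div (memLp_fourier hw hw2) (continuous_fourier hw)
    (c := 2 * Real.pi) (by positivity)
  have h2 := ((h1.restrict (Set.Ioi r)).sub (memLp_remainder hu hr)).const_mul
    (Complex.I * totalPhase u)
  refine h2.ae_eq ?_
  filter_upwards [ae_restrict_mem measurableSet_Ioi] with l hl
  rw [scatteringBeta_eq hu (hr.trans hl)]
  rfl

end Continuity

end BenjaminOno

theorem theorem6p3 (s s₁ : ℝ) (hs₁ : 1 / 2 < s₁) (hs : s₁ < s)
    (u : ℝ → ℝ) (hu : MemWeightedLp 2 s u) :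
    -- the Jost solutions in the claim exist and are unique
    (∀ᶠ k in CutPlane.atInfinity, UniquelySolvable u (s - s₁) k.kernel (fun _ => 1)) ∧
    (∀ l : ℝ, 0 < l →
      UniquelySolvable u (s - s₁) (kernelGPlus l) (fun _ => 1) ∧
      UniquelySolvable u (s - s₁) (kernelGPlus l) (planeWave l)) ∧
    -- `m_1(·,k) → 1` in `L^∞` as `k → ∞` in the cut plane
    Tendsto (fun k : CutPlane => eLpNorm (fun x => jostOne u (s - s₁) k x - 1) ∞ volume)
      CutPlane.atInfinity (𝓝 0) ∧
    -- `m_e(·,λ+0i) - e^{iλx} e^{i ∫_{-∞}^x u} → 0` in `L^∞` as `λ → ∞`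
    Tendsto (fun l : ℝ => eLpNorm (fun x => jostExpPlus u (s - s₁) l x -
        planeWave l x * Complex.exp (Complex.I * ((∫ t in Set.Iic x, u t : ℝ) : ℂ))) ∞ volume)
      atTop (𝓝 0) ∧
    -- `Γ(λ) - e^{i ∫ u} = O(1/λ)`
    (fun l : ℝ => scatteringGamma u (s - s₁) l -
        Complex.exp (Complex.I * ((∫ t, u t : ℝ) : ℂ))) =O[atTop] (fun l : ℝ => 1 / l) ∧
    -- `β ∈ L^2(a,∞)` for every `a > 0`, and `β(λ) → 0`
    (∀ a : ℝ, 0 < a → MemLp (scatteringBeta u (s - s₁)) 2 (volume.restrict (Set.Ioi a))) ∧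
    Tendsto (scatteringBeta u (s - s₁)) atTop (𝓝 0) := by
  have h := Admissible.of_memWeightedLp hs₁ hs hu
  -- The tolerance `1` is arbitrary here, since only the solvability half of `NearOne` is used.
  exact ⟨(eventually_nearOne h zero_lt_one).mono fun _ hk => hk.1,
    fun _ hl => ⟨(jostOnePlus_spec h hl).1, (jostExpPlus_spec h hl).1⟩,
    tendsto_jostOne h, tendsto_jostExpPlus h, isBigO_scatteringGamma h,
    fun _ ha => memLp_scatteringBeta h ha, tendsto_scatteringBeta h⟩
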